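/- Let $m\ge 1$ and let $\mathcal H_m=L^2(\mathbb R^m)$ be the Hilbert space of an $m$-mode system $A$, with canonical operators $x_j$, $p_j=-i\,\partial/\partial x_j$, annihilation operators $a_j=(x_j+ip_j)/\sqrt2$, total photon number $N=\sum_{j}a_j^\dagger a_j$, and displacement operators $D(\alpha)=\exp\big[\sum_j(\alpha_ja_j^\dagger-\alpha_j^*a_j)\big]$, $\alpha\in\mathbb C^m$. For $\lambda>0$ let $\mathcal N_\lambda(T)=\frac1{\pi\lambda}\int_{\mathbb C} d^2\alpha\, e^{-|\alpha|^2/\lambda}\,D(\alpha)\,T\,D(\alpha)^\dagger$ be the single-mode Gaussian noise channel, and let $\mathcal N_\lambda^{\otimes m}$ be $m$ copies of it, one acting on each mode. Braunstein--Kimble teleportation of $A$, with $m$ two-mode squeezed vacua of squeezing $r\ge0$ as a resource and with detection efficiency $\eta\in(0,1]$, transforms a state $\rho_{RA}$, where $R$ is an arbitrary quantum system, into $$\widetilde\rho_{RB}=\big(I^R\otimes\mathcal N_{\lambda(r,\eta)}^{\otimes m}\big)(\rho_{RA}),\qquad \lambda(r,\eta)=e^{-2r}+\eta^{-2}-1 .$$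 For $E\ge0$ put $\gamma_E=\sqrt E+\sqrt{E+1}$, and let $f(x,2m)=\frac{x^{m-1}e^{-x/2}}{2^m\Gamma(m)}$ be the chi-square density with $2m$ degrees of freedom. Let $\rho_{RB}$ denote the state $\rho_{RA}$ with $A$ identified with $B$, and let $\|\cdot\|_1$ be the trace norm. (a) Let $E\ge 0$ and let $\rho_{RA}$ be a state whose reduced state $\rho_A$ satisfies $\operatorname{Tr}[\rho_AN]-\sum_j|\operatorname{Tr}[\rho_Aa_j]|^2\le E$ (in particular $\operatorname{Tr}[\rho_A N]<\infty$). Then for all $r\ge0$ and $\eta\in(0,1]$ $$\big\|\widetilde\rho_{RB}-\rho_{RB}\big\|_1\le 2\int_0^\infty dx\,f(x,2m)\,\sin\Big(\min\Big\{\gamma_E\sqrt{\tfrac{\lambda(r,\eta)\,x}{2}},\tfrac\pi2\Big\}\Big)\le\frac{2\,\Gamma(m+1/2)}{(m-1)!}\,\gamma_E\sqrt{\lambda(r,\eta)} .$$ (b) For all $E\ge0$ and $\lambda>0$, the energy-constrained diamond norm $\|\mathcal L\|_\diamond^{N,E}=\sup\big\{\|(I^R\otimes\mathcal L)(\rho_{RA})\|_1:\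 R \text{ arbitrary},\ \rho_{RA}\text{ a state},\ \operatorname{Tr}[\rho_AN]\le E\big\}$ satisfies $$\big\|\mathcal N_\lambda^{\otimes m}-I\big\|_\diamond^{N,E}\le 2\int_0^\infty dx\,f(x,2m)\,\sin\Big(\min\Big\{\gamma_E\sqrt{\tfrac{\lambda x}{2}},\tfrac\pi2\Big\}\Big)\le\frac{2\,\Gamma(m+1/2)}{(m-1)!}\,\gamma_E\sqrt{\lambda} .$$ -/

import Mathlib

open MeasureTheory
open scoped InnerProductSpace ENNReal TensorProduct SchwartzMap LineDeriv

universe u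

noncomputable section

namespace BKTeleportation

/-! ## Operators on Hilbert spaces -/

section Operators

variable {K : Type*} [NormedAddCommGroup K] [InnerProductSpace ℂ K] [CompleteSpace K]

variable (K) in
/-- The index set of a fixed orthonormal (Hilbert) basis of `K`. -/
def basisIndex : Set K := (exists_hilbertBasis ℂ K).choose

variable (K) in
/-- A fixed orthonormal (Hilbert) basis of `K`. -/
def stdBasis : HilbertBasis (basisIndex K) ℂ K := (exists_hilbertBasis ℂ K).choose_spec.choose

/-- The trace `∑ᵢ ⟨eᵢ, P eᵢ⟩ ∈ [0, ∞]` of a positive operator `P`. -/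
def posTrace (P : K →L[ℂ] K) : ℝ≥0∞ :=
  ∑' i, ENNReal.ofReal (RCLike.re ⟪stdBasis K i, P (stdBasis K i)⟫_ℂ)

/-- The trace norm `‖T‖₁ = Tr |T| ∈ [0, ∞]`, where `|T| = √(T† T)`. -/
def traceNorm (T : K →L[ℂ] K) : ℝ≥0∞ := posTrace (CFC.abs T)

/-- Density operators: positive operators with trace one. -/
def IsState (ρ : K →L[ℂ] K) : Prop := ρ.IsPositive ∧ posTrace ρ = 1

end Operators

/-! ## Bipartite systems -/

section Bipartite

variable (R : Type*) [NormedAddCommGroup R] [InnerProductSpace ℂ R]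
variable (H : Type*) [NormedAddCommGroup H] [InnerProductSpace ℂ H]

/-- The Hilbert space tensor product `R ⊗ H`. -/
abbrev HTensor : Type _ := UniformSpace.Completion (R ⊗[ℂ] H)

variable {R} {H}

/-- The operator `|e⟩ ⊗ 1 : H → R ⊗ H`, `ψ ↦ e ⊗ ψ`. -/
def ketTensor (e : R) : H →L[ℂ] HTensor R H :=
  (UniformSpace.Completion.toComplL (𝕜 := ℂ) (E := R ⊗[ℂ] H)).comp (TensorProduct.mkL ℂ R H e)

theorem ketTensor_apply (e : R) (ψ : H) :
    ketTensor e ψ = ((e ⊗ₜ[ℂ] ψ : R ⊗[ℂ] H) : HTensor R H) := rfl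

variable [CompleteSpace H]

/-- The operator `(⟨e| ⊗ 1) T (|f⟩ ⊗ 1)` on `H`. -/
def slice (T : HTensor R H →L[ℂ] HTensor R H) (e f : R) : H →L[ℂ] H :=
  (ketTensor e).adjoint ∘L T ∘L ketTensor f

/-- The partial trace over `R`, i.e. the reduced operator on `H`. For a state the series converges
in operator norm (even in trace norm). -/
def partialTrace [CompleteSpace R] (T : HTensor R H →L[ℂ] HTensor R H) : H →L[ℂ] H :=
  ∑' i, slice T (stdBasis R i) (stdBasis R i)

/-- `X = (I ⊗ L)(T)`: the super-operator `L` acts on the factor `H` while nothing is done on `R`,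
that is, `(⟨e| ⊗ 1) X (|f⟩ ⊗ 1) = L ((⟨e| ⊗ 1) T (|f⟩ ⊗ 1))` for all `e, f`. -/
def IsAmpliation (L : (H →L[ℂ] H) → (H →L[ℂ] H)) (T X : HTensor R H →L[ℂ] HTensor R H) : Prop :=
  ∀ e f : R, slice X e f = L (slice T e f)

/-- There is at most one operator `(I ⊗ L)(T)`. -/
theorem IsAmpliation.unique {L : (H →L[ℂ] H) → (H →L[ℂ] H)}
    {T X Y : HTensor R H →L[ℂ] HTensor R H} (hX : IsAmpliation L T X) (hY : IsAmpliation L T Y) :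
    X = Y := by
  have key : ∀ (e f : R) (φ ψ : H),
      ⟪((e ⊗ₜ[ℂ] φ : R ⊗[ℂ] H) : HTensor R H), X ((f ⊗ₜ[ℂ] ψ : R ⊗[ℂ] H) : HTensor R H)⟫_ℂ =
      ⟪((e ⊗ₜ[ℂ] φ : R ⊗[ℂ] H) : HTensor R H), Y ((f ⊗ₜ[ℂ] ψ : R ⊗[ℂ] H) : HTensor R H)⟫_ℂ := by
    intro e f φ ψ
    have h : slice X e f = slice Y e f := (hX e f).trans (hY e f).symm
    have h2 := congrArg (fun A : H →L[ℂ] H => ⟪φ, A ψ⟫_ℂ) h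
    simpa only [slice, ContinuousLinearMap.comp_apply, ContinuousLinearMap.adjoint_inner_right,
      ketTensor_apply] using h2
  have key2 : ∀ (x y : R ⊗[ℂ] H),
      ⟪(x : HTensor R H), X (y : HTensor R H)⟫_ℂ = ⟪(x : HTensor R H), Y (y : HTensor R H)⟫_ℂ := by
    intro x y
    induction x using TensorProduct.induction_on with
    | zero => rw [UniformSpace.Completion.coe_zero, inner_zero_left, inner_zero_left]
    | add a b ha hb =>
      rw [UniformSpace.Completion.coe_add, inner_add_left, inner_add_left, ha, hb]
    | tmul e φ =>
      induction y using TensorProduct.induction_on with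
      | zero => rw [UniformSpace.Completion.coe_zero, map_zero, map_zero]
      | add a b ha hb =>
        rw [UniformSpace.Completion.coe_add, map_add, map_add, inner_add_right, inner_add_right,
          ha, hb]
      | tmul f ψ => exact key e f φ ψ
  ext y
  refine UniformSpace.Completion.induction_on y
    (isClosed_eq X.continuous Y.continuous) (fun b => ?_)
  refine ext_inner_left ℂ (fun v => ?_)
  refine UniformSpace.Completion.induction_on v
    (isClosed_eq (by fun_prop) (by fun_prop)) (fun a => key2 a b)

end Bipartite

/-! ## Continuous variable systems -/

section Modes

variable {m : ℕ}

variable (m) in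
/-- The Hilbert space `L²(ℝᵐ)` of an `m`-mode system. -/
abbrev ModeSpace : Type := Lp ℂ 2 (volume : Measure (EuclideanSpace ℝ (Fin m)))

variable (m) in
/-- Schwartz functions on `ℝᵐ`, the common domain of the canonical operators. -/
abbrev Schw : Type := 𝓢(EuclideanSpace ℝ (Fin m), ℂ)

/-- A Schwartz function as a vector of `L²(ℝᵐ)`. -/
def toVec (f : Schw m) : ModeSpace m := f.toLp 2 volume

/-- The position operator `x_j`. -/
def position (j : Fin m) : Module.End ℂ (Schw m) :=
  (SchwartzMap.smulLeftCLM ℂ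
    (fun x : EuclideanSpace ℝ (Fin m) => ((x j : ℝ) : ℂ)) : Schw m →L[ℂ] Schw m).toLinearMap

theorem position_apply (j : Fin m) (f : Schw m) (x : EuclideanSpace ℝ (Fin m)) :
    position j f x = (x j : ℂ) * f x := by
  have h : Function.HasTemperateGrowth
      (fun x : EuclideanSpace ℝ (Fin m) => ((x j : ℝ) : ℂ)) :=
    (Complex.ofRealCLM.comp (EuclideanSpace.proj (𝕜 := ℝ) j)).hasTemperateGrowth
  change SchwartzMap.smulLeftCLM ℂ
    (fun x : EuclideanSpace ℝ (Fin m) => ((x j : ℝ) : ℂ)) f x = _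
  rw [SchwartzMap.smulLeftCLM_apply_apply h, smul_eq_mul]

/-- The momentum operator `p_j = -i ∂/∂x_j`. -/
def momentum (j : Fin m) : Module.End ℂ (Schw m) :=
  (-Complex.I) • (LineDeriv.lineDerivOpCLM ℂ (Schw m)
    (EuclideanSpace.single j (1 : ℝ))).toLinearMap

/-- The annihilation operator `a_j = (x_j + i p_j) / √2`. -/
def annihilation (j : Fin m) : Module.End ℂ (Schw m) :=
  ((Real.sqrt 2 : ℝ) : ℂ)⁻¹ • (position j + Complex.I • momentum j)

/-- The creation operator `a_j† = (x_j - i p_j) / √2`. -/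
def creation (j : Fin m) : Module.End ℂ (Schw m) :=
  ((Real.sqrt 2 : ℝ) : ℂ)⁻¹ • (position j - Complex.I • momentum j)

variable (m) in
/-- The total photon number operator `N = ∑ⱼ aⱼ† aⱼ`. -/
def number : Module.End ℂ (Schw m) := ∑ j : Fin m, creation j * annihilation j

/-- The Gaussian `exp(-‖x‖²/2)` is a Schwartz function. -/
theorem gaussian_decay (k n : ℕ) : ∃ C : ℝ, ∀ x : EuclideanSpace ℝ (Fin m),
    ‖x‖ ^ k * ‖iteratedFDeriv ℝ n (fun y : EuclideanSpace ℝ (Fin m) =>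
      Real.exp (-‖y‖ ^ 2 / 2)) x‖ ≤ C := by
  have hsq : (fun y : EuclideanSpace ℝ (Fin m) => -‖y‖ ^ 2 / 2).HasTemperateGrowth := by
    have h := (Function.HasTemperateGrowth.const (E := EuclideanSpace ℝ (Fin m)) (-1 / 2 : ℝ)).mul
      (Function.hasTemperateGrowth_norm_sq (H := EuclideanSpace ℝ (Fin m)))
    have e : (fun y : EuclideanSpace ℝ (Fin m) => -‖y‖ ^ 2 / 2) =
        fun y : EuclideanSpace ℝ (Fin m) => (-1 / 2 : ℝ) * ‖y‖ ^ 2 := by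
      funext y
      ring
    rw [e]
    exact h
  obtain ⟨l, C, hC, hb⟩ := hsq.norm_iteratedFDeriv_le_uniform n
  refine ⟨(n.factorial : ℝ) * (C + 1) ^ n * ((k + l * n).factorial * Real.exp (3 / 2)), fun x => ?_⟩
  have hx : (0 : ℝ) ≤ ‖x‖ := norm_nonneg x
  have h1 : (1 : ℝ) ≤ (C + 1) * (1 + ‖x‖) ^ l := by
    have h2 : (1 : ℝ) ≤ (1 + ‖x‖) ^ l := one_le_pow₀ (by linarith)
    nlinarith
  have h2 : ‖iteratedFDeriv ℝ n (Real.exp ∘ fun y : EuclideanSpace ℝ (Fin m) => -‖y‖ ^ 2 / 2) x‖ ≤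
      n.factorial * Real.exp (-‖x‖ ^ 2 / 2) * ((C + 1) * (1 + ‖x‖) ^ l) ^ n := by
    refine norm_iteratedFDeriv_comp_le (N := ⊤) Real.contDiff_exp
      (((contDiff_norm_sq ℝ).neg).div_const 2) (mod_cast le_top) x ?_ ?_
    · intro i _
      rw [norm_iteratedFDeriv_eq_norm_iteratedDeriv, iteratedDeriv_eq_iterate,
        Real.iter_deriv_exp, Real.norm_eq_abs, Real.abs_exp]
    · intro i hi hin
      refine (hb i hin x).trans (le_trans ?_ (le_self_pow₀ h1 (by omega)))
      gcongr
      linarith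
  have h3 : (1 + ‖x‖) ^ (k + l * n) ≤ (k + l * n).factorial * Real.exp (1 + ‖x‖) := by
    have h4 := Real.pow_div_factorial_le_exp (x := 1 + ‖x‖) (by linarith) (k + l * n)
    rw [div_le_iff₀ (by positivity)] at h4
    linarith
  have h5 : Real.exp (1 + ‖x‖) * Real.exp (-‖x‖ ^ 2 / 2) ≤ Real.exp (3 / 2) := by
    rw [← Real.exp_add]
    refine Real.exp_le_exp.mpr ?_
    nlinarith [sq_nonneg (‖x‖ - 1)]
  calc ‖x‖ ^ k * ‖iteratedFDeriv ℝ n (fun y : EuclideanSpace ℝ (Fin m) =>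
        Real.exp (-‖y‖ ^ 2 / 2)) x‖
      ≤ (1 + ‖x‖) ^ k * (n.factorial * Real.exp (-‖x‖ ^ 2 / 2) *
          ((C + 1) * (1 + ‖x‖) ^ l) ^ n) := by
        refine mul_le_mul ?_ h2 (norm_nonneg _) (by positivity)
        gcongr
        linarith
    _ = n.factorial * (C + 1) ^ n * ((1 + ‖x‖) ^ (k + l * n) * Real.exp (-‖x‖ ^ 2 / 2)) := by
        rw [mul_pow, ← pow_mul, pow_add]
        ring
    _ ≤ n.factorial * (C + 1) ^ n * ((k + l * n).factorial * Real.exp (3 / 2)) := by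
        refine mul_le_mul_of_nonneg_left ?_ (by positivity)
        calc (1 + ‖x‖) ^ (k + l * n) * Real.exp (-‖x‖ ^ 2 / 2)
            ≤ ((k + l * n).factorial * Real.exp (1 + ‖x‖)) * Real.exp (-‖x‖ ^ 2 / 2) := by gcongr
          _ = (k + l * n).factorial * (Real.exp (1 + ‖x‖) * Real.exp (-‖x‖ ^ 2 / 2)) := by ring
          _ ≤ _ := by gcongr

variable (m) in
/-- The function `exp(-‖x‖²/2)` as an element of the Schwartz space. -/
def gaussian : 𝓢(EuclideanSpace ℝ (Fin m), ℝ) where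
  toFun x := Real.exp (-‖x‖ ^ 2 / 2)
  smooth' := Real.contDiff_exp.comp (((contDiff_norm_sq ℝ).neg).div_const 2)
  decay' := gaussian_decay

variable (m) in
/-- The vacuum state `|0⟩`, i.e. the function `π^(-m/4) exp(-‖x‖²/2)`. -/
def vacuum : Schw m :=
  ((Real.pi ^ (-(m : ℝ) / 4) : ℝ) : ℂ) •
    SchwartzMap.postcompCLM (𝕜 := ℝ) Complex.ofRealCLM (gaussian m)

theorem vacuum_apply (x : EuclideanSpace ℝ (Fin m)) :
    vacuum m x = ((Real.pi ^ (-(m : ℝ) / 4) * Real.exp (-‖x‖ ^ 2 / 2) : ℝ) : ℂ) := by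
  rw [Complex.ofReal_mul]
  rfl

/-- The Fock states `|n⟩ = ∏ⱼ (aⱼ†)^(nⱼ) / √(nⱼ!) |0⟩`. -/
def fock (n : Fin m → ℕ) : Schw m :=
  ((∏ j, Real.sqrt ((n j).factorial) : ℝ) : ℂ)⁻¹ •
    ((List.finRange m).map (fun j => creation j ^ n j)).prod (vacuum m)

/-- The mean photon number `Tr[ρ N] ∈ [0, ∞]` of a state, computed in the orthonormal basis of the
Fock states, which are the eigenvectors of `N`. -/
def meanPhotonNumber (ρ : ModeSpace m →L[ℂ] ModeSpace m) : ℝ≥0∞ :=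
  ∑' n : Fin m → ℕ,
    ENNReal.ofReal (RCLike.re ⟪toVec (fock n), ρ (toVec (number m (fock n)))⟫_ℂ)

/-- The mean amplitude `Tr[ρ aⱼ]` of a state, computed in the orthonormal basis of the Fock states.
The series converges absolutely if the mean photon number is finite. -/
def meanAmplitude (ρ : ModeSpace m →L[ℂ] ModeSpace m) (j : Fin m) : ℂ :=
  ∑' n : Fin m → ℕ, ⟪toVec (fock n), ρ (toVec (annihilation j (fock n)))⟫_ℂ

/-- The translation of `ℝᵐ` by `-√2 Re α`. -/
def shift (α : Fin m → ℂ) (x : EuclideanSpace ℝ (Fin m)) : EuclideanSpace ℝ (Fin m) :=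
  x - WithLp.toLp 2 (fun j => Real.sqrt 2 * (α j).re)

/-- The phase `exp(i ∑ⱼ (√2 Im αⱼ xⱼ - Re αⱼ Im αⱼ))`. -/
def phase (α : Fin m → ℂ) (x : EuclideanSpace ℝ (Fin m)) : ℂ :=
  Complex.exp (((∑ j, (Real.sqrt 2 * (α j).im * x j - (α j).re * (α j).im) : ℝ) : ℂ) * Complex.I)

theorem shift_measurePreserving (α : Fin m → ℂ) :
    MeasurePreserving (shift α) volume volume :=
  measurePreserving_sub_right volume _

theorem continuous_phase (α : Fin m → ℂ) : Continuous (phase α) := by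
  unfold phase
  fun_prop

theorem norm_phase (α : Fin m → ℂ) (x : EuclideanSpace ℝ (Fin m)) : ‖phase α x‖ = 1 :=
  Complex.norm_exp_ofReal_mul_I _

theorem memLp_displacement (α : Fin m → ℂ) (ψ : ModeSpace m) :
    MemLp (fun x => phase α x * ψ (shift α x)) 2 volume := by
  have h := (Lp.memLp ψ).comp_measurePreserving (shift_measurePreserving α)
  refine (memLp_congr_norm ((continuous_phase α).aestronglyMeasurable.mul h.1) h.1 ?_).mpr h
  filter_upwards with x
  simp [norm_phase]

/-- The displacement operator `D(α) = exp(∑ⱼ (αⱼ aⱼ† - αⱼ* aⱼ))` on `L²(ℝᵐ)`. The exponent is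
`∑ⱼ (i √2 Im αⱼ xⱼ - √2 Re αⱼ ∂/∂xⱼ)`, and it generates the unitary operator
`(D(α) ψ)(x) = exp(i ∑ⱼ (√2 Im αⱼ xⱼ - Re αⱼ Im αⱼ)) ψ(x - √2 Re α)`. -/
def displacementₗᵢ (α : Fin m → ℂ) : ModeSpace m →ₗᵢ[ℂ] ModeSpace m where
  toFun ψ := (memLp_displacement α ψ).toLp
  map_add' ψ φ := by
    rw [← MemLp.toLp_add]
    refine MemLp.toLp_congr _ _ ?_
    have h := (shift_measurePreserving α).quasiMeasurePreserving.ae_eq_comp (Lp.coeFn_add ψ φ)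
    filter_upwards [h] with x hx
    simp only [Function.comp_apply, Pi.add_apply] at hx ⊢
    rw [hx, mul_add]
  map_smul' c ψ := by
    rw [RingHom.id_apply, ← MemLp.toLp_const_smul]
    refine MemLp.toLp_congr _ _ ?_
    have h := (shift_measurePreserving α).quasiMeasurePreserving.ae_eq_comp (Lp.coeFn_smul c ψ)
    filter_upwards [h] with x hx
    simp only [Function.comp_apply, Pi.smul_apply, smul_eq_mul] at hx ⊢
    rw [hx]
    ring
  norm_map' ψ := by
    change ‖(memLp_displacement α ψ).toLp‖ = ‖ψ‖
    rw [Lp.norm_toLp, Lp.norm_def,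
      ← eLpNorm_comp_measurePreserving (Lp.aestronglyMeasurable ψ) (shift_measurePreserving α)]
    congr 1
    refine eLpNorm_congr_norm_ae ?_
    filter_upwards with x
    simp [norm_phase]

/-- The displacement operator `D(α)` as a bounded operator. -/
def displacement (α : Fin m → ℂ) : ModeSpace m →L[ℂ] ModeSpace m :=
  (displacementₗᵢ α).toContinuousLinearMap

theorem displacement_apply_ae (α : Fin m → ℂ) (ψ : ModeSpace m) :
    displacement α ψ =ᵐ[volume] fun x => phase α x * ψ (shift α x) :=
  (memLp_displacement α ψ).coeFn_toLp

/-- The displacement channel `𝒟_α(T) = D(α) T D(α)†`. -/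
def displacementChannel (α : Fin m → ℂ) (T : ModeSpace m →L[ℂ] ModeSpace m) :
    ModeSpace m →L[ℂ] ModeSpace m :=
  displacement α ∘L T ∘L (displacement α).adjoint

/-- The single-mode Gaussian noise channel `𝒩_λ` applied to the `j`-th mode:
`T ↦ 1/(πλ) ∫ d²a exp(-|a|²/λ) 𝒟_a(T)`, where `𝒟_a` displaces only the `j`-th mode. For a trace
class operator `T` the integrand is norm continuous. -/
def modeNoise (lam : ℝ) (j : Fin m) (T : ModeSpace m →L[ℂ] ModeSpace m) :
    ModeSpace m →L[ℂ] ModeSpace m :=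
  (Real.pi * lam)⁻¹ • ∫ a : ℂ, Real.exp (-‖a‖ ^ 2 / lam) • displacementChannel (Pi.single j a) T

/-- The channel `𝒩_λ^{⊗m}`: the single-mode Gaussian noise channel is applied to each mode. -/
def noiseChannel (lam : ℝ) (T : ModeSpace m →L[ℂ] ModeSpace m) : ModeSpace m →L[ℂ] ModeSpace m :=
  (List.finRange m).foldr (fun j S => modeNoise lam j S) T

/-- The energy-constrained diamond norm `‖L‖_⋄^{N,E}` of a super-operator `L`: the supremum of
`‖(I ⊗ L)(ρ)‖₁` over all states `ρ` of `R ⊗ L²(ℝᵐ)`, for arbitrary `R`, whose reduced state has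
mean photon number at most `E`. As `(I ⊗ L)(ρ)` is unique, the infimum has one term; it is `∞` if
`(I ⊗ L)(ρ)` does not exist. -/
def ecDiamondNorm (L : (ModeSpace m →L[ℂ] ModeSpace m) → (ModeSpace m →L[ℂ] ModeSpace m))
    (E : ℝ) : ℝ≥0∞ :=
  ⨆ (R : Type u) (_ : NormedAddCommGroup R) (_ : InnerProductSpace ℂ R) (_ : CompleteSpace R)
    (ρ : HTensor R (ModeSpace m) →L[ℂ] HTensor R (ModeSpace m)) (_ : IsState ρ)
    (_ : meanPhotonNumber (partialTrace ρ) ≤ ENNReal.ofReal E),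
    ⨅ (X : HTensor R (ModeSpace m) →L[ℂ] HTensor R (ModeSpace m)) (_ : IsAmpliation L ρ X),
      traceNorm X

/-- The noise parameter `λ(r, η) = e^{-2r} + (1 - η²)/η²` of Braunstein–Kimble teleportation. -/
def noiseParameter (r η : ℝ) : ℝ := Real.exp (-2 * r) + (1 - η ^ 2) / η ^ 2

/-- `γ_E = √E + √(E+1)`. -/
def gammaE (E : ℝ) : ℝ := Real.sqrt E + Real.sqrt (E + 1)

/-- The chi-square density `f(x, 2m) = x^(m-1) e^(-x/2) / (2^m Γ(m))`. -/
def chiSqDensity (m : ℕ) (x : ℝ) : ℝ :=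
  x ^ (m - 1) * Real.exp (-x / 2) / (2 ^ m * Real.Gamma m)

end Modes

end BKTeleportation

end

noncomputable section

namespace BKTeleportation

/-! ### Oscillator algebra and completeness of the Fock basis -/

section Ladder

variable {m : ℕ}

/-! ### Ladder operators on Schwartz functions -/

/-! The channel is an average of displacements `D(α)` over a Gaussian `α`, so by convexity of the
trace norm it suffices to bound, for a fixed `α`, how far `1 ⊗ D(α)` moves a state whose centred
energy is at most `E`. The claim is that it moves it by at most `2 sin(min(γ_E |α|, π/2))`. Since
`|α|²` is `λ/2` times a chi-square variable with `2m` degrees of freedom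
(`integral_ampl_modesMeasure`), averaging gives the integral in the theorem. The closed form follows
from `sin t ≤ t` and a Gamma integral.

The estimate for fixed `α` is a quantum speed limit. For a unit vector `v`, the group `V_t =
exp(-itc) D(tα)` has constant speed `‖(G - ic) v‖`, where `G` generates `D(tα)`. Global phases do
not matter for states, so `c` is free. With `c = 2 Im ∑ αⱼ μⱼ*` the operator `G - ic` becomes `∑ αⱼ
(aⱼ - μⱼ)† - ∑ αⱼ* (aⱼ - μⱼ)`. If `e = ∑ ‖(aⱼ - μⱼ) v‖²`, the second sum has norm at most `|α| √e`
on `v` by Cauchy-Schwarz, and the commutation relations then give at most `|α| √(e + 1)` for the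
first (`norm_raising_sq`). The speed is thus at most `|α| γ_e`. The angle on the unit sphere grows
no faster than this (`cos_le_inner_of_group`), and two vectors at angle at most `δ ≤ π/2` define
pure states at trace distance at most `2 sin δ`.

A mixed state is written as `∑ |vₖ⟩⟨vₖ|`. All `vₖ` are centred at the same `μⱼ = Tr[ρ aⱼ]`, so that
their energies add up to `Tr[ρN] - ∑ |Tr[ρ aⱼ]|² ≤ E` (`IsDecomposition.hasSum_vecEnergy`). Because
`E ↦ sin(min(γ_E r, π/2))` is concave and increasing, Jensen's inequality gives the bound for `ρ`.
The trace norm is reached by duality with self-adjoint contractions (`traceNorm_le_of_sum_le`).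

The remaining work concerns unbounded operators and operator integrals. The speed limit is proved on
the algebraic tensor product of `R` with the Schwartz space, and extended to finite-energy vectors
by truncating their expansion in `eᵢ ⊗ |n⟩`; this needs completeness of the Fock states
(`eq_zero_of_inner_fock_eq_zero`). The iterated single-mode integrals become one integral over `ℂᵐ`
because `α ↦ D(α) T D(α)†` is norm continuous for the operators that occur. -/

variable (m) in
/-- The embedding of Schwartz functions into `L²` as a linear map. -/
def toVecL : Schw m →ₗ[ℂ] ModeSpace m :=
  (SchwartzMap.toLpCLM ℂ ℂ 2 (volume : Measure (EuclideanSpace ℝ (Fin m)))).toLinearMap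

theorem toVecL_apply (f : Schw m) : toVecL m f = toVec f := rfl

theorem toVec_ae (f : Schw m) : (toVec f : EuclideanSpace ℝ (Fin m) → ℂ) =ᵐ[volume] f :=
  f.coeFn_toLp 2 volume

theorem inner_toVec (f g : Schw m) :
    ⟪toVec f, toVec g⟫_ℂ = ∫ x, starRingEnd ℂ (f x) * g x := by
  refine (SchwartzMap.inner_toL2_toL2_eq f g volume).trans ?_
  simp only [RCLike.inner_apply']

/-- The partial derivative `∂/∂x_j` on Schwartz functions. -/
def pderiv (j : Fin m) : Module.End ℂ (Schw m) :=
  (LineDeriv.lineDerivOpCLM ℂ (Schw m) (EuclideanSpace.single j (1 : ℝ))).toLinearMap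

theorem pderiv_apply (j : Fin m) (f : Schw m) (x : EuclideanSpace ℝ (Fin m)) :
    pderiv j f x = fderiv ℝ f x (EuclideanSpace.single j 1) := rfl

theorem I_smul_momentum (j : Fin m) :
    Complex.I • momentum j = (pderiv j : Module.End ℂ (Schw m)) := by
  rw [momentum, smul_smul]
  simp only [mul_neg, Complex.I_mul_I, neg_neg, one_smul]
  rfl

theorem annihilation_eq (j : Fin m) :
    annihilation j = ((Real.sqrt 2 : ℝ) : ℂ)⁻¹ • (position j + pderiv j) := by
  rw [annihilation, I_smul_momentum]

theorem creation_eq (j : Fin m) :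
    creation j = ((Real.sqrt 2 : ℝ) : ℂ)⁻¹ • (position j - pderiv j) := by
  rw [creation, I_smul_momentum]

theorem position_comm (i j : Fin m) :
    position i * position j = (position j * position i : Module.End ℂ (Schw m)) := by
  ext f x
  simp only [Module.End.mul_apply, position_apply]
  ring

theorem pderiv_comm (i j : Fin m) :
    pderiv i * pderiv j = (pderiv j * pderiv i : Module.End ℂ (Schw m)) := by
  ext f x
  have key : ∀ i j : Fin m, pderiv i (pderiv j f) x =
      fderiv ℝ (fderiv ℝ f) x (EuclideanSpace.single i 1) (EuclideanSpace.single j 1) := by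
    intro i j
    rw [pderiv_apply]
    have hd : DifferentiableAt ℝ (fderiv ℝ f) x :=
      ((f.smooth 2).fderiv_right (m := 1) (by norm_num)).differentiable (by norm_num) x
    have h : (pderiv j f : EuclideanSpace ℝ (Fin m) → ℂ) =
        fun y => fderiv ℝ f y (EuclideanSpace.single j 1) := rfl
    rw [h, fderiv_clm_apply hd (by fun_prop)]
    simp
  simp only [Module.End.mul_apply, key]
  have hs : IsSymmSndFDerivAt ℝ f x :=
    ((f.smooth 2).contDiffAt).isSymmSndFDerivAt (by simp)
  exact hs _ _

theorem pderiv_mul_position (i j : Fin m) :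
    pderiv i * position j = position j * pderiv i +
      (if i = j then 1 else 0 : Module.End ℂ (Schw m)) := by
  ext f x
  have h : (position j f : EuclideanSpace ℝ (Fin m) → ℂ) =
      fun y => Complex.ofRealCLM (EuclideanSpace.proj (𝕜 := ℝ) j y) * f y := by
    funext y
    exact position_apply j f y
  simp only [Module.End.mul_apply, LinearMap.add_apply, add_apply, position_apply]
  rw [pderiv_apply, h]
  have h1 : HasFDerivAt (fun y : EuclideanSpace ℝ (Fin m) =>
      Complex.ofRealCLM (EuclideanSpace.proj (𝕜 := ℝ) j y))
      (Complex.ofRealCLM.comp (EuclideanSpace.proj (𝕜 := ℝ) j)) x :=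
    (Complex.ofRealCLM.comp (EuclideanSpace.proj (𝕜 := ℝ) j)).hasFDerivAt
  rw [(h1.fun_mul (f.hasFDerivAt x)).fderiv]
  simp only [add_apply, smul_apply, smul_eq_mul,
    ContinuousLinearMap.comp_apply, pderiv_apply]
  by_cases hij : i = j
  · subst hij
    simp
  · simp [hij, Ne.symm hij]

theorem sqrt_two_inv_mul_self : ((Real.sqrt 2 : ℝ) : ℂ)⁻¹ * ((Real.sqrt 2 : ℝ) : ℂ)⁻¹ = 1 / 2 := by
  rw [← mul_inv, ← Complex.ofReal_mul, Real.mul_self_sqrt (by norm_num)]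
  norm_num

theorem creation_comm (i j : Fin m) :
    creation i * creation j = (creation j * creation i : Module.End ℂ (Schw m)) := by
  rw [creation_eq, creation_eq, smul_mul_smul_comm, smul_mul_smul_comm]
  congr 1
  have h1 := position_comm i j
  have h2 := pderiv_comm i j
  have h3 := pderiv_mul_position i j
  have h4 := pderiv_mul_position j i
  simp only [mul_sub, sub_mul, h1, h2, h3, h4, eq_comm (a := i) (b := j)]
  abel

/-- The canonical commutation relation. The difference of the two products is half the sum of `[∂ᵢ,
xⱼ]` and `[∂ⱼ, xᵢ]`, each of which is `δᵢⱼ`. -/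
theorem annihilation_mul_creation (i j : Fin m) :
    annihilation i * creation j = creation j * annihilation i +
      (if i = j then 1 else 0 : Module.End ℂ (Schw m)) := by
  rw [creation_eq, annihilation_eq, smul_mul_smul_comm, smul_mul_smul_comm, sqrt_two_inv_mul_self]
  have h1 := position_comm i j
  have h2 := pderiv_comm i j
  have h3 := pderiv_mul_position i j
  have h4 := pderiv_mul_position j i
  simp only [mul_sub, sub_mul, mul_add, add_mul, h1, h2, h3, h4, eq_comm (a := i) (b := j)]
  by_cases hij : j = i
  · simp only [hij, if_true]
    module
  · simp only [hij, if_false]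
    module

/-- The gradient of `exp(-‖x‖²/2)` is `-x` times the function itself, which cancels the position
term. -/
theorem annihilation_vacuum (j : Fin m) : annihilation j (vacuum m) = 0 := by
  ext x
  rw [annihilation_eq]
  have hv : (vacuum m : EuclideanSpace ℝ (Fin m) → ℂ) = fun y =>
      ((Real.pi ^ (-(m : ℝ) / 4) * Real.exp (-‖y‖ ^ 2 / 2) : ℝ) : ℂ) := funext vacuum_apply
  have hd : HasFDerivAt (vacuum m) (Complex.ofRealCLM.comp
      ((Real.pi ^ (-(m : ℝ) / 4) : ℝ) • (Real.exp (-‖x‖ ^ 2 / 2) • ((-1 : ℝ) • innerSL ℝ x)))) x := by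
    rw [hv]
    refine Complex.ofRealCLM.hasFDerivAt.comp x (HasFDerivAt.const_mul (HasFDerivAt.exp ?_) _)
    have h := ((hasStrictFDerivAt_norm_sq x).hasFDerivAt).const_mul (-1 / 2 : ℝ)
    have e : (fun y : EuclideanSpace ℝ (Fin m) => -‖y‖ ^ 2 / 2) =
        fun y : EuclideanSpace ℝ (Fin m) => (-1 / 2 : ℝ) * ‖y‖ ^ 2 := by
      funext y
      ring
    rw [e]
    refine h.congr_fderiv ?_
    ext y
    simp
    ring
  simp only [LinearMap.smul_apply, LinearMap.add_apply, smul_apply,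
    add_apply, position_apply, pderiv_apply, hd.fderiv, zero_apply]
  rw [vacuum_apply]
  simp [EuclideanSpace.inner_single_right]
  ring

/-- Complex conjugation of Schwartz functions. -/
def conjSchw (f : Schw m) : Schw m :=
  SchwartzMap.postcompCLM (𝕜 := ℝ) (Complex.conjCLE : ℂ →L[ℝ] ℂ) f

theorem pderiv_conjSchw (j : Fin m) (f : Schw m) (x : EuclideanSpace ℝ (Fin m)) :
    pderiv j (conjSchw f) x = starRingEnd ℂ (pderiv j f x) := by
  rw [pderiv_apply, pderiv_apply]
  have h : HasFDerivAt (conjSchw f) ((Complex.conjCLE : ℂ →L[ℝ] ℂ).comp (fderiv ℝ f x)) x :=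
    (Complex.conjCLE : ℂ →L[ℝ] ℂ).hasFDerivAt.comp x (f.hasFDerivAt x)
  rw [h.fderiv]
  rfl

theorem inner_position (j : Fin m) (f g : Schw m) :
    ⟪toVec (position j f), toVec g⟫_ℂ = ⟪toVec f, toVec (position j g)⟫_ℂ := by
  rw [inner_toVec, inner_toVec]
  congr 1
  funext x
  rw [position_apply, position_apply, map_mul, Complex.conj_ofReal]
  ring

/-- Integration by parts. The available formula is bilinear, so it is applied to the conjugate of
`f`. -/
theorem inner_pderiv (j : Fin m) (f g : Schw m) :
    ⟪toVec (pderiv j f), toVec g⟫_ℂ = -⟪toVec f, toVec (pderiv j g)⟫_ℂ := by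
  rw [inner_toVec, inner_toVec]
  have h := SchwartzMap.integral_mul_lineDerivOp_right_eq_neg_left
    (μ := (volume : Measure (EuclideanSpace ℝ (Fin m)))) (conjSchw f) g
    (EuclideanSpace.single j (1 : ℝ))
  have h' : (∫ x, starRingEnd ℂ (f x) * pderiv j g x) =
      -∫ x, starRingEnd ℂ (pderiv j f x) * g x := by
    simp only [← pderiv_conjSchw]
    exact h
  rw [h', neg_neg]

theorem inner_creation (j : Fin m) (f g : Schw m) :
    ⟪toVec (creation j f), toVec g⟫_ℂ = ⟪toVec f, toVec (annihilation j g)⟫_ℂ := by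
  have h1 := inner_position j f g
  have h2 := inner_pderiv j f g
  simp only [← toVecL_apply] at *
  simp only [creation_eq, annihilation_eq, LinearMap.smul_apply, LinearMap.sub_apply,
    LinearMap.add_apply, map_smul, map_sub, map_add, inner_smul_left, inner_smul_right,
    inner_sub_left, inner_add_right, h1, h2]
  simp

theorem inner_annihilation (j : Fin m) (f g : Schw m) :
    ⟪toVec (annihilation j f), toVec g⟫_ℂ = ⟪toVec f, toVec (creation j g)⟫_ℂ := by
  rw [← inner_conj_symm, ← inner_creation, inner_conj_symm]

end Ladder

section Fock

variable {m : ℕ}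

/-! ### Fock states -/

/-- The unnormalised product `∏ⱼ (aⱼ†)^(nⱼ)` over a list of modes. -/
def creationProd (l : List (Fin m)) (n : Fin m → ℕ) : Module.End ℂ (Schw m) :=
  (l.map (fun j => creation j ^ n j)).prod

theorem creationProd_congr {l : List (Fin m)} {n n' : Fin m → ℕ} (h : ∀ j ∈ l, n j = n' j) :
    creationProd l n = creationProd l n' := by
  unfold creationProd
  congr 1
  exact List.map_congr_left fun j hj => by rw [h j hj]

/-- Creation operators commute, so the new factor slides to its own mode. Each mode occurs once in
the list, hence exactly one exponent is raised. -/
theorem creation_mul_creationProd (j : Fin m) (l : List (Fin m)) (hl : l.Nodup) (hj : j ∈ l)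
    (n : Fin m → ℕ) :
    creation j * creationProd l n = creationProd l (n + Pi.single j 1) := by
  induction l with
  | nil => simp at hj
  | cons k l ih =>
    rw [List.nodup_cons] at hl
    simp only [creationProd, List.map_cons, List.prod_cons] at ih ⊢
    by_cases hjk : j = k
    · subst hjk
      rw [← mul_assoc, ← pow_succ']
      have h := creationProd_congr (l := l) (n := n) (n' := n + Pi.single j 1) (by
        intro i hi
        have : i ≠ j := fun h => hl.1 (h ▸ hi)
        simp [this])
      simp only [creationProd] at h
      rw [h]
      simp
    · have hj' : j ∈ l := by
        rcases List.mem_cons.mp hj with h | h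
        · exact absurd h hjk
        · exact h
      have hc : Commute (creation j) (creation k ^ n k) :=
        (show Commute (creation j) (creation k) from creation_comm j k).pow_right _
      rw [← mul_assoc, hc.eq, mul_assoc, ih hl.2 hj']
      simp [Ne.symm hjk]

/-- The unnormalised Fock state `∏ⱼ (aⱼ†)^(nⱼ) |0⟩`. -/
def rawFock (n : Fin m → ℕ) : Schw m := creationProd (List.finRange m) n (vacuum m)

theorem rawFock_zero : rawFock (0 : Fin m → ℕ) = vacuum m := by
  simp [rawFock, creationProd]

theorem creation_rawFock (j : Fin m) (n : Fin m → ℕ) :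
    creation j (rawFock n) = rawFock (n + Pi.single j 1) := by
  rw [rawFock, rawFock, ← creation_mul_creationProd j _ (List.nodup_finRange m)
    (List.mem_finRange j)]
  rfl

/-- Induction on the total photon number `∑ nⱼ`: every nonzero occupation vector arises from a
smaller one by adding one photon. -/
theorem occupation_induction {P : (Fin m → ℕ) → Prop} (zero : P 0)
    (add : ∀ n j, P n → P (n + Pi.single j 1)) (n : Fin m → ℕ) : P n := by
  have h : ∀ s : ℕ, ∀ n : Fin m → ℕ, ∑ j, n j = s → P n := by
    intro s
    induction s with
    | zero =>
      intro n hn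
      have : n = 0 := by
        funext j
        exact (Finset.sum_eq_zero_iff.mp hn) j (Finset.mem_univ j)
      exact this ▸ zero
    | succ s ih =>
      intro n hn
      obtain ⟨j, -, hj⟩ : ∃ j ∈ Finset.univ, n j ≠ 0 := by
        by_contra! h
        rw [Finset.sum_eq_zero h] at hn
        omega
      have hle : Pi.single j 1 ≤ n := by
        intro i
        by_cases hi : i = j
        · subst hi
          simp
          omega
        · simp [hi]
      have he : n - Pi.single j 1 + Pi.single j 1 = n := tsub_add_cancel_of_le hle
      rw [← he]
      refine add _ _ (ih _ ?_)
      have h2 := congrArg (fun k : Fin m → ℕ => ∑ i, k i) he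
      simp only [Pi.add_apply, Finset.sum_add_distrib, Finset.sum_pi_single', Finset.mem_univ,
        if_true, hn] at h2
      omega
  exact h _ n rfl

/-- The number operator `aⱼ† aⱼ` of a single mode. -/
def modeNumber (j : Fin m) : Module.End ℂ (Schw m) := creation j * annihilation j

/-- Adding a photon uses `Nⱼ aₖ† = aₖ† Nⱼ + δⱼₖ aⱼ†`, a consequence of the commutation relations. -/
theorem modeNumber_rawFock (j : Fin m) (n : Fin m → ℕ) :
    modeNumber j (rawFock n) = (n j : ℂ) • rawFock n := by
  induction n using occupation_induction with
  | zero => simp [rawFock_zero, modeNumber, annihilation_vacuum]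
  | add n k ih =>
    rw [← creation_rawFock]
    have h : modeNumber j * creation k = creation k * modeNumber j +
        (if j = k then creation j else 0 : Module.End ℂ (Schw m)) := by
      rw [modeNumber, mul_assoc, annihilation_mul_creation, mul_add, ← mul_assoc, ← mul_assoc,
        creation_comm j k]
      congr 1
      split_ifs <;> simp
    have h2 := LinearMap.congr_fun h (rawFock n)
    simp only [Module.End.mul_apply, LinearMap.add_apply] at h2
    rw [h2, ih, map_smul]
    by_cases hjk : j = k
    · subst hjk
      simp [add_smul]
    · simp [hjk]

theorem inner_modeNumber (j : Fin m) (f g : Schw m) :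
    ⟪toVec (modeNumber j f), toVec g⟫_ℂ = ⟪toVec f, toVec (modeNumber j g)⟫_ℂ := by
  rw [modeNumber, Module.End.mul_apply, Module.End.mul_apply, inner_creation,
    inner_annihilation]

/-- The two vectors are eigenvectors of a symmetric number operator, with different eigenvalues for
a mode where `n` and `k` differ. -/
theorem inner_rawFock_of_ne {n k : Fin m → ℕ} (h : n ≠ k) :
    ⟪toVec (rawFock n), toVec (rawFock k)⟫_ℂ = 0 := by
  obtain ⟨j, hj⟩ := Function.ne_iff.mp h
  have h1 := inner_modeNumber j (rawFock n) (rawFock k)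
  rw [modeNumber_rawFock, modeNumber_rawFock] at h1
  simp only [← toVecL_apply, map_smul, inner_smul_left, inner_smul_right,
    Complex.conj_natCast] at h1
  have h2 : ((n j : ℂ) - (k j : ℂ)) * ⟪toVecL m (rawFock n), toVecL m (rawFock k)⟫_ℂ = 0 := by
    rw [sub_mul, h1, sub_self]
  rcases mul_eq_zero.mp h2 with h3 | h3
  · exact absurd (by exact_mod_cast sub_eq_zero.mp h3) hj
  · exact h3

theorem inner_vacuum_self : ⟪toVec (vacuum m), toVec (vacuum m)⟫_ℂ = 1 := by
  rw [inner_toVec]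
  have h1 : ∀ x : EuclideanSpace ℝ (Fin m), starRingEnd ℂ (vacuum m x) * vacuum m x =
      ((Real.pi ^ (-(m : ℝ) / 2) * Real.exp (-1 * ‖x‖ ^ 2) : ℝ) : ℂ) := by
    intro x
    rw [vacuum_apply, Complex.conj_ofReal, ← Complex.ofReal_mul]
    congr 1
    have h2 : Real.pi ^ (-(m : ℝ) / 2) = Real.pi ^ (-(m : ℝ) / 4) * Real.pi ^ (-(m : ℝ) / 4) := by
      rw [← Real.rpow_add Real.pi_pos]
      congr 1
      ring
    have h3 : Real.exp (-1 * ‖x‖ ^ 2) = Real.exp (-‖x‖ ^ 2 / 2) * Real.exp (-‖x‖ ^ 2 / 2) := by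
      rw [← Real.exp_add]
      congr 1
      ring
    rw [h2, h3]
    ring
  simp only [h1]
  rw [integral_complex_ofReal, integral_const_mul]
  have h4 := GaussianFourier.integral_rexp_neg_mul_sq_norm
    (V := EuclideanSpace ℝ (Fin m)) (b := 1) one_pos
  rw [h4, finrank_euclideanSpace_fin, div_one, ← Real.rpow_add Real.pi_pos]
  norm_num
  rw [show -(m : ℝ) / 2 + m / 2 = 0 by ring, Real.rpow_zero]

/-- Moving the creation operator across gives `⟨f, aₖ aₖ† f⟩ = (nₖ + 1) ‖f‖²`, so each added photon
contributes the next factor of `nₖ!`. -/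
theorem inner_rawFock_self (n : Fin m → ℕ) :
    ⟪toVec (rawFock n), toVec (rawFock n)⟫_ℂ = ((∏ j, (n j).factorial : ℕ) : ℂ) := by
  induction n using occupation_induction with
  | zero =>
    rw [rawFock_zero, inner_vacuum_self]
    simp
  | add n k ih =>
    rw [← creation_rawFock, inner_creation, ← Module.End.mul_apply, annihilation_mul_creation]
    have h := modeNumber_rawFock k n
    rw [modeNumber] at h
    simp only [if_true, LinearMap.add_apply, Module.End.one_apply, h]
    simp only [← toVecL_apply, map_add, map_smul, inner_add_right, inner_smul_right] at ih ⊢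
    rw [ih, ← add_one_mul]
    rw [← Finset.mul_prod_erase Finset.univ _ (Finset.mem_univ k),
      ← Finset.mul_prod_erase Finset.univ _ (Finset.mem_univ k)]
    have h2 : ∏ j ∈ Finset.univ.erase k, ((n + Pi.single k 1 : Fin m → ℕ) j).factorial =
        ∏ j ∈ Finset.univ.erase k, (n j).factorial := by
      refine Finset.prod_congr rfl fun j hj => ?_
      simp [Finset.ne_of_mem_erase hj]
    rw [h2]
    simp only [Pi.add_apply, Pi.single_eq_same, Nat.factorial_succ]
    push_cast
    ring

theorem fock_eq (n : Fin m → ℕ) :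
    fock n = ((∏ j, Real.sqrt ((n j).factorial) : ℝ) : ℂ)⁻¹ • rawFock n := rfl

theorem prod_sqrt_factorial_ne_zero (n : Fin m → ℕ) :
    ((∏ j, Real.sqrt ((n j).factorial) : ℝ) : ℂ) ≠ 0 := by
  norm_cast
  refine Finset.prod_ne_zero_iff.mpr fun j _ => ?_
  positivity

theorem modeNumber_fock (j : Fin m) (n : Fin m → ℕ) :
    modeNumber j (fock n) = (n j : ℂ) • fock n := by
  rw [fock_eq, map_smul, modeNumber_rawFock, smul_comm]

theorem number_fock (n : Fin m → ℕ) : number m (fock n) = ((∑ j, n j : ℕ) : ℂ) • fock n := by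
  rw [number, LinearMap.sum_apply]
  have h : ∀ j ∈ Finset.univ, (creation j * annihilation j) (fock n) = (n j : ℂ) • fock n :=
    fun j _ => modeNumber_fock j n
  rw [Finset.sum_congr rfl h, ← Finset.sum_smul]
  push_cast
  rfl

variable (m) in
theorem orthonormal_fock : Orthonormal ℂ (fun n : Fin m → ℕ => toVec (fock n)) := by
  refine ⟨fun n => ?_, fun n k h => ?_⟩
  · have h : ⟪toVec (fock n), toVec (fock n)⟫_ℂ = 1 := by
      have h0 := prod_sqrt_factorial_ne_zero n
      have h1 := inner_rawFock_self n
      rw [fock_eq]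
      simp only [← toVecL_apply, map_smul, inner_smul_left, inner_smul_right] at h1 ⊢
      rw [h1]
      have h2 : (((∏ j, (n j).factorial : ℕ)) : ℂ) =
          ((∏ j, Real.sqrt ((n j).factorial) : ℝ) : ℂ) *
            ((∏ j, Real.sqrt ((n j).factorial) : ℝ) : ℂ) := by
        rw [← Complex.ofReal_mul, ← Finset.prod_mul_distrib]
        simp
      rw [h2, map_inv₀, Complex.conj_ofReal]
      field_simp
    rw [inner_self_eq_norm_sq_to_K, ← RCLike.ofReal_pow] at h
    have h2 : ‖toVec (fock n)‖ ^ 2 = 1 := by exact Complex.ofReal_eq_one.mp h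
    exact (pow_eq_one_iff_of_nonneg (norm_nonneg _) two_ne_zero).mp h2
  · simp only [fock_eq, ← toVecL_apply, map_smul, inner_smul_left, inner_smul_right]
    rw [toVecL_apply, toVecL_apply, inner_rawFock_of_ne h]
    simp

end Fock

section Completeness

variable {m : ℕ}

/-! ### Completeness of the Fock states -/

variable (m) in
/-- The linear span of the Fock states inside the Schwartz space. -/
def fockSpan : Submodule ℂ (Schw m) := Submodule.span ℂ (Set.range fock)

theorem rawFock_mem_fockSpan (n : Fin m → ℕ) : rawFock n ∈ fockSpan m := by
  have h : rawFock n = ((∏ j, Real.sqrt ((n j).factorial) : ℝ) : ℂ) • fock n := by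
    rw [fock_eq, smul_smul, mul_inv_cancel₀ (prod_sqrt_factorial_ne_zero n), one_smul]
  rw [h]
  exact Submodule.smul_mem _ _ (Submodule.subset_span ⟨n, rfl⟩)

theorem map_mem_fockSpan (A : Module.End ℂ (Schw m)) (h : ∀ n, A (rawFock n) ∈ fockSpan m)
    {f : Schw m} (hf : f ∈ fockSpan m) : A f ∈ fockSpan m := by
  induction hf using Submodule.span_induction with
  | mem x hx =>
    obtain ⟨n, rfl⟩ := hx
    rw [fock_eq, map_smul]
    exact Submodule.smul_mem _ _ (h n)
  | zero => simp
  | add x y _ _ hx hy =>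
    rw [map_add]
    exact Submodule.add_mem _ hx hy
  | smul c x _ hx =>
    rw [map_smul]
    exact Submodule.smul_mem _ _ hx

theorem creation_mem_fockSpan (j : Fin m) {f : Schw m} (hf : f ∈ fockSpan m) :
    creation j f ∈ fockSpan m :=
  map_mem_fockSpan _ (fun n => creation_rawFock j n ▸ rawFock_mem_fockSpan _) hf

theorem annihilation_mem_fockSpan (j : Fin m) {f : Schw m} (hf : f ∈ fockSpan m) :
    annihilation j f ∈ fockSpan m := by
  refine map_mem_fockSpan _ (fun n => ?_) hf
  induction n using occupation_induction with
  | zero => simp [rawFock_zero, annihilation_vacuum]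
  | add n k ih =>
    rw [← creation_rawFock, ← Module.End.mul_apply, annihilation_mul_creation]
    refine Submodule.add_mem _ (creation_mem_fockSpan k ih) ?_
    split_ifs
    · exact rawFock_mem_fockSpan n
    · exact Submodule.zero_mem _

/-- Since `xⱼ = (aⱼ + aⱼ†)/√2`, the span is stable under multiplication by coordinates and therefore
contains every polynomial times the Gaussian. -/
theorem position_mem_fockSpan (j : Fin m) {f : Schw m} (hf : f ∈ fockSpan m) :
    position j f ∈ fockSpan m := by
  have h : position j f =
      ((Real.sqrt 2 : ℝ) : ℂ)⁻¹ • (creation j f + annihilation j f) := by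
    rw [creation_eq, annihilation_eq]
    simp only [LinearMap.smul_apply, LinearMap.add_apply, LinearMap.sub_apply, ← smul_add,
      smul_smul, sqrt_two_inv_mul_self]
    module
  rw [h]
  exact Submodule.smul_mem _ _
    (Submodule.add_mem _ (creation_mem_fockSpan j hf) (annihilation_mem_fockSpan j hf))

/-- Powers of linear forms are the terms in the expansion of a plane wave `exp(i⟨ξ, x⟩)`, and these
are all that completeness requires. -/
theorem exists_mem_fockSpan_inner_pow (ξ : EuclideanSpace ℝ (Fin m)) (k : ℕ) :
    ∃ f ∈ fockSpan m, ∀ x, f x = ((⟪ξ, x⟫_ℝ : ℝ) : ℂ) ^ k * vacuum m x := by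
  induction k with
  | zero =>
    exact ⟨vacuum m, rawFock_zero (m := m) ▸ rawFock_mem_fockSpan 0, fun x => by simp⟩
  | succ k ih =>
    obtain ⟨f, hf, hfx⟩ := ih
    refine ⟨∑ j, ((ξ j : ℝ) : ℂ) • position j f, Submodule.sum_mem _ fun j _ =>
      Submodule.smul_mem _ _ (position_mem_fockSpan j hf), fun x => ?_⟩
    have h : (∑ j, ((ξ j : ℝ) : ℂ) • position j f) x =
        ∑ j, ((ξ j : ℝ) : ℂ) * ((x j : ℂ) * f x) := by
      simp [position_apply]
    rw [h, hfx, pow_succ, PiLp.inner_apply]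
    simp only [← mul_assoc, ← Finset.sum_mul]
    push_cast
    simp only [RCLike.inner_apply, conj_trivial]
    push_cast
    rw [Finset.sum_congr rfl fun j _ => mul_comm ((ξ j : ℝ) : ℂ) (x j : ℂ)]
    ring

theorem vacuum_ne_zero (x : EuclideanSpace ℝ (Fin m)) : vacuum m x ≠ 0 := by
  rw [vacuum_apply]
  norm_cast
  have := Real.rpow_pos_of_pos Real.pi_pos (-(m : ℝ) / 4)
  positivity

/-- A product is dominated by the sum of the squares of its factors, and the Gaussian absorbs the
exponential. This is the domination that allows a plane wave to be expanded under the integral. -/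
theorem integrable_exp_mul_vacuum (ψ : ModeSpace m) (c : ℝ) :
    Integrable (fun x => Real.exp (c * ‖x‖) * (‖ψ x‖ * ‖vacuum m x‖)) := by
  set p := Real.pi ^ (-(m : ℝ) / 4) with hp
  have hp0 : 0 < p := Real.rpow_pos_of_pos Real.pi_pos _
  have h1 : Integrable (fun x => ‖ψ x‖ ^ 2) :=
    (memLp_two_iff_integrable_sq_norm (Lp.aestronglyMeasurable ψ)).mp (Lp.memLp ψ)
  have h2 : Integrable (fun x : EuclideanSpace ℝ (Fin m) => Real.exp (-‖x‖ ^ 2 / 2)) :=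
    (gaussian m).integrable
  -- The factor `exp(2c²)` comes from `2c‖x‖ - ‖x‖² ≤ 2c² - ‖x‖²/2`, that is, from `(‖x‖ - 2c)² ≥
  -- 0`.
  refine (h1.add (h2.const_mul (p ^ 2 * Real.exp (2 * c ^ 2)))).mono' ?_ ?_
  · refine AEStronglyMeasurable.mul (by fun_prop) (AEStronglyMeasurable.mul ?_ ?_)
    · exact (Lp.aestronglyMeasurable ψ).norm
    · exact (vacuum m).continuous.norm.aestronglyMeasurable
  · refine Filter.Eventually.of_forall fun x => ?_
    have hv : ‖vacuum m x‖ = p * Real.exp (-‖x‖ ^ 2 / 2) := by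
      rw [vacuum_apply, Complex.norm_real, Real.norm_of_nonneg (by positivity)]
    rw [Real.norm_of_nonneg (by positivity), hv]
    simp only [Pi.add_apply]
    have h3 : (Real.exp (c * ‖x‖) * (p * Real.exp (-‖x‖ ^ 2 / 2))) ^ 2 ≤
        p ^ 2 * Real.exp (2 * c ^ 2) * Real.exp (-‖x‖ ^ 2 / 2) := by
      have h4 : (Real.exp (c * ‖x‖) * (p * Real.exp (-‖x‖ ^ 2 / 2))) ^ 2 =
          p ^ 2 * Real.exp (2 * (c * ‖x‖) - ‖x‖ ^ 2) := by
        rw [mul_pow, mul_pow, ← Real.exp_nat_mul, ← Real.exp_nat_mul, mul_left_comm,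
          ← Real.exp_add]
        congr 2
        push_cast
        ring
      rw [h4, mul_assoc, ← Real.exp_add]
      refine mul_le_mul_of_nonneg_left (Real.exp_le_exp.mpr ?_) (by positivity)
      nlinarith [sq_nonneg (‖x‖ - 2 * c)]
    nlinarith [sq_nonneg (‖ψ x‖ - Real.exp (c * ‖x‖) * (p * Real.exp (-‖x‖ ^ 2 / 2))),
      sq_nonneg (‖ψ x‖), sq_nonneg (Real.exp (c * ‖x‖) * (p * Real.exp (-‖x‖ ^ 2 / 2)))]

/-- A test function is the Fourier transform of a Schwartz function; moving the transform onto `h`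
makes the pairing vanish. -/
theorem ae_eq_zero_of_fourier_eq_zero {h : EuclideanSpace ℝ (Fin m) → ℂ} (hi : Integrable h)
    (hF : ∀ w, FourierTransform.fourier h w = 0) : h =ᵐ[volume] 0 := by
  refine ae_eq_zero_of_integral_contDiff_smul_eq_zero hi.locallyIntegrable fun g hg hgs => ?_
  have hgs' : HasCompactSupport (fun x => (g x : ℂ)) := hgs.comp_left (g := fun t : ℝ => (t : ℂ)) rfl
  set G : Schw m := hgs'.toSchwartzMap (Complex.ofRealCLM.contDiff.comp hg) with hG
  have h1 : ∫ x, (FourierTransform.fourier (FourierTransform.fourierInv G : Schw m) : Schw m) x • h x =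
      ∫ x, (FourierTransform.fourierInv G : Schw m) x • FourierTransform.fourier h x := by
    have := VectorFourier.integral_fourierIntegral_smul_eq_flip
      (L := innerₗ (EuclideanSpace ℝ (Fin m))) (μ := volume) (ν := volume)
      Real.continuous_fourierChar continuous_inner
      (FourierTransform.fourierInv G : Schw m).integrable hi
    rw [flip_innerₗ] at this
    exact this
  simp only [hF, smul_zero, integral_zero, FourierTransform.fourier_fourierInv_eq] at h1
  rw [← h1]
  refine integral_congr_ae (Filter.Eventually.of_forall fun x => ?_)
  have : G x = (g x : ℂ) := rfl
  simp [this]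

/-- Orthogonality to all polynomials times the Gaussian, summed along the exponential series, shows
that the Fourier transform of `conj ψ · vacuum` vanishes. As the vacuum has no zeros, `ψ = 0`. -/
theorem eq_zero_of_inner_fock_eq_zero (ψ : ModeSpace m)
    (hψ : ∀ n, ⟪toVec (fock n), ψ⟫_ℂ = 0) : ψ = 0 := by
  have hspan : ∀ f ∈ fockSpan m, ∫ x, starRingEnd ℂ (ψ x) * f x = 0 := by
    intro f hf
    have h0 : ⟪ψ, toVecL m f⟫_ℂ = 0 := by
      induction hf using Submodule.span_induction with
      | mem x hx =>
        obtain ⟨n, rfl⟩ := hx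
        rw [← inner_conj_symm, toVecL_apply, hψ, map_zero]
      | zero => simp
      | add x y _ _ hx hy => rw [map_add, inner_add_right, hx, hy, add_zero]
      | smul c x _ hx => rw [map_smul, inner_smul_right, hx, mul_zero]
    rw [← h0, L2.inner_def]
    refine integral_congr_ae ?_
    filter_upwards [toVec_ae f] with x hx
    rw [toVecL_apply, hx, RCLike.inner_apply']
  set h : EuclideanSpace ℝ (Fin m) → ℂ := fun x => starRingEnd ℂ (ψ x) * vacuum m x with hh
  have hmeas : AEStronglyMeasurable h volume :=
    (Complex.continuous_conj.comp_aestronglyMeasurable (Lp.aestronglyMeasurable ψ)).mul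
      (vacuum m).continuous.aestronglyMeasurable
  have hnorm : ∀ x, ‖h x‖ = ‖ψ x‖ * ‖vacuum m x‖ := fun x => by simp [hh]
  have hexp : ∀ ξ : EuclideanSpace ℝ (Fin m),
      ∫ x, Complex.exp (((⟪ξ, x⟫_ℝ : ℝ) : ℂ) * Complex.I) * h x = 0 := by
    intro ξ
    have hs := hasSum_integral_of_dominated_convergence
      (μ := (volume : Measure (EuclideanSpace ℝ (Fin m))))
      (F := fun (k : ℕ) x => (((⟪ξ, x⟫_ℝ : ℝ) : ℂ) * Complex.I) ^ k / (k.factorial : ℂ) * h x)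
      (f := fun x => Complex.exp (((⟪ξ, x⟫_ℝ : ℝ) : ℂ) * Complex.I) * h x)
      (fun k x => (‖ξ‖ * ‖x‖) ^ k / (k.factorial : ℝ) * (‖ψ x‖ * ‖vacuum m x‖)) ?_ ?_ ?_ ?_ ?_
    · have hz : ∀ k : ℕ, ∫ x, (((⟪ξ, x⟫_ℝ : ℝ) : ℂ) * Complex.I) ^ k / (k.factorial : ℂ) * h x
          = 0 := by
        intro k
        obtain ⟨f, hf, hfx⟩ := exists_mem_fockSpan_inner_pow ξ k
        have h1 := hspan f hf
        have h2 : ∀ x, (((⟪ξ, x⟫_ℝ : ℝ) : ℂ) * Complex.I) ^ k / (k.factorial : ℂ) * h x =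
            (Complex.I ^ k / (k.factorial : ℂ)) * (starRingEnd ℂ (ψ x) * f x) := by
          intro x
          rw [hfx, hh, mul_pow]
          ring
        simp only [h2]
        rw [integral_const_mul, h1, mul_zero]
      simp only [hz] at hs
      exact hs.unique hasSum_zero
    · intro k
      exact AEStronglyMeasurable.mul (by fun_prop) hmeas
    · intro k
      refine Filter.Eventually.of_forall fun x => ?_
      rw [norm_mul, hnorm, norm_div, norm_pow, norm_mul, Complex.norm_I, mul_one,
        Complex.norm_natCast, Complex.norm_real]
      gcongr
      exact abs_real_inner_le_norm ξ x
    · exact Filter.Eventually.of_forall fun x =>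
        (Real.summable_pow_div_factorial _).mul_right _
    · have h3 : ∀ x, ∑' k : ℕ, (‖ξ‖ * ‖x‖) ^ k / (k.factorial : ℝ) * (‖ψ x‖ * ‖vacuum m x‖) =
          Real.exp (‖ξ‖ * ‖x‖) * (‖ψ x‖ * ‖vacuum m x‖) := by
        intro x
        rw [tsum_mul_right, Real.exp_eq_exp_ℝ, NormedSpace.exp_eq_tsum_div]
      simp only [h3]
      exact integrable_exp_mul_vacuum ψ _
    · refine Filter.Eventually.of_forall fun x => ?_
      have := NormedSpace.expSeries_div_hasSum_exp (((⟪ξ, x⟫_ℝ : ℝ) : ℂ) * Complex.I)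
      rw [← Complex.exp_eq_exp_ℂ] at this
      exact this.mul_right _
  have hint : Integrable h := by
    have := integrable_exp_mul_vacuum ψ 0
    simp only [zero_mul, Real.exp_zero, one_mul, ← hnorm] at this
    exact (integrable_norm_iff hmeas).mp this
  have hzero := ae_eq_zero_of_fourier_eq_zero hint fun w => by
    rw [Real.fourier_eq', ← hexp ((-2 * Real.pi) • w)]
    congr 1
    funext x
    rw [inner_smul_left, real_inner_comm, smul_eq_mul]
    simp
  refine (Lp.eq_zero_iff_ae_eq_zero).mpr ?_
  filter_upwards [hzero] with x hx
  have h4 : starRingEnd ℂ (ψ x) = 0 := by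
    rcases mul_eq_zero.mp hx with h5 | h5
    · exact h5
    · exact absurd h5 (vacuum_ne_zero x)
  simpa using h4

end Completeness

/-! ### Weyl operators and their action on one factor of a bipartite system -/

section Displacement

variable {m : ℕ}

/-! ### Displacement operators -/

theorem displacement_norm (α : Fin m → ℂ) (ψ : ModeSpace m) : ‖displacement α ψ‖ = ‖ψ‖ :=
  (displacementₗᵢ α).norm_map ψ

theorem displacement_inner (α : Fin m → ℂ) (ψ φ : ModeSpace m) :
    ⟪displacement α ψ, displacement α φ⟫_ℂ = ⟪ψ, φ⟫_ℂ :=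
  (displacementₗᵢ α).inner_map_map ψ φ

/-- The phase in the Weyl relation. -/
def weylPhase (α β : Fin m → ℂ) : ℂ :=
  Complex.exp (((∑ j, ((β j).re * (α j).im - (α j).re * (β j).im) : ℝ) : ℂ) * Complex.I)

theorem shift_shift (α β : Fin m → ℂ) (x : EuclideanSpace ℝ (Fin m)) :
    shift β (shift α x) = shift (α + β) x := by
  ext j
  simp [shift]
  ring

/-- Shifting the linear phase of `β` by `α` produces `-2 Re αⱼ Im βⱼ`. Its part symmetric in `α, β`
completes the quadratic phase of `α + β`; the antisymmetric part is the Weyl phase. -/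
theorem phase_mul_phase (α β : Fin m → ℂ) (x : EuclideanSpace ℝ (Fin m)) :
    phase α x * phase β (shift α x) = weylPhase α β * phase (α + β) x := by
  rw [phase, phase, phase, weylPhase, ← Complex.exp_add, ← Complex.exp_add, ← add_mul, ← add_mul,
    ← Complex.ofReal_add, ← Complex.ofReal_add, ← Finset.sum_add_distrib,
    ← Finset.sum_add_distrib]
  congr 4
  funext j
  have h2 : Real.sqrt 2 * Real.sqrt 2 = 2 := Real.mul_self_sqrt (by norm_num)
  simp only [shift, PiLp.sub_apply, Pi.add_apply, Complex.add_re, Complex.add_im]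
  linear_combination (-(β j).im * (α j).re) * h2

theorem displacement_displacement (α β : Fin m → ℂ) (ψ : ModeSpace m) :
    displacement α (displacement β ψ) = weylPhase α β • displacement (α + β) ψ := by
  refine Lp.ext ?_
  have h1 := (shift_measurePreserving α).quasiMeasurePreserving.ae_eq_comp
    (displacement_apply_ae β ψ)
  filter_upwards [displacement_apply_ae α (displacement β ψ), h1,
    Lp.coeFn_smul (weylPhase α β) (displacement (α + β) ψ), displacement_apply_ae (α + β) ψ]
    with x h2 h3 h4 h5
  simp only [Function.comp_apply] at h3
  rw [h2, h3, h4, Pi.smul_apply, h5, smul_eq_mul, ← mul_assoc, phase_mul_phase, shift_shift,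
    mul_assoc]

theorem displacement_zero (ψ : ModeSpace m) : displacement (0 : Fin m → ℂ) ψ = ψ := by
  refine Lp.ext ?_
  filter_upwards [displacement_apply_ae 0 ψ] with x h
  have h1 : shift (0 : Fin m → ℂ) x = x := by
    ext j
    simp [shift]
  rw [h, h1]
  simp [phase]

theorem weylPhase_neg (α : Fin m → ℂ) : weylPhase α (-α) = 1 := by
  have h : ∀ j, ((-α) j).re * (α j).im - (α j).re * ((-α) j).im = 0 := by
    intro j
    simp only [Pi.neg_apply, Complex.neg_re, Complex.neg_im]
    ring
  simp only [weylPhase, h, Finset.sum_const_zero, Complex.ofReal_zero, zero_mul, Complex.exp_zero]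

theorem weylPhase_smul_smul (α : Fin m → ℂ) (s t : ℝ) : weylPhase (s • α) (t • α) = 1 := by
  have h : ∀ j, ((t • α) j).re * ((s • α) j).im - ((s • α) j).re * ((t • α) j).im = 0 := by
    intro j
    simp only [Pi.smul_apply, Complex.smul_re, Complex.smul_im, smul_eq_mul]
    ring
  simp only [weylPhase, h, Finset.sum_const_zero, Complex.ofReal_zero, zero_mul, Complex.exp_zero]

theorem displacement_displacement_neg (α : Fin m → ℂ) (ψ : ModeSpace m) :
    displacement α (displacement (-α) ψ) = ψ := by
  rw [displacement_displacement, weylPhase_neg, one_smul, add_neg_cancel, displacement_zero]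

theorem displacement_smul_smul (α : Fin m → ℂ) (s t : ℝ) (ψ : ModeSpace m) :
    displacement (s • α) (displacement (t • α) ψ) = displacement ((s + t) • α) ψ := by
  rw [displacement_displacement, weylPhase_smul_smul, one_smul, add_smul]

theorem adjoint_displacement (α : Fin m → ℂ) :
    (displacement α).adjoint = displacement (-α) := by
  symm
  rw [ContinuousLinearMap.eq_adjoint_iff]
  intro x y
  rw [← displacement_inner α, displacement_displacement_neg]

theorem displacementChannel_apply (α : Fin m → ℂ) (T : ModeSpace m →L[ℂ] ModeSpace m)
    (ψ : ModeSpace m) :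
    displacementChannel α T ψ = displacement α (T (displacement (-α) ψ)) := by
  rw [displacementChannel, adjoint_displacement]
  rfl

theorem weylPhase_mul_weylPhase_neg (α β : Fin m → ℂ) :
    weylPhase (-β) (-α) * weylPhase α β = 1 := by
  rw [weylPhase, weylPhase, ← Complex.exp_add, ← add_mul, ← Complex.ofReal_add,
    ← Finset.sum_add_distrib, Finset.sum_eq_zero, Complex.ofReal_zero, zero_mul, Complex.exp_zero]
  intro j _
  simp only [Pi.neg_apply, Complex.neg_re, Complex.neg_im]
  ring

/-- Under conjugation the Weyl phases cancel, so the channels compose additively although the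
operators do so only up to a phase. Noise on different modes can therefore be merged. -/
theorem displacementChannel_displacementChannel (α β : Fin m → ℂ)
    (T : ModeSpace m →L[ℂ] ModeSpace m) :
    displacementChannel α (displacementChannel β T) = displacementChannel (α + β) T := by
  ext1 ψ
  rw [displacementChannel_apply, displacementChannel_apply, displacementChannel_apply,
    displacement_displacement (-β), map_smul, map_smul, map_smul, displacement_displacement,
    smul_smul, weylPhase_mul_weylPhase_neg, one_smul, neg_add_rev]

theorem inner_displacement (α : Fin m → ℂ) (g f : Schw m) :
    ⟪toVec g, displacement α (toVec f)⟫_ℂ =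
      ∫ x, starRingEnd ℂ (g x) * (phase α x * f (shift α x)) := by
  rw [L2.inner_def]
  refine integral_congr_ae ?_
  have h1 := (shift_measurePreserving α).quasiMeasurePreserving.ae_eq_comp (toVec_ae f)
  filter_upwards [toVec_ae g, displacement_apply_ae α (toVec f), h1] with x h2 h3 h4
  simp only [Function.comp_apply] at h4
  rw [h2, h3, h4, RCLike.inner_apply']

theorem exists_norm_le (f : Schw m) : ∃ C : ℝ, ∀ x, ‖f x‖ ≤ C :=
  ⟨_, fun x => SchwartzMap.norm_le_seminorm ℝ f x⟩

theorem continuous_shift (α : Fin m → ℂ) : Continuous (shift α) := by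
  unfold shift
  fun_prop

theorem integrand_norm_le (α : Fin m → ℂ) (g f : Schw m) {C : ℝ} (hC : ∀ x, ‖f x‖ ≤ C)
    (x : EuclideanSpace ℝ (Fin m)) :
    ‖starRingEnd ℂ (g x) * (phase α x * f (shift α x))‖ ≤ ‖g x‖ * C := by
  rw [norm_mul, norm_mul, norm_phase, one_mul, RCLike.norm_conj]
  exact mul_le_mul_of_nonneg_left (hC _) (norm_nonneg _)

theorem integrand_measurable (α : Fin m → ℂ) (g f : Schw m) :
    AEStronglyMeasurable (fun x => starRingEnd ℂ (g x) * (phase α x * f (shift α x)))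
      (volume : Measure (EuclideanSpace ℝ (Fin m))) := by
  have h1 := continuous_shift α
  have h2 := continuous_phase α
  have h3 := g.continuous
  have h4 := f.continuous
  exact Continuous.aestronglyMeasurable
    ((Complex.continuous_conj.comp h3).mul (h2.mul (h4.comp h1)))

/-- Dominated convergence: phases have modulus one and shifts do not change the supremum of `f`, so
the bound is uniform in `α`. -/
theorem continuous_inner_displacement (g f : Schw m) :
    Continuous fun α : Fin m → ℂ => ⟪toVec g, displacement α (toVec f)⟫_ℂ := by
  simp only [inner_displacement]
  obtain ⟨C, hC⟩ := exists_norm_le f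
  refine continuous_of_dominated (bound := fun x => ‖g x‖ * C) ?_ ?_ ?_ ?_
  · exact fun α => integrand_measurable α g f
  · exact fun α => Filter.Eventually.of_forall fun x => integrand_norm_le α g f hC x
  · exact g.integrable.norm.mul_const C
  · refine Filter.Eventually.of_forall fun x => ?_
    have h1 : Continuous fun α : Fin m → ℂ => shift α x := by
      unfold shift
      fun_prop
    have h2 : Continuous fun α : Fin m → ℂ => phase α x := by
      unfold phase
      fun_prop
    exact continuous_const.mul (h2.mul (f.continuous.comp h1))

/-- The generator `∑ⱼ (αⱼ aⱼ† - αⱼ* aⱼ)` of the displacements `D(tα)`. -/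
def generator (α : Fin m → ℂ) : Module.End ℂ (Schw m) :=
  ∑ j, (α j • creation j - starRingEnd ℂ (α j) • annihilation j)

theorem generator_apply (α : Fin m → ℂ) (f : Schw m) (x : EuclideanSpace ℝ (Fin m)) :
    generator α f x = ((∑ j, Real.sqrt 2 * (α j).im * x j : ℝ) : ℂ) * Complex.I * f x -
      fderiv ℝ f x (WithLp.toLp 2 (fun j => Real.sqrt 2 * (α j).re)) := by
  have h1 : (WithLp.toLp 2 (fun j => Real.sqrt 2 * (α j).re) : EuclideanSpace ℝ (Fin m)) =
      ∑ j, (Real.sqrt 2 * (α j).re) • EuclideanSpace.single j (1 : ℝ) := by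
    ext i
    simp [Finset.sum_apply, Pi.single_apply]
  have hs : (Real.sqrt 2 : ℂ) ≠ 0 := by
    norm_cast
    positivity
  have h2 : ((Real.sqrt 2 : ℝ) : ℂ)⁻¹ * 2 = Real.sqrt 2 := by
    rw [inv_mul_eq_iff_eq_mul₀ hs, ← Complex.ofReal_mul, Real.mul_self_sqrt (by norm_num)]
    norm_num
  rw [h1, map_sum, generator, LinearMap.sum_apply, sum_apply, Complex.ofReal_sum,
    Finset.sum_mul, Finset.sum_mul, ← Finset.sum_sub_distrib]
  refine Finset.sum_congr rfl fun j _ => ?_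
  rw [map_smul, ← pderiv_apply, creation_eq, annihilation_eq]
  simp only [LinearMap.sub_apply, LinearMap.smul_apply, LinearMap.add_apply, sub_apply,
    smul_apply, add_apply, position_apply, smul_eq_mul, Complex.real_smul]
  have h3 : α j = (α j).re + (α j).im * Complex.I := (Complex.re_add_im _).symm
  have h4 : starRingEnd ℂ (α j) = (α j).re - (α j).im * Complex.I := by
    apply Complex.ext <;> simp
  rw [h4]
  push_cast
  linear_combination ((Real.sqrt 2 : ℂ)⁻¹ * (x j * f x - pderiv j f x)) * h3 +
    (((α j).im : ℂ) * Complex.I * x j * f x - ((α j).re : ℂ) * pderiv j f x) * h2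

theorem hasDerivAt_integrand (α : Fin m → ℂ) (f : Schw m) (x : EuclideanSpace ℝ (Fin m)) (t : ℝ) :
    HasDerivAt (fun t : ℝ => phase (t • α) x * f (shift (t • α) x))
      (phase (t • α) x * generator α f (shift (t • α) x)) t := by
  set v : EuclideanSpace ℝ (Fin m) := WithLp.toLp 2 (fun j => Real.sqrt 2 * (α j).re) with hv
  have h1 : ∀ t : ℝ, shift (t • α) x = x - t • v := by
    intro t
    ext j
    simp [shift, hv]
    ring
  have h2 : ∀ t : ℝ, phase (t • α) x =
      Complex.exp (((t * (∑ j, Real.sqrt 2 * (α j).im * x j) -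
        t ^ 2 * (∑ j, (α j).re * (α j).im) : ℝ) : ℂ) * Complex.I) := by
    intro t
    rw [phase]
    congr 3
    rw [Finset.mul_sum, Finset.mul_sum, ← Finset.sum_sub_distrib]
    refine Finset.sum_congr rfl fun j _ => ?_
    simp only [Pi.smul_apply, Complex.smul_re, Complex.smul_im, smul_eq_mul]
    ring
  have h3 : HasDerivAt (fun t : ℝ => x - t • v) (-v) t := by
    simpa using ((hasDerivAt_id t).smul_const v).const_sub x
  have h4 : HasDerivAt (fun t : ℝ => f (x - t • v)) (fderiv ℝ f (x - t • v) (-v)) t :=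
    (f.hasFDerivAt _).comp_hasDerivAt t h3
  have h5 : HasDerivAt (fun t : ℝ => t * (∑ j, Real.sqrt 2 * (α j).im * x j) -
        t ^ 2 * (∑ j, (α j).re * (α j).im))
      ((∑ j, Real.sqrt 2 * (α j).im * x j) - 2 * t * (∑ j, (α j).re * (α j).im)) t := by
    have := ((hasDerivAt_id t).mul_const (∑ j, Real.sqrt 2 * (α j).im * x j)).fun_sub
      ((hasDerivAt_pow 2 t).mul_const (∑ j, (α j).re * (α j).im))
    simpa using this
  have h6 := (h5.ofReal_comp.mul_const Complex.I).cexp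
  simp only [h1, h2]
  refine (h6.mul h4).congr_deriv ?_
  rw [generator_apply, ← hv, map_neg]
  -- Evaluating the linear phase at the shifted point reproduces the derivative of the quadratic
  -- phase in `t`. Hence the derivative is again a displaced function, namely that of `generator α
  -- f`.
  have h7 : (∑ j, Real.sqrt 2 * (α j).im * (x - t • v) j) =
      (∑ j, Real.sqrt 2 * (α j).im * x j) - 2 * t * (∑ j, (α j).re * (α j).im) := by
    rw [Finset.mul_sum, ← Finset.sum_sub_distrib]
    refine Finset.sum_congr rfl fun j _ => ?_
    have h8 : Real.sqrt 2 * Real.sqrt 2 = 2 := Real.mul_self_sqrt (by norm_num)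
    simp only [hv, PiLp.sub_apply, PiLp.smul_apply, smul_eq_mul]
    linear_combination (-(α j).im * t * (α j).re) * h8
  rw [h7]
  ring

theorem hasDerivAt_inner_displacement (α : Fin m → ℂ) (g f : Schw m) (t : ℝ) :
    HasDerivAt (fun t : ℝ => ⟪toVec g, displacement (t • α) (toVec f)⟫_ℂ)
      ⟪toVec g, displacement (t • α) (toVec (generator α f))⟫_ℂ t := by
  simp only [inner_displacement]
  obtain ⟨C, hC⟩ := exists_norm_le f
  obtain ⟨C', hC'⟩ := exists_norm_le (generator α f)
  refine (hasDerivAt_integral_of_dominated_loc_of_deriv_le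
    (F := fun (t : ℝ) x => starRingEnd ℂ (g x) * (phase (t • α) x * f (shift (t • α) x)))
    (F' := fun (t : ℝ) x =>
      starRingEnd ℂ (g x) * (phase (t • α) x * generator α f (shift (t • α) x)))
    (s := Set.univ) (bound := fun x => ‖g x‖ * C') Filter.univ_mem ?_ ?_ ?_ ?_ ?_ ?_).2
  · exact Filter.Eventually.of_forall fun t => integrand_measurable _ g f
  · exact (g.integrable.norm.mul_const C).mono' (integrand_measurable _ g f)
      (Filter.Eventually.of_forall fun x => integrand_norm_le _ g f hC x)
  · exact integrand_measurable _ g (generator α f)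
  · exact Filter.Eventually.of_forall fun x t _ => integrand_norm_le _ g (generator α f) hC' x
  · exact g.integrable.norm.mul_const C'
  · exact Filter.Eventually.of_forall fun x t _ => (hasDerivAt_integrand α f x t).const_mul _

end Displacement

section Ampliation

variable {m : ℕ} {R : Type*} [NormedAddCommGroup R] [InnerProductSpace ℂ R]

/-! ### Displacements of one half of a bipartite system -/

variable (R) in
/-- The operator `1 ⊗ D(α)`. -/
def ampDisp (α : Fin m → ℂ) : HTensor R (ModeSpace m) →L[ℂ] HTensor R (ModeSpace m) :=
  ((displacementₗᵢ α).lTensor R).toContinuousLinearMap.completion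

theorem ampDisp_tmul (α : Fin m → ℂ) (e : R) (ψ : ModeSpace m) :
    ampDisp R α ((e ⊗ₜ[ℂ] ψ : R ⊗[ℂ] ModeSpace m) : HTensor R (ModeSpace m)) =
      ((e ⊗ₜ[ℂ] displacement α ψ : R ⊗[ℂ] ModeSpace m) : HTensor R (ModeSpace m)) :=
  ContinuousLinearMap.completion_apply_coe _ _

theorem ampDisp_norm (α : Fin m → ℂ) (x : HTensor R (ModeSpace m)) : ‖ampDisp R α x‖ = ‖x‖ := by
  refine UniformSpace.Completion.induction_on x
    (isClosed_eq (by fun_prop) (by fun_prop)) fun a => ?_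
  have h : ampDisp R α (a : HTensor R (ModeSpace m)) =
      (((displacementₗᵢ α).lTensor R a : R ⊗[ℂ] ModeSpace m) : HTensor R (ModeSpace m)) :=
    ContinuousLinearMap.completion_apply_coe _ _
  rw [h, UniformSpace.Completion.norm_coe, UniformSpace.Completion.norm_coe,
    LinearIsometry.norm_map]

variable (R) in
/-- The isometry `1 ⊗ D(α)`. -/
def ampDispₗᵢ (α : Fin m → ℂ) : HTensor R (ModeSpace m) →ₗᵢ[ℂ] HTensor R (ModeSpace m) where
  toLinearMap := (ampDisp R α).toLinearMap
  norm_map' := ampDisp_norm α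

theorem ampDisp_inner (α : Fin m → ℂ) (x y : HTensor R (ModeSpace m)) :
    ⟪ampDisp R α x, ampDisp R α y⟫_ℂ = ⟪x, y⟫_ℂ :=
  (ampDispₗᵢ R α).inner_map_map x y

/-- Bounded operators on `R ⊗ H` agree if they agree on product vectors. -/
theorem ext_tmul {H Z : Type*} [NormedAddCommGroup H] [InnerProductSpace ℂ H]
    [NormedAddCommGroup Z] [NormedSpace ℂ Z] {A B : HTensor R H →L[ℂ] Z}
    (h : ∀ (e : R) (ψ : H), A ((e ⊗ₜ[ℂ] ψ : R ⊗[ℂ] H) : HTensor R H) =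
      B ((e ⊗ₜ[ℂ] ψ : R ⊗[ℂ] H) : HTensor R H)) : A = B := by
  ext x
  refine UniformSpace.Completion.induction_on x
    (isClosed_eq A.continuous B.continuous) fun a => ?_
  induction a using TensorProduct.induction_on with
  | zero => rw [UniformSpace.Completion.coe_zero, map_zero, map_zero]
  | add a b ha hb => rw [UniformSpace.Completion.coe_add, map_add, map_add, ha, hb]
  | tmul e ψ => exact h e ψ

theorem eq_zero_of_inner_tmul {H : Type*} [NormedAddCommGroup H] [InnerProductSpace ℂ H]
    {x : HTensor R H}
    (h : ∀ (e : R) (ψ : H), ⟪((e ⊗ₜ[ℂ] ψ : R ⊗[ℂ] H) : HTensor R H), x⟫_ℂ = 0) : x = 0 := by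
  have h1 : innerSL ℂ x = 0 := ext_tmul fun e ψ => by
    rw [innerSL_apply_apply, ← inner_conj_symm, h, map_zero]
    rfl
  have h2 : ⟪x, x⟫_ℂ = 0 := by
    rw [← innerSL_apply_apply, h1]
    rfl
  exact inner_self_eq_zero.mp h2

theorem ampDisp_smul_smul (α : Fin m → ℂ) (s t : ℝ) (x : HTensor R (ModeSpace m)) :
    ampDisp R (s • α) (ampDisp R (t • α) x) = ampDisp R ((s + t) • α) x := by
  have h : ampDisp R (s • α) ∘L ampDisp R (t • α) = ampDisp R ((s + t) • α) :=
    ext_tmul fun e ψ => by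
      rw [ContinuousLinearMap.comp_apply, ampDisp_tmul, ampDisp_tmul, ampDisp_tmul,
        displacement_smul_smul]
  exact DFunLike.congr_fun h x

theorem ampDisp_ampDisp_neg (α : Fin m → ℂ) (x : HTensor R (ModeSpace m)) :
    ampDisp R α (ampDisp R (-α) x) = x := by
  have h : ampDisp R α ∘L ampDisp R (-α) = ContinuousLinearMap.id ℂ _ :=
    ext_tmul fun e ψ => by
      rw [ContinuousLinearMap.comp_apply, ampDisp_tmul, ampDisp_tmul,
        displacement_displacement_neg]
      rfl
  exact DFunLike.congr_fun h x

theorem adjoint_ampDisp (α : Fin m → ℂ) : (ampDisp R α).adjoint = ampDisp R (-α) := by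
  symm
  rw [ContinuousLinearMap.eq_adjoint_iff]
  intro x y
  rw [← ampDisp_inner α, ampDisp_ampDisp_neg]

theorem ampDisp_comp_ketTensor (α : Fin m → ℂ) (e : R) :
    ampDisp R α ∘L ketTensor e = ketTensor e ∘L displacement α := by
  ext1 ψ
  exact ampDisp_tmul α e ψ

theorem adjoint_ketTensor_comp_ampDisp (α : Fin m → ℂ) (e : R) :
    (ketTensor e).adjoint ∘L ampDisp R α = displacement α ∘L (ketTensor e).adjoint := by
  have h := congrArg ContinuousLinearMap.adjoint (ampDisp_comp_ketTensor (-α) e)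
  rw [ContinuousLinearMap.adjoint_comp, ContinuousLinearMap.adjoint_comp, adjoint_ampDisp,
    adjoint_displacement, neg_neg] at h
  exact h

/-- The channel `I ⊗ 𝒟_α`. -/
def ampChannel (α : Fin m → ℂ) (T : HTensor R (ModeSpace m) →L[ℂ] HTensor R (ModeSpace m)) :
    HTensor R (ModeSpace m) →L[ℂ] HTensor R (ModeSpace m) :=
  ampDisp R α ∘L T ∘L (ampDisp R α).adjoint

theorem slice_ampChannel (α : Fin m → ℂ)
    (T : HTensor R (ModeSpace m) →L[ℂ] HTensor R (ModeSpace m)) (e f : R) :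
    slice (ampChannel α T) e f = displacementChannel α (slice T e f) := by
  ext1 ψ
  have h1 : ∀ x, (ketTensor e).adjoint (ampDisp R α x) =
      displacement α ((ketTensor e).adjoint x) :=
    fun x => DFunLike.congr_fun (adjoint_ketTensor_comp_ampDisp α e) x
  have h2 : ampDisp R (-α) (ketTensor f ψ) = ketTensor f (displacement (-α) ψ) :=
    DFunLike.congr_fun (ampDisp_comp_ketTensor (-α) f) ψ
  rw [displacementChannel_apply]
  simp only [slice, ampChannel, ContinuousLinearMap.comp_apply]
  rw [adjoint_ampDisp, h1, h2]

/-! ### A common domain -/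

variable (m R) in
/-- The embedding of the algebraic tensor product of `R` with the Schwartz space. -/
def toHTensor : R ⊗[ℂ] Schw m →ₗ[ℂ] HTensor R (ModeSpace m) :=
  (UniformSpace.Completion.toComplL (𝕜 := ℂ) (E := R ⊗[ℂ] ModeSpace m)).toLinearMap ∘ₗ
    LinearMap.lTensor R (toVecL m)

theorem toHTensor_tmul (e : R) (f : Schw m) :
    toHTensor m R (e ⊗ₜ f) = ((e ⊗ₜ[ℂ] toVec f : R ⊗[ℂ] ModeSpace m) :
      HTensor R (ModeSpace m)) := rfl

theorem inner_toHTensor_tmul (e e' : R) (f f' : Schw m) :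
    ⟪toHTensor m R (e ⊗ₜ f), toHTensor m R (e' ⊗ₜ f')⟫_ℂ =
      ⟪e, e'⟫_ℂ * ⟪toVec f, toVec f'⟫_ℂ := by
  rw [toHTensor_tmul, toHTensor_tmul, UniformSpace.Completion.inner_coe,
    TensorProduct.inner_tmul]

theorem inner_lTensor_adjoint {A B : Module.End ℂ (Schw m)}
    (h : ∀ f g, ⟪toVec (A f), toVec g⟫_ℂ = ⟪toVec f, toVec (B g)⟫_ℂ) (x y : R ⊗[ℂ] Schw m) :
    ⟪toHTensor m R (A.lTensor R x), toHTensor m R y⟫_ℂ =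
      ⟪toHTensor m R x, toHTensor m R (B.lTensor R y)⟫_ℂ := by
  induction x using TensorProduct.induction_on with
  | zero => simp
  | add a b ha hb => simp only [map_add, inner_add_left, ha, hb]
  | tmul e f =>
    induction y using TensorProduct.induction_on with
    | zero => simp
    | add a b ha hb => simp only [map_add, inner_add_right, ha, hb]
    | tmul e' f' =>
      rw [LinearMap.lTensor_tmul, LinearMap.lTensor_tmul, inner_toHTensor_tmul,
        inner_toHTensor_tmul, h]

theorem eq_zero_of_inner_basis {ι : Type*} (b : HilbertBasis ι ℂ R) {x : R}
    (h : ∀ i, ⟪b i, x⟫_ℂ = 0) : x = 0 := by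
  refine b.repr.injective ?_
  ext i
  rw [b.repr_apply_apply, h, map_zero]
  rfl

theorem continuous_inner_ampDisp (y x : R ⊗[ℂ] Schw m) :
    Continuous fun α : Fin m → ℂ => ⟪toHTensor m R y, ampDisp R α (toHTensor m R x)⟫_ℂ := by
  induction x using TensorProduct.induction_on with
  | zero =>
    simp only [map_zero, inner_zero_right]
    exact continuous_const
  | add a b ha hb =>
    simp only [map_add, inner_add_right]
    exact ha.add hb
  | tmul e f =>
    induction y using TensorProduct.induction_on with
    | zero =>
      simp only [map_zero, inner_zero_left]
      exact continuous_const
    | add a b ha hb =>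
      simp only [map_add, inner_add_left]
      exact ha.add hb
    | tmul e' f' =>
      simp only [toHTensor_tmul, ampDisp_tmul, UniformSpace.Completion.inner_coe,
        TensorProduct.inner_tmul]
      exact continuous_const.mul (continuous_inner_displacement f' f)

variable [CompleteSpace R]

variable (R m) in
theorem orthonormal_tensor : Orthonormal ℂ (fun p : basisIndex R × (Fin m → ℕ) =>
    toHTensor m R (stdBasis R p.1 ⊗ₜ fock p.2)) := by
  classical
  rw [orthonormal_iff_ite]
  rintro ⟨i, n⟩ ⟨j, k⟩
  have h1 := orthonormal_iff_ite.mp (stdBasis R).orthonormal i j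
  have h2 := orthonormal_iff_ite.mp (orthonormal_fock m) n k
  rw [inner_toHTensor_tmul, h1, h2]
  simp only [Prod.mk.injEq]
  split_ifs <;> simp_all

/-- Completeness is applied one factor at a time: to the components `(⟨eᵢ| ⊗ 1) x` in `L²`, then to
the basis of `R`. -/
theorem eq_zero_of_inner_tensor (x : HTensor R (ModeSpace m))
    (h : ∀ i n, ⟪toHTensor m R (stdBasis R i ⊗ₜ fock n), x⟫_ℂ = 0) : x = 0 := by
  have h1 : ∀ i, (ketTensor (stdBasis R i)).adjoint x = 0 := fun i =>
    eq_zero_of_inner_fock_eq_zero _ fun n => by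
      rw [ContinuousLinearMap.adjoint_inner_right]
      exact h i n
  refine eq_zero_of_inner_tmul fun e ψ => ?_
  set L : R →L[ℂ] HTensor R (ModeSpace m) :=
    (UniformSpace.Completion.toComplL (𝕜 := ℂ) (E := R ⊗[ℂ] ModeSpace m)).comp
      ((TensorProduct.mkL ℂ R (ModeSpace m)).flip ψ) with hL
  have h2 : L.adjoint x = 0 := eq_zero_of_inner_basis (stdBasis R) fun i => by
    rw [ContinuousLinearMap.adjoint_inner_right]
    have h3 : L (stdBasis R i) = ketTensor (stdBasis R i) ψ := rfl
    rw [h3, ← ContinuousLinearMap.adjoint_inner_right, h1, inner_zero_right]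
  have h4 : ((e ⊗ₜ[ℂ] ψ : R ⊗[ℂ] ModeSpace m) : HTensor R (ModeSpace m)) = L e := rfl
  rw [h4, ← ContinuousLinearMap.adjoint_inner_right, h2, inner_zero_right]

variable (R m) in
/-- The orthonormal basis `eᵢ ⊗ |n⟩` of `R ⊗ L²(ℝᵐ)`. -/
def tensorBasis : HilbertBasis (basisIndex R × (Fin m → ℕ)) ℂ (HTensor R (ModeSpace m)) :=
  HilbertBasis.mkOfOrthogonalEqBot (orthonormal_tensor m R) (by
    rw [Submodule.eq_bot_iff]
    intro x hx
    rw [Submodule.mem_orthogonal] at hx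
    exact eq_zero_of_inner_tensor x fun i n => hx _ (Submodule.subset_span ⟨(i, n), rfl⟩))

theorem tensorBasis_apply (p : basisIndex R × (Fin m → ℕ)) :
    tensorBasis m R p = toHTensor m R (stdBasis R p.1 ⊗ₜ fock p.2) := by
  rw [tensorBasis, HilbertBasis.coe_mkOfOrthogonalEqBot]

variable (R m) in
theorem denseRange_toHTensor : DenseRange (toHTensor m R) := by
  have h := (tensorBasis m R).dense_span
  have h2 : Submodule.span ℂ (Set.range (tensorBasis m R)) ≤ LinearMap.range (toHTensor m R) := by
    rw [Submodule.span_le]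
    rintro _ ⟨p, rfl⟩
    exact ⟨_, (tensorBasis_apply p).symm⟩
  have h3 : Dense ((Submodule.span ℂ (Set.range (tensorBasis m R)) : Submodule ℂ _) :
      Set (HTensor R (ModeSpace m))) := Submodule.dense_iff_topologicalClosure_eq_top.mpr h
  exact h3.mono fun x hx => h2 hx

/-! ### Strong continuity -/

/-- The family is uniformly Lipschitz in the parameter `y`, so `f y` is a uniform limit of
continuous functions. -/
theorem continuous_of_dense {X K Z : Type*} [TopologicalSpace X] [PseudoMetricSpace K]
    [PseudoMetricSpace Z] {s : Set K} (hs : Dense s) {f : K → X → Z} (C : ℝ)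
    (hf : ∀ y ∈ s, Continuous (f y)) (hd : ∀ y y' a, dist (f y a) (f y' a) ≤ C * dist y y')
    (y : K) : Continuous (f y) := by
  refine continuous_of_uniform_approx_of_continuous fun u hu => ?_
  obtain ⟨ε, hε, hu⟩ := Metric.mem_uniformity_dist.mp hu
  -- Dividing by `|C| + 1` keeps the radius positive even when `C` is zero or negative.
  obtain ⟨y', hy', hyy⟩ := hs.exists_dist_lt y (ε := ε / (|C| + 1)) (by positivity)
  refine ⟨f y', hf y' hy', fun a => hu ((hd y y' a).trans_lt ?_)⟩
  rw [lt_div_iff₀ (by positivity)] at hyy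
  have h1 : C * dist y y' ≤ |C| * dist y y' :=
    mul_le_mul_of_nonneg_right (le_abs_self C) dist_nonneg
  nlinarith [dist_nonneg (x := y) (y := y')]

/-- For isometries weak continuity implies strong continuity, since `‖u - w‖² = 2‖x‖² - 2 Re⟨w, u⟩`
when both have the norm of `x`. Weak continuity itself is extended from the Schwartz domain by
density. -/
theorem continuous_ampDisp (x : HTensor R (ModeSpace m)) :
    Continuous fun α : Fin m → ℂ => ampDisp R α x := by
  refine continuous_of_dense (denseRange_toHTensor m R) (f := fun x α => ampDisp R α x) 1 ?_ ?_ x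
  · rintro _ ⟨x, rfl⟩
    have hw : ∀ y, Continuous fun α : Fin m → ℂ => ⟪y, ampDisp R α (toHTensor m R x)⟫_ℂ := by
      refine continuous_of_dense (denseRange_toHTensor m R)
        (f := fun y α => ⟪y, ampDisp R α (toHTensor m R x)⟫_ℂ) ‖toHTensor m R x‖ ?_ ?_
      · rintro _ ⟨y, rfl⟩
        exact continuous_inner_ampDisp y x
      · intro y y' α
        rw [dist_eq_norm, ← inner_sub_left, dist_eq_norm]
        refine (norm_inner_le_norm _ _).trans ?_
        rw [ampDisp_norm, mul_comm]
    refine continuous_iff_continuousAt.mpr fun β => ?_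
    rw [ContinuousAt, tendsto_iff_norm_sub_tendsto_zero]
    have h1 : ∀ α : Fin m → ℂ, ‖ampDisp R α (toHTensor m R x) - ampDisp R β (toHTensor m R x)‖ =
        Real.sqrt (2 * ‖toHTensor m R x‖ ^ 2 - 2 * RCLike.re
          ⟪ampDisp R β (toHTensor m R x), ampDisp R α (toHTensor m R x)⟫_ℂ) := by
      intro α
      rw [← Real.sqrt_sq (norm_nonneg (_ - _)), norm_sub_sq (𝕜 := ℂ), ampDisp_norm, ampDisp_norm,
        inner_re_symm]
      congr 1
      ring
    simp only [h1]
    have h2 : Continuous fun α : Fin m → ℂ => Real.sqrt (2 * ‖toHTensor m R x‖ ^ 2 - 2 * RCLike.re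
          ⟪ampDisp R β (toHTensor m R x), ampDisp R α (toHTensor m R x)⟫_ℂ) :=
      Real.continuous_sqrt.comp (continuous_const.sub
        (continuous_const.mul (RCLike.continuous_re.comp (hw _))))
    have h3 := h2.tendsto β
    rw [inner_self_eq_norm_sq, ampDisp_norm, sub_self, Real.sqrt_zero] at h3
    exact h3
  · intro y y' α
    rw [dist_eq_norm, ← map_sub, ampDisp_norm, dist_eq_norm, one_mul]

end Ampliation

/-! ### The quantum speed limit for displacements of finite-energy vectors -/

section SpeedLimit

variable {m : ℕ} {R : Type*} [NormedAddCommGroup R] [InnerProductSpace ℂ R]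

/-! ### The speed of a displacement on the common domain -/

theorem hasDerivAt_inner_ampDisp (α : Fin m → ℂ) (y x : R ⊗[ℂ] Schw m) (t : ℝ) :
    HasDerivAt (fun t : ℝ => ⟪toHTensor m R y, ampDisp R (t • α) (toHTensor m R x)⟫_ℂ)
      ⟪toHTensor m R y,
        ampDisp R (t • α) (toHTensor m R ((generator α).lTensor R x))⟫_ℂ t := by
  induction x using TensorProduct.induction_on with
  | zero =>
    simp only [map_zero, inner_zero_right]
    exact hasDerivAt_const _ _
  | add a b ha hb =>
    simp only [map_add, inner_add_right]
    exact ha.fun_add hb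
  | tmul e f =>
    induction y using TensorProduct.induction_on with
    | zero =>
      simp only [map_zero, inner_zero_left]
      exact hasDerivAt_const _ _
    | add a b ha hb =>
      simp only [map_add, inner_add_left]
      exact ha.fun_add hb
    | tmul e' f' =>
      simp only [toHTensor_tmul, ampDisp_tmul, UniformSpace.Completion.inner_coe,
        TensorProduct.inner_tmul, LinearMap.lTensor_tmul]
      exact (hasDerivAt_inner_displacement α f' f t).const_mul _

variable (R) in
/-- The unitary group `exp(-itc) (1 ⊗ D(tα))`. -/
def phasedDisp (α : Fin m → ℂ) (c t : ℝ) : HTensor R (ModeSpace m) →L[ℂ] HTensor R (ModeSpace m) :=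
  Complex.exp (((-t * c : ℝ) : ℂ) * Complex.I) • ampDisp R (t • α)

theorem phasedDisp_apply (α : Fin m → ℂ) (c t : ℝ) (x : HTensor R (ModeSpace m)) :
    phasedDisp R α c t x = Complex.exp (((-t * c : ℝ) : ℂ) * Complex.I) • ampDisp R (t • α) x := rfl

theorem phasedDisp_norm (α : Fin m → ℂ) (c t : ℝ) (x : HTensor R (ModeSpace m)) :
    ‖phasedDisp R α c t x‖ = ‖x‖ := by
  rw [phasedDisp_apply, norm_smul, Complex.norm_exp_ofReal_mul_I, one_mul, ampDisp_norm]

theorem phasedDisp_phasedDisp (α : Fin m → ℂ) (c s t : ℝ) (x : HTensor R (ModeSpace m)) :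
    phasedDisp R α c s (phasedDisp R α c t x) = phasedDisp R α c (s + t) x := by
  simp only [phasedDisp_apply, map_smul, smul_smul, ampDisp_smul_smul]
  rw [← Complex.exp_add]
  congr 2
  push_cast
  ring

theorem phasedDisp_zero (α : Fin m → ℂ) (c : ℝ) (x : HTensor R (ModeSpace m)) :
    phasedDisp R α c 0 x = x := by
  have h : ampDisp R (0 : Fin m → ℂ) = ContinuousLinearMap.id ℂ _ :=
    ext_tmul fun e ψ => by
      rw [ampDisp_tmul, displacement_zero]
      rfl
  rw [phasedDisp_apply, zero_smul, h]
  simp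

theorem norm_le_of_inner_le_of_dense {K : Type*} [NormedAddCommGroup K] [InnerProductSpace ℂ K]
    {s : Set K} (hs : Dense s) {z : K} {C : ℝ} (hC : 0 ≤ C)
    (h : ∀ y ∈ s, ‖⟪y, z⟫_ℂ‖ ≤ ‖y‖ * C) :
    ‖z‖ ≤ C := by
  have h1 : ∀ y, ‖⟪y, z⟫_ℂ‖ ≤ ‖y‖ * C := by
    intro y
    have hc : IsClosed {y : K | ‖⟪y, z⟫_ℂ‖ ≤ ‖y‖ * C} :=
      isClosed_le (by fun_prop) (by fun_prop)
    have h2 := hs.closure_eq ▸ hc.closure_subset_iff.mpr h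
    exact h2 (Set.mem_univ y)
  have h2 := h1 z
  rw [inner_self_eq_norm_sq_to_K, norm_pow, RCLike.norm_ofReal, abs_norm, sq] at h2
  rcases eq_or_lt_of_le (norm_nonneg z) with hz | hz
  · rwa [← hz]
  · exact le_of_mul_le_mul_left h2 hz

/-- The derivative of `⟨y, V_t x⟩` is `⟨y, V_t z⟩`, which is bounded by `‖y‖ ‖z‖` because `V_t` is
isometric. The mean value inequality for each `y` in a dense set then controls the norm, so only
weak derivatives are needed. -/
theorem norm_phasedDisp_sub_le [CompleteSpace R] (α : Fin m → ℂ) (c t : ℝ) (x : R ⊗[ℂ] Schw m) :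
    ‖phasedDisp R α c t (toHTensor m R x) - toHTensor m R x‖ ≤
      |t| * ‖toHTensor m R
        ((generator α - ((c : ℂ) * Complex.I) • (1 : Module.End ℂ (Schw m))).lTensor R x)‖ := by
  set z := (generator α - ((c : ℂ) * Complex.I) • (1 : Module.End ℂ (Schw m))).lTensor R x with hz
  refine norm_le_of_inner_le_of_dense (denseRange_toHTensor m R) 
    (mul_nonneg (abs_nonneg t) (norm_nonneg _)) ?_
  rintro _ ⟨y, rfl⟩
  have hd : ∀ t : ℝ, HasDerivAt
      (fun t : ℝ => ⟪toHTensor m R y, phasedDisp R α c t (toHTensor m R x)⟫_ℂ)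
      ⟪toHTensor m R y, phasedDisp R α c t (toHTensor m R z)⟫_ℂ t := by
    intro t
    simp only [phasedDisp_apply, inner_smul_right]
    have h1 : HasDerivAt (fun t : ℝ => (((-t * c : ℝ) : ℂ) * Complex.I))
        (((-c : ℝ) : ℂ) * Complex.I) t := by
      refine HasDerivAt.mul_const (HasDerivAt.ofReal_comp ?_) _
      simpa using (hasDerivAt_neg t).mul_const c
    refine (h1.cexp.fun_mul (hasDerivAt_inner_ampDisp α y x t)).congr_deriv ?_
    have hz' : z = (generator α).lTensor R x - ((c : ℂ) * Complex.I) • x := by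
      rw [hz, LinearMap.lTensor_sub, LinearMap.lTensor_smul]
      simp [Module.End.one_eq_id]
    rw [hz', map_sub, map_smul, map_sub, map_smul, inner_sub_right, inner_smul_right]
    push_cast
    ring
  have h2 := Convex.norm_image_sub_le_of_norm_hasDerivWithin_le (𝕜 := ℝ) (s := Set.univ)
    (C := ‖toHTensor m R y‖ * ‖toHTensor m R z‖)
    (fun t _ => (hd t).hasDerivWithinAt) (fun t _ => ?_) convex_univ (Set.mem_univ 0)
    (Set.mem_univ t)
  · rw [phasedDisp_zero, ← inner_sub_right, sub_zero, Real.norm_eq_abs] at h2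
    linarith
  · exact (norm_inner_le_norm _ _).trans (by rw [phasedDisp_norm])

/-- The length `|α|` of a displacement vector. -/
def ampl (α : Fin m → ℂ) : ℝ := Real.sqrt (∑ j, ‖α j‖ ^ 2)

theorem ampl_nonneg (α : Fin m → ℂ) : 0 ≤ ampl α := Real.sqrt_nonneg _

theorem ampl_sq (α : Fin m → ℂ) : ampl α ^ 2 = ∑ j, ‖α j‖ ^ 2 :=
  Real.sq_sqrt (Finset.sum_nonneg fun _ _ => by positivity)

/-- The centred annihilation operator `aⱼ - μⱼ`. -/
def centredAnnihilation (μ : Fin m → ℂ) (j : Fin m) : Module.End ℂ (Schw m) :=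
  annihilation j - μ j • 1

/-- The centred creation operator `aⱼ† - μⱼ*`. -/
def centredCreation (μ : Fin m → ℂ) (j : Fin m) : Module.End ℂ (Schw m) :=
  creation j - starRingEnd ℂ (μ j) • 1

/-- The combination `∑ⱼ αⱼ* (aⱼ - μⱼ)`. -/
def lowering (α μ : Fin m → ℂ) : Module.End ℂ (Schw m) :=
  ∑ j, starRingEnd ℂ (α j) • centredAnnihilation μ j

/-- The combination `∑ⱼ αⱼ (aⱼ† - μⱼ*)`. -/
def raising (α μ : Fin m → ℂ) : Module.End ℂ (Schw m) :=
  ∑ j, α j • centredCreation μ j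

/-- Centring the ladder operators changes the generator only by an imaginary scalar, which the phase
in `phasedDisp` removes. This is the origin of the constant `2 Im ∑ αⱼ μⱼ*`. -/
theorem raising_sub_lowering (α μ : Fin m → ℂ) :
    raising α μ - lowering α μ = generator α -
      (((2 * (∑ j, α j * starRingEnd ℂ (μ j)).im : ℝ) : ℂ) * Complex.I) •
        (1 : Module.End ℂ (Schw m)) := by
  have h1 : (((2 * (∑ j, α j * starRingEnd ℂ (μ j)).im : ℝ) : ℂ) * Complex.I) =
      ∑ j, (α j * starRingEnd ℂ (μ j) - starRingEnd ℂ (α j) * μ j) := by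
    rw [← Complex.sub_conj, Finset.sum_sub_distrib, map_sum]
    simp
  rw [h1, raising, lowering, generator, Finset.sum_smul, ← Finset.sum_sub_distrib,
    ← Finset.sum_sub_distrib]
  refine Finset.sum_congr rfl fun j _ => ?_
  rw [centredAnnihilation, centredCreation]
  module

/-- Subtracting scalars leaves commutators unchanged, so only the diagonal terms `‖αⱼ‖²` survive. -/
theorem lowering_mul_raising (α μ : Fin m → ℂ) :
    lowering α μ * raising α μ = raising α μ * lowering α μ +
      ((ampl α ^ 2 : ℝ) : ℂ) • (1 : Module.End ℂ (Schw m)) := by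
  have h1 : ∀ i j : Fin m, centredAnnihilation μ i * centredCreation μ j =
      centredCreation μ j * centredAnnihilation μ i +
        (if i = j then 1 else 0 : Module.End ℂ (Schw m)) := by
    intro i j
    simp only [centredAnnihilation, centredCreation, sub_mul, mul_sub, annihilation_mul_creation,
      smul_mul_assoc, mul_smul_comm, one_mul, mul_one]
    module
  simp only [lowering, raising, Finset.sum_mul_sum, smul_mul_smul_comm, h1, smul_add,
    Finset.sum_add_distrib]
  congr 1
  · rw [Finset.sum_comm]
    refine Finset.sum_congr rfl fun j _ => Finset.sum_congr rfl fun i _ => ?_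
    rw [mul_comm]
  · simp only [smul_ite, smul_zero, Finset.sum_ite_eq, Finset.mem_univ, if_true]
    rw [ampl_sq, ← Finset.sum_smul]
    congr 1
    push_cast
    refine Finset.sum_congr rfl fun j _ => ?_
    rw [mul_comm, Complex.mul_conj, Complex.normSq_eq_norm_sq]
    push_cast
    rfl

theorem inner_raising (α μ : Fin m → ℂ) (f g : Schw m) :
    ⟪toVec (raising α μ f), toVec g⟫_ℂ = ⟪toVec f, toVec (lowering α μ g)⟫_ℂ := by
  have h := fun j => inner_creation (m := m) j f g
  simp only [← toVecL_apply] at *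
  simp only [raising, lowering, LinearMap.sum_apply, map_sum, sum_inner, inner_sum,
    LinearMap.smul_apply, map_smul, inner_smul_left, inner_smul_right, centredCreation,
    centredAnnihilation, LinearMap.sub_apply, map_sub, inner_sub_left, inner_sub_right, h,
    Module.End.one_apply, RCLike.conj_conj]

/-- The centred energy `∑ⱼ ‖(aⱼ - μⱼ) x‖²`. -/
def centredEnergy (μ : Fin m → ℂ) (x : R ⊗[ℂ] Schw m) : ℝ :=
  ∑ j, ‖toHTensor m R ((centredAnnihilation μ j).lTensor R x)‖ ^ 2

theorem centredEnergy_nonneg (μ : Fin m → ℂ) (x : R ⊗[ℂ] Schw m) : 0 ≤ centredEnergy μ x :=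
  Finset.sum_nonneg fun _ _ => by positivity

theorem norm_lowering_le (α μ : Fin m → ℂ) (x : R ⊗[ℂ] Schw m) :
    ‖toHTensor m R ((lowering α μ).lTensor R x)‖ ≤ ampl α * Real.sqrt (centredEnergy μ x) := by
  have h : toHTensor m R ((lowering α μ).lTensor R x) =
      ∑ j, starRingEnd ℂ (α j) • toHTensor m R ((centredAnnihilation μ j).lTensor R x) := by
    have h1 : (lowering α μ).lTensor R =
        ∑ j, starRingEnd ℂ (α j) • (centredAnnihilation μ j).lTensor R := by
      rw [← LinearMap.coe_lTensorHom, lowering, map_sum]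
      simp only [map_smul]
    rw [h1]
    simp only [LinearMap.sum_apply, LinearMap.smul_apply, map_sum, map_smul]
  rw [h]
  refine (norm_sum_le _ _).trans ?_
  simp only [norm_smul, RCLike.norm_conj]
  exact Real.sum_mul_le_sqrt_mul_sqrt _ _ _

/-- The two operators are mutually adjoint on the Schwartz domain, so the difference of the squared
norms is the expectation of their commutator, the scalar `|α|²`. -/
theorem norm_raising_sq (α μ : Fin m → ℂ) (x : R ⊗[ℂ] Schw m) :
    ‖toHTensor m R ((raising α μ).lTensor R x)‖ ^ 2 =
      ‖toHTensor m R ((lowering α μ).lTensor R x)‖ ^ 2 + ampl α ^ 2 * ‖toHTensor m R x‖ ^ 2 := by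
  have h1 := inner_lTensor_adjoint (R := R) (inner_raising α μ) x ((raising α μ).lTensor R x)
  have h2 := inner_lTensor_adjoint (R := R) (inner_raising α μ) ((lowering α μ).lTensor R x) x
  have h3 : (lowering α μ).lTensor R ((raising α μ).lTensor R x) =
      (raising α μ).lTensor R ((lowering α μ).lTensor R x) + ((ampl α ^ 2 : ℝ) : ℂ) • x := by
    rw [← LinearMap.comp_apply, ← LinearMap.lTensor_comp, ← LinearMap.comp_apply,
      ← LinearMap.lTensor_comp]
    have h4 := lowering_mul_raising α μ
    rw [Module.End.mul_eq_comp, Module.End.mul_eq_comp] at h4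
    rw [h4, LinearMap.lTensor_add, LinearMap.lTensor_smul]
    simp [Module.End.one_eq_id]
  have h5 : ⟪toHTensor m R x, toHTensor m R ((raising α μ).lTensor R
      ((lowering α μ).lTensor R x))⟫_ℂ = ⟪toHTensor m R ((lowering α μ).lTensor R x),
        toHTensor m R ((lowering α μ).lTensor R x)⟫_ℂ := by
    rw [← inner_conj_symm, h2, inner_conj_symm]
  rw [h3, map_add, map_smul, inner_add_right, inner_smul_right, h5] at h1
  simp only [inner_self_eq_norm_sq_to_K, ← RCLike.ofReal_pow] at h1
  apply Complex.ofReal_injective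
  rw [Complex.ofReal_add, Complex.ofReal_mul]
  exact h1

/-- Here `γ_E` appears: the lowering part of the generator contributes `√e`, the raising part `√(e +
‖x‖²)`. -/
theorem norm_phasedDisp_sub_le_energy [CompleteSpace R] (α μ : Fin m → ℂ) (t : ℝ)
    (x : R ⊗[ℂ] Schw m) :
    ‖phasedDisp R α (2 * (∑ j, α j * starRingEnd ℂ (μ j)).im) t (toHTensor m R x) -
        toHTensor m R x‖ ≤
      |t| * (ampl α * (Real.sqrt (centredEnergy μ x) +
        Real.sqrt (centredEnergy μ x + ‖toHTensor m R x‖ ^ 2))) := by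
  refine (norm_phasedDisp_sub_le _ _ _ _).trans (mul_le_mul_of_nonneg_left ?_ (abs_nonneg t))
  rw [← raising_sub_lowering, LinearMap.lTensor_sub, LinearMap.sub_apply, map_sub]
  refine (norm_sub_le _ _).trans ?_
  have h1 := norm_lowering_le α μ x
  have h2 : ‖toHTensor m R ((raising α μ).lTensor R x)‖ ≤
      ampl α * Real.sqrt (centredEnergy μ x + ‖toHTensor m R x‖ ^ 2) := by
    have h0 := centredEnergy_nonneg μ x
    refine le_of_sq_le_sq ?_ (mul_nonneg (ampl_nonneg α) (Real.sqrt_nonneg _))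
    rw [norm_raising_sq, mul_pow, Real.sq_sqrt (by positivity), mul_add]
    have h3 := pow_le_pow_left₀ (norm_nonneg _) h1 2
    rw [mul_pow, Real.sq_sqrt h0] at h3
    linarith
  linarith

end SpeedLimit

section Angle

open InnerProductGeometry Filter Topology

/-! ### The angle swept out by a one-parameter group of isometries -/

variable {K : Type*} [NormedAddCommGroup K] [InnerProductSpace ℝ K]

/-- A chord of the unit sphere subtending the angle `θ` has length `2 sin(θ/2)`. -/
theorem angle_le_two_mul_arcsin {x y : K} (hx : ‖x‖ = 1) (hy : ‖y‖ = 1) {s : ℝ}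
    (h : ‖y - x‖ ≤ s) : angle x y ≤ 2 * Real.arcsin (s / 2) := by
  have h1 : Real.sin (angle x y / 2) ≤ s / 2 := by
    have h2 : ‖y - x‖ ^ 2 = 4 * Real.sin (angle x y / 2) ^ 2 := by
      have h3 : Real.cos (angle x y) = inner ℝ x y := by
        rw [InnerProductGeometry.cos_angle, hx, hy]
        simp
      have h4 : Real.cos (angle x y) = 1 - 2 * Real.sin (angle x y / 2) ^ 2 := by
        rw [Real.sin_sq, show angle x y = 2 * (angle x y / 2) by ring, Real.cos_two_mul]
        ring_nf
      rw [norm_sub_sq_real, hx, hy, real_inner_comm, ← h3, h4]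
      ring
    have h0 : 0 ≤ Real.sin (angle x y / 2) :=
      Real.sin_nonneg_of_nonneg_of_le_pi (by linarith [angle_nonneg x y])
        (by linarith [angle_le_pi x y, Real.pi_pos])
    have h5 : 2 * Real.sin (angle x y / 2) ≤ ‖y - x‖ := by
      refine le_of_sq_le_sq ?_ (norm_nonneg _)
      rw [h2]
      linarith
    linarith
  have h2 := Real.monotone_arcsin h1
  rw [Real.arcsin_sin (by linarith [angle_nonneg x y, Real.pi_pos])
    (by linarith [angle_le_pi x y])] at h2
  linarith

/-- The chord estimate at time one would lose a constant. Cutting unit time into `n` steps instead,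
isometry makes all steps subtend equal angles and the triangle inequality for angles gives at most
`n · 2 arcsin(δ/(2n))`, which tends to `δ`. -/
theorem cos_le_inner_of_group {V : ℝ → K → K} (h0 : ∀ x, V 0 x = x)
    (hadd : ∀ s t x, V s (V t x) = V (s + t) x)
    (hinner : ∀ t x y, inner ℝ (V t x) (V t y) = inner ℝ x y) {x : K} (hx : ‖x‖ = 1) {δ : ℝ}
    (hδ : δ ≤ Real.pi) (h : ∀ t, 0 ≤ t → ‖V t x - x‖ ≤ t * δ) :
    Real.cos δ ≤ inner ℝ x (V 1 x) := by
  have hnorm : ∀ t y, ‖V t y‖ = ‖y‖ := fun t y => by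
    rw [norm_eq_sqrt_real_inner, hinner, ← norm_eq_sqrt_real_inner]
  have hstep : ∀ (τ : ℝ) (k : ℕ), angle x (V (k * τ) x) ≤ k * angle x (V τ x) := by
    intro τ k
    induction k with
    | zero => simp [h0, angle_self (norm_ne_zero_iff.mp (hx ▸ one_ne_zero))]
    | succ k ih =>
      refine (angle_le_angle_add_angle x (V τ x) _).trans ?_
      have h1 : V ((k + 1 : ℕ) * τ) x = V τ (V (k * τ) x) := by
        rw [hadd]
        congr 1
        push_cast
        ring
      have h2 : angle (V τ x) (V τ (V (k * τ) x)) = angle x (V (k * τ) x) := by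
        simp only [angle, hinner, hnorm]
      rw [h1, h2]
      push_cast
      linarith
  have hbound : ∀ n : ℕ, 0 < n →
      angle x (V 1 x) ≤ n * (2 * Real.arcsin ((n : ℝ)⁻¹ * δ / 2)) := by
    intro n hn
    have h1 := hstep (n : ℝ)⁻¹ n
    rw [mul_inv_cancel₀ (by positivity)] at h1
    refine h1.trans (mul_le_mul_of_nonneg_left ?_ (by positivity))
    exact angle_le_two_mul_arcsin hx ((hnorm _ _).trans hx) (h _ (by positivity))
  -- The bound `n · 2 arcsin(δ/(2n))` is the difference quotient of this function at `0` with
  -- increment `1/n`.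
  have hd : HasDerivAt (fun y : ℝ => 2 * Real.arcsin (y * δ / 2)) δ 0 := by
    have h1 : HasDerivAt (fun y : ℝ => y * δ / 2) (δ / 2) 0 := by
      simpa using ((hasDerivAt_id (0 : ℝ)).mul_const δ).div_const 2
    have h2 : HasDerivAt Real.arcsin 1 ((0 : ℝ) * δ / 2) := by
      have := Real.hasDerivAt_arcsin (x := (0 : ℝ) * δ / 2) (by simp) (by simp)
      simpa using this
    have h3 := (HasDerivAt.comp (0 : ℝ) h2 h1).const_mul 2
    refine h3.congr_deriv ?_
    ring
  have ht : Tendsto (fun n : ℕ => (n : ℝ) * (2 * Real.arcsin ((n : ℝ)⁻¹ * δ / 2))) atTop (𝓝 δ) := by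
    have h1 := hd.tendsto_slope_zero_right.comp
      (tendsto_inv_atTop_nhdsGT_zero.comp (tendsto_natCast_atTop_atTop (R := ℝ)))
    refine h1.congr fun n => ?_
    simp
  have hle : angle x (V 1 x) ≤ δ :=
    ge_of_tendsto ht (eventually_gt_atTop 0 |>.mono hbound)
  have h5 : inner ℝ x (V 1 x) = Real.cos (angle x (V 1 x)) := by
    rw [InnerProductGeometry.cos_angle, hnorm, hx]
    simp
  rw [h5]
  exact Real.cos_le_cos_of_nonneg_of_le_pi (angle_nonneg _ _) hδ hle

theorem cos_le_re_inner_of_group {K : Type*} [NormedAddCommGroup K] [InnerProductSpace ℂ K]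
    {V : ℝ → K → K} (h0 : ∀ x, V 0 x = x) (hadd : ∀ s t x, V s (V t x) = V (s + t) x)
    (hinner : ∀ t x y, ⟪V t x, V t y⟫_ℂ = ⟪x, y⟫_ℂ) {x : K} (hx : ‖x‖ = 1) {δ : ℝ}
    (hδ : δ ≤ Real.pi) (h : ∀ t, 0 ≤ t → ‖V t x - x‖ ≤ t * δ) :
    Real.cos δ ≤ RCLike.re ⟪x, V 1 x⟫_ℂ := by
  let : InnerProductSpace ℝ K := InnerProductSpace.rclikeToReal ℂ K
  exact cos_le_inner_of_group h0 hadd (fun t x y => congrArg RCLike.re (hinner t x y)) hx hδ h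

theorem norm_inner_sub_inner_le {K : Type*} [NormedAddCommGroup K] [InnerProductSpace ℂ K]
    (M : K →L[ℂ] K) (hM : ∀ x, ‖M x‖ ≤ ‖x‖) (u v : K) :
    ‖⟪u, M u⟫_ℂ - ⟪v, M v⟫_ℂ‖ ≤ ‖u - v‖ * ‖u + v‖ := by
  have h1 : ⟪u, M u⟫_ℂ - ⟪v, M v⟫_ℂ = (1 / 2) *
      (⟪u - v, M (u + v)⟫_ℂ + ⟪u + v, M (u - v)⟫_ℂ) := by
    simp only [map_add, map_sub, inner_add_left, inner_sub_left, inner_add_right,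
      inner_sub_right]
    ring
  have h2 : ‖⟪u - v, M (u + v)⟫_ℂ‖ ≤ ‖u - v‖ * ‖u + v‖ :=
    (norm_inner_le_norm _ _).trans (mul_le_mul_of_nonneg_left (hM _) (norm_nonneg _))
  have h3 : ‖⟪u + v, M (u - v)⟫_ℂ‖ ≤ ‖u - v‖ * ‖u + v‖ :=
    (norm_inner_le_norm _ _).trans
      ((mul_le_mul_of_nonneg_left (hM _) (norm_nonneg _)).trans (mul_comm _ _).le)
  rw [h1, norm_mul]
  have h4 : ‖(1 / 2 : ℂ)‖ = 1 / 2 := by norm_num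
  rw [h4]
  linarith [norm_add_le ⟪u - v, M (u + v)⟫_ℂ ⟪u + v, M (u - v)⟫_ℂ]

/-- With `c = Re⟨v, u⟩` and equal norms, `‖u - v‖² ‖u + v‖² = 4(‖v‖⁴ - c²)`. The condition `δ ≤ π/2`
keeps the lower bound on `c` nonnegative, so it may be squared. -/
theorem norm_inner_sub_inner_le_sin {K : Type*} [NormedAddCommGroup K] [InnerProductSpace ℂ K]
    (M : K →L[ℂ] K) (hM : ∀ x, ‖M x‖ ≤ ‖x‖) {u v : K} (huv : ‖u‖ = ‖v‖) {δ : ℝ} (h0 : 0 ≤ δ)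
    (hδ : δ ≤ Real.pi / 2) (h : ‖v‖ ^ 2 * Real.cos δ ≤ RCLike.re ⟪v, u⟫_ℂ) :
    ‖⟪u, M u⟫_ℂ - ⟪v, M v⟫_ℂ‖ ≤ 2 * ‖v‖ ^ 2 * Real.sin δ := by
  refine (norm_inner_sub_inner_le M hM u v).trans ?_
  have hc : 0 ≤ Real.cos δ := Real.cos_nonneg_of_mem_Icc ⟨by linarith, hδ⟩
  have hs : 0 ≤ Real.sin δ := Real.sin_nonneg_of_nonneg_of_le_pi h0 (by linarith [Real.pi_pos])
  refine le_of_sq_le_sq ?_ (by positivity)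
  have h1 := norm_sub_sq (𝕜 := ℂ) u v
  have h2 := norm_add_sq (𝕜 := ℂ) u v
  rw [inner_re_symm] at h1 h2
  rw [mul_pow, h1, h2, huv]
  set c := RCLike.re ⟪v, u⟫_ℂ
  have h3 : (‖v‖ ^ 2 * Real.cos δ) ^ 2 ≤ c ^ 2 := pow_le_pow_left₀ (by positivity) h 2
  have h4 := Real.sin_sq_add_cos_sq δ
  have h5 : Real.sin δ ^ 2 = 1 - Real.cos δ ^ 2 := by linarith
  rw [mul_pow, h5]
  nlinarith

end Angle

section Limit

open Filter Topology

variable {m : ℕ} {R : Type*} [NormedAddCommGroup R] [InnerProductSpace ℂ R]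

/-! ### Vectors of finite energy -/

theorem norm_sum_sq_of_orthogonal {K ι : Type*} [NormedAddCommGroup K] [InnerProductSpace ℂ K]
    {f : ι → K} (h : Pairwise fun i j => ⟪f i, f j⟫_ℂ = 0) (s : Finset ι) :
    ‖∑ i ∈ s, f i‖ ^ 2 = ∑ i ∈ s, ‖f i‖ ^ 2 := by
  classical
  induction s using Finset.induction_on with
  | empty => simp
  | insert a s ha ih =>
    have h1 : ⟪f a, ∑ i ∈ s, f i⟫_ℂ = 0 := by
      rw [inner_sum]
      exact Finset.sum_eq_zero fun i hi => h (fun hai => ha (hai ▸ hi))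
    rw [Finset.sum_insert ha, Finset.sum_insert ha, norm_add_sq (𝕜 := ℂ), h1, ih]
    simp

theorem summable_of_orthogonal {K ι : Type*} [NormedAddCommGroup K] [InnerProductSpace ℂ K]
    [CompleteSpace K] {f : ι → K} (h : Pairwise fun i j => ⟪f i, f j⟫_ℂ = 0)
    (hs : Summable fun i => ‖f i‖ ^ 2) : Summable f := by
  have h1 : OrthogonalFamily ℂ (fun i => (Submodule.span ℂ {f i} : Submodule ℂ K))
      (fun i => (Submodule.span ℂ {f i}).subtypeₗᵢ) := by
    intro i j hij v w
    obtain ⟨a, ha⟩ := Submodule.mem_span_singleton.mp v.2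
    obtain ⟨b, hb⟩ := Submodule.mem_span_singleton.mp w.2
    change ⟪(v : K), (w : K)⟫_ℂ = 0
    rw [← ha, ← hb, inner_smul_left, inner_smul_right, h hij]
    simp
  exact (h1.summable_iff_norm_sq_summable
    (fun i => ⟨f i, Submodule.mem_span_singleton_self _⟩)).mpr hs

theorem norm_sq_hasSum_of_orthogonal {K ι : Type*} [NormedAddCommGroup K] [InnerProductSpace ℂ K]
    {f : ι → K} {w : K} (h : Pairwise fun i j => ⟪f i, f j⟫_ℂ = 0) (hw : HasSum f w) :
    HasSum (fun i => ‖f i‖ ^ 2) (‖w‖ ^ 2) := by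
  have h1 : Tendsto (fun s : Finset ι => ‖∑ i ∈ s, f i‖ ^ 2) atTop (𝓝 (‖w‖ ^ 2)) :=
    (Tendsto.norm hw).pow 2
  simp only [norm_sum_sq_of_orthogonal h] at h1
  exact h1

variable [CompleteSpace R]

/-- The coefficients of a vector in the basis `eᵢ ⊗ |n⟩`. -/
def coeff (v : HTensor R (ModeSpace m)) (p : basisIndex R × (Fin m → ℕ)) : ℂ :=
  ⟪tensorBasis m R p, v⟫_ℂ

theorem hasSum_coeff (v : HTensor R (ModeSpace m)) :
    HasSum (fun p => coeff v p • tensorBasis m R p) v := by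
  have h := (tensorBasis m R).hasSum_repr v
  simp only [HilbertBasis.repr_apply_apply] at h
  exact h

theorem hasSum_norm_coeff_sq (v : HTensor R (ModeSpace m)) :
    HasSum (fun p => ‖coeff v p‖ ^ 2) (‖v‖ ^ 2) := by
  have h1 : Pairwise fun p q =>
      ⟪coeff v p • tensorBasis m R p, coeff v q • tensorBasis m R q⟫_ℂ = 0 := by
    intro p q hpq
    rw [inner_smul_left, inner_smul_right, (tensorBasis m R).orthonormal.2 hpq]
    simp
  have h2 := norm_sq_hasSum_of_orthogonal h1 (hasSum_coeff v)
  simpa only [norm_smul, (tensorBasis m R).orthonormal.1, mul_one] using h2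

variable (R) in
/-- The vectors `eᵢ ⊗ aⱼ|n⟩`. -/
def loweredBasis (j : Fin m) (p : basisIndex R × (Fin m → ℕ)) : HTensor R (ModeSpace m) :=
  toHTensor m R (stdBasis R p.1 ⊗ₜ annihilation j (fock p.2))

/-- Since `aⱼ† aⱼ` is diagonal, lowering keeps the basis orthogonal. The series for `(1 ⊗ aⱼ) v`
therefore converges as soon as `∑ nⱼ |coefficient|²` does. -/
theorem inner_loweredBasis (j : Fin m) (p q : basisIndex R × (Fin m → ℕ)) :
    ⟪loweredBasis R j p, loweredBasis R j q⟫_ℂ =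
      (q.2 j : ℂ) * ⟪tensorBasis m R p, tensorBasis m R q⟫_ℂ := by
  rw [tensorBasis_apply, tensorBasis_apply, loweredBasis, loweredBasis, inner_toHTensor_tmul,
    inner_toHTensor_tmul, inner_annihilation, ← Module.End.mul_apply]
  have h := modeNumber_fock j q.2
  rw [modeNumber] at h
  rw [h]
  simp only [← toVecL_apply, map_smul, inner_smul_right]
  ring

theorem norm_loweredBasis_sq (j : Fin m) (p : basisIndex R × (Fin m → ℕ)) :
    ‖loweredBasis R j p‖ ^ 2 = p.2 j := by
  have h := inner_loweredBasis j p p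
  rw [inner_self_eq_norm_sq_to_K, inner_self_eq_norm_sq_to_K, (tensorBasis m R).orthonormal.1] at h
  have h2 : ((‖loweredBasis R j p‖ ^ 2 : ℝ) : ℂ) = ((p.2 j : ℝ) : ℂ) := by
    simpa using h
  exact Complex.ofReal_injective h2

theorem pairwise_inner_loweredBasis (j : Fin m) (c : basisIndex R × (Fin m → ℕ) → ℂ) :
    Pairwise fun p q => ⟪c p • loweredBasis R j p, c q • loweredBasis R j q⟫_ℂ = 0 := by
  intro p q hpq
  rw [inner_smul_left, inner_smul_right, inner_loweredBasis, (tensorBasis m R).orthonormal.2 hpq]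
  simp

theorem norm_smul_loweredBasis_sq (j : Fin m) (c : ℂ) (p : basisIndex R × (Fin m → ℕ)) :
    ‖c • loweredBasis R j p‖ ^ 2 = (p.2 j : ℝ) * ‖c‖ ^ 2 := by
  rw [norm_smul, mul_pow, norm_loweredBasis_sq, mul_comm]

/-- The vector `(1 ⊗ aⱼ) v`, for `v` of finite energy. -/
def lowered (j : Fin m) (v : HTensor R (ModeSpace m)) : HTensor R (ModeSpace m) :=
  ∑' p, coeff v p • loweredBasis R j p

theorem hasSum_lowered {j : Fin m} {v : HTensor R (ModeSpace m)}
    (h : Summable fun p : basisIndex R × (Fin m → ℕ) => (p.2 j : ℝ) * ‖coeff v p‖ ^ 2) :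
    HasSum (fun p => coeff v p • loweredBasis R j p) (lowered j v) := by
  refine (summable_of_orthogonal (pairwise_inner_loweredBasis j (coeff v)) ?_).hasSum
  simpa only [norm_smul_loweredBasis_sq] using h

theorem hasSum_norm_lowered_sq {j : Fin m} {v : HTensor R (ModeSpace m)}
    (h : Summable fun p : basisIndex R × (Fin m → ℕ) => (p.2 j : ℝ) * ‖coeff v p‖ ^ 2) :
    HasSum (fun p : basisIndex R × (Fin m → ℕ) => (p.2 j : ℝ) * ‖coeff v p‖ ^ 2)
      (‖lowered j v‖ ^ 2) := by
  have h1 := norm_sq_hasSum_of_orthogonal (pairwise_inner_loweredBasis j (coeff v))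
    (hasSum_lowered h)
  simpa only [norm_smul_loweredBasis_sq] using h1

/-- The energy `∑ⱼ ‖(aⱼ - μⱼ) v‖²` of a vector of finite energy. -/
def vecEnergy (μ : Fin m → ℂ) (v : HTensor R (ModeSpace m)) : ℝ :=
  ∑ j, ‖lowered j v - μ j • v‖ ^ 2

theorem vecEnergy_nonneg (μ : Fin m → ℂ) (v : HTensor R (ModeSpace m)) : 0 ≤ vecEnergy μ v :=
  Finset.sum_nonneg fun _ _ => by positivity

/-- Finite partial sums of the basis expansion lie in the Schwartz domain. Along them both `v` and
all lowered vectors converge, so the energies converge and the inequality passes to the limit. -/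
theorem norm_phasedDisp_sub_le_vecEnergy (α μ : Fin m → ℂ) (t : ℝ) {v : HTensor R (ModeSpace m)}
    (h : ∀ j, Summable fun p : basisIndex R × (Fin m → ℕ) => (p.2 j : ℝ) * ‖coeff v p‖ ^ 2) :
    ‖phasedDisp R α (2 * (∑ j, α j * starRingEnd ℂ (μ j)).im) t v - v‖ ≤
      |t| * (ampl α * (Real.sqrt (vecEnergy μ v) +
        Real.sqrt (vecEnergy μ v + ‖v‖ ^ 2))) := by
  set x : Finset (basisIndex R × (Fin m → ℕ)) → R ⊗[ℂ] Schw m := fun s =>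
    ∑ p ∈ s, coeff v p • (stdBasis R p.1 ⊗ₜ[ℂ] fock p.2) with hx
  have h1 : Tendsto (fun s => toHTensor m R (x s)) atTop (𝓝 v) := by
    have := hasSum_coeff v
    simp only [HasSum, SummationFilter.unconditional_filter, tensorBasis_apply] at this
    simpa only [hx, map_sum, map_smul] using this
  have h2 : ∀ j, Tendsto (fun s => toHTensor m R ((centredAnnihilation μ j).lTensor R (x s))) atTop
      (𝓝 (lowered j v - μ j • v)) := by
    intro j
    have h3 : Tendsto (fun s => toHTensor m R ((annihilation j).lTensor R (x s))) atTop
        (𝓝 (lowered j v)) := by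
      have := hasSum_lowered (h j)
      simp only [HasSum, SummationFilter.unconditional_filter, loweredBasis] at this
      simpa only [hx, map_sum, map_smul, LinearMap.lTensor_tmul] using this
    refine (h3.sub (h1.const_smul (μ j))).congr fun s => ?_
    rw [centredAnnihilation, LinearMap.lTensor_sub, LinearMap.lTensor_smul]
    simp [Module.End.one_eq_id]
  have h3 : Tendsto (fun s => centredEnergy μ (x s)) atTop (𝓝 (vecEnergy μ v)) :=
    tendsto_finsetSum _ fun j _ => ((h2 j).norm.pow 2)
  have h4 : Tendsto (fun s => |t| * (ampl α * (Real.sqrt (centredEnergy μ (x s)) +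
        Real.sqrt (centredEnergy μ (x s) + ‖toHTensor m R (x s)‖ ^ 2)))) atTop
      (𝓝 (|t| * (ampl α * (Real.sqrt (vecEnergy μ v) + Real.sqrt (vecEnergy μ v + ‖v‖ ^ 2))))) := by
    refine ((h3.sqrt.add ?_).const_mul _).const_mul _
    exact (h3.add (h1.norm.pow 2)).sqrt
  refine le_of_tendsto_of_tendsto ?_ h4
    (Eventually.of_forall fun s => norm_phasedDisp_sub_le_energy α μ t (x s))
  exact ((((ContinuousLinearMap.continuous _).tendsto v).comp h1).sub h1).norm

theorem gammaE_nonneg (E : ℝ) : 0 ≤ gammaE E := add_nonneg (Real.sqrt_nonneg _) (Real.sqrt_nonneg _)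

/-- The angle estimate is applied to `v/‖v‖`, which is why the energy enters per unit of `‖v‖²`. -/
theorem cos_le_re_inner_phasedDisp (α μ : Fin m → ℂ) {v : HTensor R (ModeSpace m)} (hv : v ≠ 0)
    (h : ∀ j, Summable fun p : basisIndex R × (Fin m → ℕ) => (p.2 j : ℝ) * ‖coeff v p‖ ^ 2)
    (hδ : ampl α * gammaE (vecEnergy μ v / ‖v‖ ^ 2) ≤ Real.pi) :
    ‖v‖ ^ 2 * Real.cos (ampl α * gammaE (vecEnergy μ v / ‖v‖ ^ 2)) ≤
      RCLike.re ⟪v, phasedDisp R α (2 * (∑ j, α j * starRingEnd ℂ (μ j)).im) 1 v⟫_ℂ := by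
  set c := 2 * (∑ j, α j * starRingEnd ℂ (μ j)).im
  have hv0 : 0 < ‖v‖ := norm_pos_iff.mpr hv
  set w : HTensor R (ModeSpace m) := ((‖v‖⁻¹ : ℝ) : ℂ) • v with hw
  have hvw : v = ((‖v‖ : ℝ) : ℂ) • w := by
    rw [hw, smul_smul, ← Complex.ofReal_mul, mul_inv_cancel₀ hv0.ne', Complex.ofReal_one, one_smul]
  have hw1 : ‖w‖ = 1 := by
    rw [hw, norm_smul, Complex.norm_real, norm_inv, norm_norm, inv_mul_cancel₀ hv0.ne']
  have key := cos_le_re_inner_of_group (V := fun t => phasedDisp R α c t) (x := w)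
    (phasedDisp_zero α c) (phasedDisp_phasedDisp α c) (fun t x y => ?_) hw1 hδ ?_
  · conv_rhs => rw [hvw]
    rw [map_smul, inner_smul_left, inner_smul_right, Complex.conj_ofReal, ← mul_assoc,
      ← Complex.ofReal_mul, ← sq]
    have h1 : RCLike.re (((‖v‖ ^ 2 : ℝ) : ℂ) * ⟪w, phasedDisp R α c 1 w⟫_ℂ) =
        ‖v‖ ^ 2 * RCLike.re ⟪w, phasedDisp R α c 1 w⟫_ℂ := RCLike.re_ofReal_mul _ _
    rw [h1]
    exact mul_le_mul_of_nonneg_left key (by positivity)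
  · simp only [phasedDisp_apply, inner_smul_left, inner_smul_right, ampDisp_inner]
    rw [← mul_assoc, Complex.mul_conj', Complex.norm_exp_ofReal_mul_I]
    simp
  · intro t ht
    have h1 := norm_phasedDisp_sub_le_vecEnergy α μ t h
    rw [abs_of_nonneg ht] at h1
    have h2 : phasedDisp R α c t w - w = ((‖v‖⁻¹ : ℝ) : ℂ) • (phasedDisp R α c t v - v) := by
      rw [hw, map_smul, smul_sub]
    rw [h2, norm_smul, Complex.norm_real, norm_inv, norm_norm, inv_mul_le_iff₀ hv0]
    refine h1.trans (le_of_eq ?_)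
    have h3 : Real.sqrt (vecEnergy μ v / ‖v‖ ^ 2) = Real.sqrt (vecEnergy μ v) / ‖v‖ := by
      rw [Real.sqrt_div (vecEnergy_nonneg μ v), Real.sqrt_sq hv0.le]
    have h4 : Real.sqrt (vecEnergy μ v / ‖v‖ ^ 2 + 1) =
        Real.sqrt (vecEnergy μ v + ‖v‖ ^ 2) / ‖v‖ := by
      rw [← Real.sqrt_sq hv0.le, ← Real.sqrt_div (by
        have := vecEnergy_nonneg μ v
        positivity), Real.sqrt_sq hv0.le]
      congr 1
      field_simp
    rw [gammaE, h3, h4]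
    field_simp

/-- The gain `sin(min(r γ_E, π/2))`. -/
def gain (r E : ℝ) : ℝ := Real.sin (min (gammaE E * r) (Real.pi / 2))

/-- Expectations of `M` do not see the phase that separates `ampDisp` from `phasedDisp`. Once the
angle bound exceeds `π/2`, the trivial estimate `2‖v‖²` is used; this is the truncation in `gain`.
-/
theorem norm_inner_ampDisp_sub_le (α μ : Fin m → ℂ) {v : HTensor R (ModeSpace m)}
    (h : ∀ j, Summable fun p : basisIndex R × (Fin m → ℕ) => (p.2 j : ℝ) * ‖coeff v p‖ ^ 2)
    (M : HTensor R (ModeSpace m) →L[ℂ] HTensor R (ModeSpace m)) (hM : ∀ x, ‖M x‖ ≤ ‖x‖) :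
    ‖⟪ampDisp R α v, M (ampDisp R α v)⟫_ℂ - ⟪v, M v⟫_ℂ‖ ≤
      2 * ‖v‖ ^ 2 * gain (ampl α) (vecEnergy μ v / ‖v‖ ^ 2) := by
  by_cases hv : v = 0
  · simp [hv]
  set δ := gammaE (vecEnergy μ v / ‖v‖ ^ 2) * ampl α with hδ
  by_cases hδ' : δ ≤ Real.pi / 2
  · set c := 2 * (∑ j, α j * starRingEnd ℂ (μ j)).im with hc
    have h1 := cos_le_re_inner_phasedDisp α μ hv h (by
      rw [mul_comm, ← hδ]
      linarith [Real.pi_pos])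
    rw [mul_comm (ampl α), ← hδ, ← hc] at h1
    have h2 := norm_inner_sub_inner_le_sin M hM (phasedDisp_norm α c 1 v)
      (mul_nonneg (gammaE_nonneg _) (ampl_nonneg α)) hδ' h1
    rw [gain, ← hδ, min_eq_left hδ']
    refine le_trans (le_of_eq ?_) h2
    rw [phasedDisp_apply, map_smul, inner_smul_left, inner_smul_right, ← mul_assoc,
      Complex.conj_mul', Complex.norm_exp_ofReal_mul_I]
    simp
  · rw [gain, ← hδ, min_eq_right (not_le.mp hδ').le, Real.sin_pi_div_two, mul_one]
    have h3 : ∀ u, ‖⟪u, M u⟫_ℂ‖ ≤ ‖u‖ ^ 2 := fun u =>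
      (norm_inner_le_norm _ _).trans (by
        rw [sq]
        exact mul_le_mul_of_nonneg_left (hM u) (norm_nonneg _))
    have h4 := h3 (ampDisp R α v)
    rw [ampDisp_norm] at h4
    linarith [norm_sub_le ⟪ampDisp R α v, M (ampDisp R α v)⟫_ℂ ⟪v, M v⟫_ℂ, h3 v]

end Limit

/-! ### From vectors to density operators: decompositions, energies and Jensen's inequality -/

section Decomposition

open Filter Topology

/-! ### Decompositions of positive trace class operators -/

/-- `T = ∑ₖ |vₖ⟩⟨vₖ|` weakly, with `∑ₖ ‖vₖ‖² < ∞`. -/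
structure IsDecomposition {K κ : Type*} [NormedAddCommGroup K] [InnerProductSpace ℂ K]
    (v : κ → K) (T : K →L[ℂ] K) : Prop where
  summable : Summable fun k => ‖v k‖ ^ 2
  hasSum : ∀ x y, HasSum (fun k => ⟪x, v k⟫_ℂ * ⟪v k, y⟫_ℂ) ⟪x, T y⟫_ℂ

/-- Take `vₖ = √ρ eₖ`: Parseval for `√ρ x` and `√ρ y` gives the weak expansion, and `∑ ‖vₖ‖²` is the
trace. -/
theorem IsState.exists_decomposition {K : Type*} [NormedAddCommGroup K] [InnerProductSpace ℂ K]
    [CompleteSpace K] {ρ : K →L[ℂ] K} (hρ : IsState ρ) :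
    ∃ v : basisIndex K → K, IsDecomposition v ρ ∧ ∑' k, ‖v k‖ ^ 2 = 1 := by
  have h0 : 0 ≤ ρ := (ContinuousLinearMap.nonneg_iff_isPositive ρ).mpr hρ.1
  set S : K →L[ℂ] K := CFC.sqrt ρ with hS
  have hSS : ∀ x, S (S x) = ρ x := fun x => by
    have := CFC.sqrt_mul_sqrt_self ρ h0
    exact DFunLike.congr_fun this x
  have hSsym : ∀ x y, ⟪S x, y⟫_ℂ = ⟪x, S y⟫_ℂ := by
    intro x y
    have h1 : S.IsPositive := (ContinuousLinearMap.nonneg_iff_isPositive S).mp (CFC.sqrt_nonneg ρ)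
    exact h1.inner_left_eq_inner_right x y
  have hnorm : ∀ k, RCLike.re ⟪stdBasis K k, ρ (stdBasis K k)⟫_ℂ = ‖S (stdBasis K k)‖ ^ 2 := by
    intro k
    rw [← hSS, ← hSsym, inner_self_eq_norm_sq]
  have htr := hρ.2
  simp only [posTrace, hnorm] at htr
  have hs : Summable fun k => ‖S (stdBasis K k)‖ ^ 2 := by
    have h1 : ∑' k, ENNReal.ofReal (‖S (stdBasis K k)‖ ^ 2) ≠ ⊤ := by
      rw [htr]
      exact ENNReal.one_ne_top
    have h2 := ENNReal.summable_toReal h1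
    simpa only [ENNReal.toReal_ofReal (sq_nonneg _)] using h2
  refine ⟨fun k => S (stdBasis K k), ⟨hs, fun x y => ?_⟩, ?_⟩
  · have h1 := (stdBasis K).hasSum_inner_mul_inner (S x) (S y)
    rw [hSsym, hSS] at h1
    simpa only [hSsym] using h1
  · rw [← ENNReal.ofReal_tsum_of_nonneg (fun _ => sq_nonneg _) hs] at htr
    exact (ENNReal.ofReal_eq_one).mp htr

variable {m : ℕ} {R : Type*} [NormedAddCommGroup R] [InnerProductSpace ℂ R]

variable (m) in
/-- The orthonormal basis of the Fock states. -/
def fockBasis : HilbertBasis (Fin m → ℕ) ℂ (ModeSpace m) :=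
  HilbertBasis.mkOfOrthogonalEqBot (orthonormal_fock m) (by
    rw [Submodule.eq_bot_iff]
    intro x hx
    rw [Submodule.mem_orthogonal] at hx
    exact eq_zero_of_inner_fock_eq_zero x fun n => hx _ (Submodule.subset_span ⟨n, rfl⟩))

theorem fockBasis_apply (n : Fin m → ℕ) : fockBasis m n = toVec (fock n) := by
  rw [fockBasis, HilbertBasis.coe_mkOfOrthogonalEqBot]

theorem inner_slice (T : HTensor R (ModeSpace m) →L[ℂ] HTensor R (ModeSpace m)) (e f : R)
    (φ χ : ModeSpace m) :
    ⟪φ, slice T e f χ⟫_ℂ = ⟪ketTensor e φ, T (ketTensor f χ)⟫_ℂ := by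
  rw [slice, ContinuousLinearMap.comp_apply, ContinuousLinearMap.adjoint_inner_right]
  rfl

variable [CompleteSpace R] {κ : Type*}

theorem inner_fock_adjoint_ketTensor (v : HTensor R (ModeSpace m)) (i : basisIndex R)
    (n : Fin m → ℕ) :
    ⟪toVec (fock n), (ketTensor (stdBasis R i)).adjoint v⟫_ℂ = coeff v (i, n) := by
  rw [ContinuousLinearMap.adjoint_inner_right, coeff, tensorBasis_apply]
  rfl

theorem hasSum_norm_coeff_sq_adjoint (v : HTensor R (ModeSpace m)) (i : basisIndex R) :
    HasSum (fun n => ‖coeff v (i, n)‖ ^ 2) (‖(ketTensor (stdBasis R i)).adjoint v‖ ^ 2) := by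
  have h := (fockBasis m).hasSum_inner_mul_inner ((ketTensor (stdBasis R i)).adjoint v)
    ((ketTensor (stdBasis R i)).adjoint v)
  rw [inner_self_eq_norm_sq_to_K, ← RCLike.ofReal_pow] at h
  refine Complex.hasSum_ofReal.mp (h.congr_fun fun n => ?_)
  rw [← inner_conj_symm, fockBasis_apply, inner_fock_adjoint_ketTensor, Complex.conj_mul']
  push_cast
  rfl

theorem summable_coeff {v : κ → HTensor R (ModeSpace m)} (hv : Summable fun k => ‖v k‖ ^ 2) :
    Summable fun q : κ × (basisIndex R × (Fin m → ℕ)) => ‖coeff (v q.1) q.2‖ ^ 2 := by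
  refine (summable_prod_of_nonneg (fun _ => sq_nonneg _)).mpr
    ⟨fun k => (hasSum_norm_coeff_sq (v k)).summable, ?_⟩
  simpa only [(hasSum_norm_coeff_sq _).tsum_eq] using hv

theorem summable_norm_adjoint_sq {v : κ → HTensor R (ModeSpace m)}
    (hv : Summable fun k => ‖v k‖ ^ 2) :
    Summable fun q : κ × basisIndex R => ‖(ketTensor (stdBasis R q.2)).adjoint (v q.1)‖ ^ 2 := by
  have h1 := (Equiv.prodAssoc κ (basisIndex R) (Fin m → ℕ)).summable_iff.mpr (summable_coeff hv)
  have h2 := ((summable_prod_of_nonneg (fun _ => sq_nonneg _)).mp h1).2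
  refine h2.congr fun q => ?_
  exact (hasSum_norm_coeff_sq_adjoint (v q.1) q.2).tsum_eq

/-- The decomposition of the reduced operator induced by a decomposition of the whole. -/
theorem IsDecomposition.partialTrace {v : κ → HTensor R (ModeSpace m)}
    {ρ : HTensor R (ModeSpace m) →L[ℂ] HTensor R (ModeSpace m)} (h : IsDecomposition v ρ) :
    IsDecomposition (fun q : κ × basisIndex R => (ketTensor (stdBasis R q.2)).adjoint (v q.1))
      (partialTrace ρ) := by
  have hs := summable_norm_adjoint_sq h.summable
  have hs' := ((Equiv.prodComm (basisIndex R) κ).summable_iff.mpr hs)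
  have hs2 := (summable_prod_of_nonneg (fun _ => sq_nonneg _)).mp hs'
  have hi : ∀ i φ χ, HasSum (fun k => ⟪φ, (ketTensor (stdBasis R i)).adjoint (v k)⟫_ℂ *
      ⟪(ketTensor (stdBasis R i)).adjoint (v k), χ⟫_ℂ)
        ⟪φ, slice ρ (stdBasis R i) (stdBasis R i) χ⟫_ℂ := by
    intro i φ χ
    rw [inner_slice]
    simp only [ContinuousLinearMap.adjoint_inner_right, ContinuousLinearMap.adjoint_inner_left]
    exact h.hasSum _ _
  have hle : ∀ φ χ ψ : ModeSpace m, ‖⟪φ, ψ⟫_ℂ * ⟪ψ, χ⟫_ℂ‖ ≤ ‖ψ‖ ^ 2 * (‖φ‖ * ‖χ‖) := by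
    intro φ χ ψ
    rw [norm_mul]
    calc ‖⟪φ, ψ⟫_ℂ‖ * ‖⟪ψ, χ⟫_ℂ‖ ≤ (‖φ‖ * ‖ψ‖) * (‖ψ‖ * ‖χ‖) :=
          mul_le_mul (norm_inner_le_norm _ _) (norm_inner_le_norm _ _) (norm_nonneg _)
            (by positivity)
      _ = ‖ψ‖ ^ 2 * (‖φ‖ * ‖χ‖) := by ring
  -- The norms of the diagonal slices are summable, so the series defining the partial trace
  -- converges in operator norm and its `tsum` is not the default value `0`.
  have hnorm : ∀ i, ‖slice ρ (stdBasis R i) (stdBasis R i)‖ ≤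
      ∑' k, ‖(ketTensor (stdBasis R i)).adjoint (v k)‖ ^ 2 := by
    intro i
    have hs3 : Summable fun k => ‖(ketTensor (stdBasis R i)).adjoint (v k)‖ ^ 2 := hs2.1 i
    refine ContinuousLinearMap.opNorm_le_bound _ (tsum_nonneg fun _ => sq_nonneg _) fun χ => ?_
    refine norm_le_of_inner_le_of_dense (K := ModeSpace m) dense_univ
      (mul_nonneg (tsum_nonneg fun _ => sq_nonneg _) (norm_nonneg _)) fun φ _ => ?_
    rw [← (hi i φ χ).tsum_eq]
    refine (tsum_of_norm_bounded (hs3.mul_right (‖φ‖ * ‖χ‖)).hasSum fun k => hle _ _ _).trans ?_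
    rw [tsum_mul_right]
    exact le_of_eq (by ring)
  have hsum : Summable fun i => slice ρ (stdBasis R i) (stdBasis R i) :=
    Summable.of_norm_bounded hs2.2 hnorm
  refine ⟨hs, fun φ χ => ?_⟩
  have h1 : HasSum (fun i => ⟪φ, slice ρ (stdBasis R i) (stdBasis R i) χ⟫_ℂ)
      ⟪φ, BKTeleportation.partialTrace ρ χ⟫_ℂ := by
    have h2 := hsum.hasSum.mapL (ContinuousLinearMap.apply ℂ (ModeSpace m) χ)
    exact h2.mapL (innerSL ℂ φ)
  have h2 : Summable fun q : basisIndex R × κ =>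
      ⟪φ, (ketTensor (stdBasis R q.1)).adjoint (v q.2)⟫_ℂ *
        ⟪(ketTensor (stdBasis R q.1)).adjoint (v q.2), χ⟫_ℂ :=
    Summable.of_norm_bounded (hs'.mul_right (‖φ‖ * ‖χ‖)) fun q => hle _ _ _
  have h3 := h2.hasSum.prod_fiberwise fun i => hi i φ χ
  have h4 := h2.hasSum
  rw [h3.unique h1] at h4
  exact (Equiv.prodComm (basisIndex R) κ).hasSum_iff.mp h4

/-- The reordering of the summation indices. -/
def indexEquiv (N κ I : Type*) : N × (κ × I) ≃ κ × (I × N) :=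
  (Equiv.prodComm N (κ × I)).trans (Equiv.prodAssoc κ I N)

/-- In the eigenbasis of `N` every term is nonnegative, so the sums over Fock states, basis vectors
of `R` and components `vₖ` may be interchanged in `[0, ∞]` without any finiteness assumption. -/
theorem IsDecomposition.meanPhotonNumber_eq {v : κ → HTensor R (ModeSpace m)}
    {ρ : HTensor R (ModeSpace m) →L[ℂ] HTensor R (ModeSpace m)} (h : IsDecomposition v ρ) :
    meanPhotonNumber (BKTeleportation.partialTrace ρ) =
      ∑' q : κ × (basisIndex R × (Fin m → ℕ)),
        ENNReal.ofReal ((∑ j, (q.2.2 j : ℝ)) * ‖coeff (v q.1) q.2‖ ^ 2) := by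
  rw [← (indexEquiv (Fin m → ℕ) κ (basisIndex R)).tsum_eq, ENNReal.tsum_prod', meanPhotonNumber]
  congr 1
  funext n
  have h1 := h.partialTrace.hasSum (toVec (fock n)) (toVec (number m (fock n)))
  have h2 : HasSum (fun q : κ × basisIndex R =>
      (∑ j, (n j : ℝ)) * ‖coeff (v q.1) (q.2, n)‖ ^ 2)
      (RCLike.re ⟪toVec (fock n), BKTeleportation.partialTrace ρ (toVec (number m (fock n)))⟫_ℂ) := by
    refine (h1.mapL Complex.reCLM).congr_fun fun q => ?_
    have h3 : ⟪toVec (fock n), (ketTensor (stdBasis R q.2)).adjoint (v q.1)⟫_ℂ *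
        ⟪(ketTensor (stdBasis R q.2)).adjoint (v q.1), toVec (number m (fock n))⟫_ℂ =
        (((∑ j, (n j : ℝ)) * ‖coeff (v q.1) (q.2, n)‖ ^ 2 : ℝ) : ℂ) := by
      rw [number_fock]
      simp only [← toVecL_apply, map_smul, inner_smul_right]
      rw [← inner_conj_symm ((ketTensor (stdBasis R q.2)).adjoint (v q.1)), toVecL_apply,
        inner_fock_adjoint_ketTensor, mul_left_comm, Complex.mul_conj']
      push_cast
      rfl
    rw [h3]
    exact (Complex.ofReal_re _).symm
  rw [← h2.tsum_eq, ENNReal.ofReal_tsum_of_nonneg (fun _ => by positivity) h2.summable]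
  rfl

end Decomposition

section TotalEnergy

open Filter Topology

variable {m : ℕ} {R : Type*} [NormedAddCommGroup R] [InnerProductSpace ℂ R] [CompleteSpace R]
  {κ : Type*} {v : κ → HTensor R (ModeSpace m)}
  {ρ : HTensor R (ModeSpace m) →L[ℂ] HTensor R (ModeSpace m)}

/-! ### The energy of a decomposition -/

theorem IsDecomposition.hasSum_energy (h : IsDecomposition v ρ)
    (hfin : meanPhotonNumber (BKTeleportation.partialTrace ρ) ≠ ⊤) :
    HasSum (fun q : κ × (basisIndex R × (Fin m → ℕ)) =>
      (∑ j, (q.2.2 j : ℝ)) * ‖coeff (v q.1) q.2‖ ^ 2)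
      (meanPhotonNumber (BKTeleportation.partialTrace ρ)).toReal := by
  have h0 := h.meanPhotonNumber_eq
  have hn : ∀ q : κ × (basisIndex R × (Fin m → ℕ)),
      0 ≤ (∑ j, (q.2.2 j : ℝ)) * ‖coeff (v q.1) q.2‖ ^ 2 := fun q => by positivity
  rw [h0] at hfin ⊢
  have hs := ENNReal.summable_toReal hfin
  simp only [ENNReal.toReal_ofReal (hn _)] at hs
  rw [← ENNReal.ofReal_tsum_of_nonneg hn hs, ENNReal.toReal_ofReal (tsum_nonneg hn)]
  exact hs.hasSum

theorem IsDecomposition.summable_mode_energy (h : IsDecomposition v ρ)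
    (hfin : meanPhotonNumber (BKTeleportation.partialTrace ρ) ≠ ⊤) (k : κ) (j : Fin m) :
    Summable fun p : basisIndex R × (Fin m → ℕ) => (p.2 j : ℝ) * ‖coeff (v k) p‖ ^ 2 := by
  have h1 := (h.hasSum_energy hfin).summable
  have h2 := ((summable_prod_of_nonneg (fun q => by
    simp only [Pi.zero_apply]
    positivity)).mp h1).1 k
  refine Summable.of_nonneg_of_le (fun p => by positivity) (fun p => ?_) h2
  refine mul_le_mul_of_nonneg_right ?_ (sq_nonneg _)
  exact Finset.single_le_sum (f := fun j => ((p.2 j : ℕ) : ℝ)) (fun i _ => by positivity)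
    (Finset.mem_univ j)

theorem IsDecomposition.hasSum_norm_lowered_sq (h : IsDecomposition v ρ)
    (hfin : meanPhotonNumber (BKTeleportation.partialTrace ρ) ≠ ⊤) :
    HasSum (fun k => ∑ j, ‖lowered j (v k)‖ ^ 2)
      (meanPhotonNumber (BKTeleportation.partialTrace ρ)).toReal := by
  refine (h.hasSum_energy hfin).prod_fiberwise fun k => ?_
  have h1 := hasSum_sum (s := Finset.univ) fun j _ =>
    BKTeleportation.hasSum_norm_lowered_sq (h.summable_mode_energy hfin k j)
  simpa only [Finset.sum_mul] using h1

/-- Rotating each coefficient by a phase turns the sum of moduli into a single inner product with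
`w`. Orthogonality makes the norm of the rotated sum at most that of `lowered j w`. -/
theorem sum_norm_coeff_mul_le {j : Fin m} {w : HTensor R (ModeSpace m)}
    (hw : Summable fun p : basisIndex R × (Fin m → ℕ) => (p.2 j : ℝ) * ‖coeff w p‖ ^ 2)
    (s : Finset (basisIndex R × (Fin m → ℕ))) :
    ∑ p ∈ s, ‖coeff w p * ⟪w, loweredBasis R j p⟫_ℂ‖ ≤ ‖w‖ * ‖lowered j w‖ := by
  have hph : ∀ z : ℂ, ∃ θ : ℂ, ‖θ‖ ≤ 1 ∧ θ * z = (‖z‖ : ℂ) := by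
    intro z
    by_cases hz : z = 0
    · exact ⟨0, by simp, by simp [hz]⟩
    · have hz' : (‖z‖ : ℂ) ≠ 0 := by simpa using hz
      refine ⟨starRingEnd ℂ z / ‖z‖, ?_, ?_⟩
      · rw [norm_div, RCLike.norm_conj, Complex.norm_real, norm_norm, div_self (by simpa using hz)]
      · rw [div_mul_eq_mul_div, Complex.conj_mul', sq, mul_div_assoc, div_self hz', mul_one]
  choose θ hθ1 hθ2 using hph
  set c : basisIndex R × (Fin m → ℕ) → ℂ := fun p =>
    θ (coeff w p * ⟪w, loweredBasis R j p⟫_ℂ) * coeff w p with hc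
  have h1 : ((∑ p ∈ s, ‖coeff w p * ⟪w, loweredBasis R j p⟫_ℂ‖ : ℝ) : ℂ) =
      ⟪w, ∑ p ∈ s, c p • loweredBasis R j p⟫_ℂ := by
    rw [inner_sum, Complex.ofReal_sum]
    refine Finset.sum_congr rfl fun p _ => ?_
    rw [inner_smul_right, hc, mul_assoc, hθ2]
  have h2 : ‖∑ p ∈ s, c p • loweredBasis R j p‖ ≤ ‖lowered j w‖ := by
    refine le_of_sq_le_sq ?_ (norm_nonneg _)
    rw [norm_sum_sq_of_orthogonal (pairwise_inner_loweredBasis j c)]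
    refine le_trans (Finset.sum_le_sum fun p _ => ?_)
      (sum_le_hasSum s (fun p _ => by positivity) (BKTeleportation.hasSum_norm_lowered_sq hw))
    rw [norm_smul_loweredBasis_sq, hc, norm_mul, mul_pow]
    refine mul_le_mul_of_nonneg_left ?_ (by positivity)
    refine mul_le_of_le_one_left (sq_nonneg _) ?_
    exact pow_le_one₀ (norm_nonneg _) (hθ1 _)
  have h3 : ∑ p ∈ s, ‖coeff w p * ⟪w, loweredBasis R j p⟫_ℂ‖ =
      ‖⟪w, ∑ p ∈ s, c p • loweredBasis R j p⟫_ℂ‖ := by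
    rw [← h1, Complex.norm_real, Real.norm_of_nonneg (Finset.sum_nonneg fun _ _ => norm_nonneg _)]
  rw [h3]
  exact (norm_inner_le_norm _ _).trans (mul_le_mul_of_nonneg_left h2 (norm_nonneg _))

/-- The mean amplitude sums over Fock states first, the decomposition over `k` first. The two orders
agree by absolute convergence, obtained from `‖v‖ ‖aⱼ v‖ ≤ ‖v‖² + ∑ᵢ ‖aᵢ v‖²`. -/
theorem IsDecomposition.hasSum_meanAmplitude (h : IsDecomposition v ρ)
    (hfin : meanPhotonNumber (BKTeleportation.partialTrace ρ) ≠ ⊤) (j : Fin m) :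
    HasSum (fun k => ⟪v k, lowered j (v k)⟫_ℂ)
      (meanAmplitude (BKTeleportation.partialTrace ρ) j) := by
  set G : κ × (basisIndex R × (Fin m → ℕ)) → ℂ := fun q =>
    coeff (v q.1) q.2 * ⟪v q.1, loweredBasis R j q.2⟫_ℂ with hG
  have hs : ∀ k s, ∑ p ∈ s, ‖G (k, p)‖ ≤ ‖v k‖ * ‖lowered j (v k)‖ := fun k s => by
    exact sum_norm_coeff_mul_le (h.summable_mode_energy hfin k j) s
  have hk : ∀ k, Summable fun p => ‖G (k, p)‖ := fun k =>
    summable_of_sum_le (fun p => norm_nonneg (G (k, p))) (hs k)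
  have hb : ∀ k, ∑' p, ‖G (k, p)‖ ≤ ‖v k‖ ^ 2 + ∑ i, ‖lowered i (v k)‖ ^ 2 := by
    intro k
    have h0 : ∑' p, ‖G (k, p)‖ ≤ ‖v k‖ * ‖lowered j (v k)‖ :=
      Summable.tsum_le_of_sum_le (hk k) (hs k)
    have h1 : ‖lowered j (v k)‖ ^ 2 ≤ ∑ i, ‖lowered i (v k)‖ ^ 2 :=
      Finset.single_le_sum (f := fun i => ‖lowered i (v k)‖ ^ 2) (fun i _ => sq_nonneg _)
        (Finset.mem_univ j)
    nlinarith [sq_nonneg (‖v k‖ - ‖lowered j (v k)‖), sq_nonneg ‖v k‖,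
      sq_nonneg ‖lowered j (v k)‖]
  have hS : Summable fun k => ∑' p, ‖G (k, p)‖ :=
    Summable.of_nonneg_of_le (fun k => tsum_nonneg fun _ => norm_nonneg _) hb
      (h.summable.add (h.hasSum_norm_lowered_sq hfin).summable)
  have hsum : Summable G :=
    Summable.of_norm ((summable_prod_of_nonneg (f := fun q => ‖G q‖)
      fun _ => norm_nonneg _).mpr ⟨hk, hS⟩)
  have h1 : HasSum (fun k => ⟪v k, lowered j (v k)⟫_ℂ) (∑' q, G q) := by
    refine hsum.hasSum.prod_fiberwise fun k => ?_
    have h2 := (hasSum_lowered (h.summable_mode_energy hfin k j)).mapL (innerSL ℂ (v k))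
    simpa only [innerSL_apply_apply, inner_smul_right] using h2
  have h2 := (indexEquiv (Fin m → ℕ) κ (basisIndex R)).hasSum_iff.mpr hsum.hasSum
  have h3 := h2.prod_fiberwise (g := fun n =>
      ⟪toVec (fock n), BKTeleportation.partialTrace ρ (toVec (annihilation j (fock n)))⟫_ℂ)
    fun n => by
      refine (h.partialTrace.hasSum (toVec (fock n)) (toVec (annihilation j (fock n)))).congr_fun
        fun q => ?_
      rw [inner_fock_adjoint_ketTensor, ContinuousLinearMap.adjoint_inner_left]
      rfl
  rw [meanAmplitude, h3.tsum_eq]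
  exact h1

/-- The variance identity: after expanding the squares, the cross terms sum to `-2|μⱼ|²` and the
constant terms, having total weight one, to `|μⱼ|²`. A single `μ` serves all components. -/
theorem IsDecomposition.hasSum_vecEnergy (h : IsDecomposition v ρ) (h1 : ∑' k, ‖v k‖ ^ 2 = 1)
    (hfin : meanPhotonNumber (BKTeleportation.partialTrace ρ) ≠ ⊤) :
    HasSum (fun k => vecEnergy (meanAmplitude (BKTeleportation.partialTrace ρ)) (v k))
      ((meanPhotonNumber (BKTeleportation.partialTrace ρ)).toReal -
        ∑ j, ‖meanAmplitude (BKTeleportation.partialTrace ρ) j‖ ^ 2) := by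
  set μ := meanAmplitude (BKTeleportation.partialTrace ρ) with hμ
  have h2 : ∀ k, vecEnergy μ (v k) = ∑ j, ‖lowered j (v k)‖ ^ 2 +
      ∑ j, (-2 * (starRingEnd ℂ (μ j) * ⟪v k, lowered j (v k)⟫_ℂ).re + ‖μ j‖ ^ 2 * ‖v k‖ ^ 2) := by
    intro k
    rw [vecEnergy, ← Finset.sum_add_distrib]
    refine Finset.sum_congr rfl fun j _ => ?_
    rw [norm_sub_sq (𝕜 := ℂ), norm_smul, mul_pow, inner_re_symm, inner_smul_left]
    have : RCLike.re (starRingEnd ℂ (μ j) * ⟪v k, lowered j (v k)⟫_ℂ) =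
      (starRingEnd ℂ (μ j) * ⟪v k, lowered j (v k)⟫_ℂ).re := rfl
    rw [this]
    ring
  have h3 : ∀ j ∈ Finset.univ, HasSum (fun k =>
      -2 * (starRingEnd ℂ (μ j) * ⟪v k, lowered j (v k)⟫_ℂ).re + ‖μ j‖ ^ 2 * ‖v k‖ ^ 2)
      (-‖μ j‖ ^ 2) := by
    intro j _
    have h4 := (((h.hasSum_meanAmplitude hfin j).mul_left (starRingEnd ℂ (μ j))).mapL
      Complex.reCLM).mul_left (-2)
    have h5 := (h.summable.hasSum).mul_left (‖μ j‖ ^ 2)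
    rw [h1] at h5
    have h6 := h4.add h5
    rw [← hμ, Complex.conj_mul'] at h6
    have h7 : Complex.reCLM ((‖μ j‖ : ℂ) ^ 2) = ‖μ j‖ ^ 2 := by
      rw [← Complex.ofReal_pow]
      exact Complex.ofReal_re _
    rw [h7, show -2 * ‖μ j‖ ^ 2 + ‖μ j‖ ^ 2 * 1 = -‖μ j‖ ^ 2 by ring] at h6
    exact h6
  simp only [h2]
  have h8 := (h.hasSum_norm_lowered_sq hfin).add (hasSum_sum h3)
  rw [Finset.sum_neg_distrib, ← sub_eq_add_neg] at h8
  exact h8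

/-! ### Concavity of the gain -/

theorem concaveOn_gammaE : ConcaveOn ℝ (Set.Ici 0) gammaE := by
  have h1 : ConcaveOn ℝ (Set.Ici 0) Real.sqrt := Real.strictConcaveOn_sqrt.concaveOn
  refine h1.add ?_
  have h2 := h1.translate_left (c := 1)
  refine h2.subset (fun x hx => ?_) (convex_Ici 0)
  simp only [Set.mem_preimage, Set.mem_Ici] at hx ⊢
  linarith

theorem gammaE_mono {x y : ℝ} (h : x ≤ y) : gammaE x ≤ gammaE y :=
  add_le_add (Real.sqrt_le_sqrt h) (Real.sqrt_le_sqrt (by linarith))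

theorem gain_arg_mem {r : ℝ} (hr : 0 ≤ r) (E : ℝ) :
    min (gammaE E * r) (Real.pi / 2) ∈ Set.Icc 0 (Real.pi / 2) :=
  ⟨le_min (mul_nonneg (gammaE_nonneg E) hr) (by positivity), min_le_right _ _⟩

theorem sin_le_sin_of_mem {x y : ℝ} (hx : x ∈ Set.Icc 0 (Real.pi / 2))
    (hy : y ∈ Set.Icc 0 (Real.pi / 2)) (h : x ≤ y) : Real.sin x ≤ Real.sin y :=
  Real.sin_le_sin_of_le_of_le_pi_div_two (by linarith [hx.1, Real.pi_pos]) hy.2 h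

theorem gain_nonneg {r : ℝ} (hr : 0 ≤ r) (E : ℝ) : 0 ≤ gain r E := by
  have h := gain_arg_mem hr E
  exact Real.sin_nonneg_of_nonneg_of_le_pi h.1 (by linarith [h.2, Real.pi_pos])

theorem gain_mono {r : ℝ} (hr : 0 ≤ r) {x y : ℝ} (h : x ≤ y) : gain r x ≤ gain r y :=
  sin_le_sin_of_mem (gain_arg_mem hr x) (gain_arg_mem hr y)
    (min_le_min_right _ (mul_le_mul_of_nonneg_right (gammaE_mono h) hr))

/-- The minimum of a concave function and a constant is concave, and on `[0, π/2]` the sine is both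
concave and increasing, so the composition is concave. -/
theorem concaveOn_gain {r : ℝ} (hr : 0 ≤ r) : ConcaveOn ℝ (Set.Ici 0) (gain r) := by
  have h1 : ConcaveOn ℝ (Set.Ici 0) fun E => min (gammaE E * r) (Real.pi / 2) := by
    have h2 := (concaveOn_gammaE.smul hr).inf (concaveOn_const (Real.pi / 2) (convex_Ici 0))
    refine h2.congr fun x _ => ?_
    simp [mul_comm]
  refine ⟨convex_Ici 0, fun x hx y hy a b ha hb hab => ?_⟩
  have h3 := strictConcaveOn_sin_Icc.concaveOn.2
    (Set.Icc_subset_Icc_right (by linarith [Real.pi_pos]) (gain_arg_mem hr x))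
    (Set.Icc_subset_Icc_right (by linarith [Real.pi_pos]) (gain_arg_mem hr y)) ha hb hab
  refine h3.trans (sin_le_sin_of_mem ?_ (gain_arg_mem hr _) (h1.2 hx hy ha hb hab))
  exact convex_Icc _ _ (gain_arg_mem hr x) (gain_arg_mem hr y) ha hb hab

/-- Jensen's inequality for weights of total at most one. An additional point of energy `0` carries
the missing weight; its contribution is nonnegative and is dropped. -/
theorem sum_mul_gain_le {r : ℝ} (hr : 0 ≤ r) {κ : Type*} (s : Finset κ) (a e : κ → ℝ)
    (ha : ∀ k, 0 ≤ a k) (he : ∀ k, 0 ≤ e k) (h0 : ∀ k, a k = 0 → e k = 0)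
    (ha1 : ∑ k ∈ s, a k ≤ 1) :
    ∑ k ∈ s, a k * gain r (e k / a k) ≤ gain r (∑ k ∈ s, e k) := by
  have h1 := (concaveOn_gain hr).le_map_sum (t := Finset.insertNone s)
    (w := fun o => o.elim (1 - ∑ k ∈ s, a k) a) (p := fun o => o.elim 0 fun k => e k / a k)
    ?_ ?_ ?_
  · simp only [Finset.sum_insertNone, Option.elim_none, Option.elim_some, smul_eq_mul,
      mul_zero, zero_add] at h1
    have h2 : ∑ k ∈ s, a k * (e k / a k) = ∑ k ∈ s, e k := by
      refine Finset.sum_congr rfl fun k _ => ?_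
      by_cases hk : a k = 0
      · rw [h0 k hk, hk, zero_mul]
      · field_simp
    rw [h2] at h1
    have h3 := mul_nonneg (sub_nonneg.mpr ha1) (gain_nonneg hr 0)
    linarith
  · intro o _
    cases o with
    | none => exact sub_nonneg.mpr ha1
    | some k => exact ha k
  · simp
  · intro o _
    cases o with
    | none => exact le_refl (0 : ℝ)
    | some k => exact div_nonneg (he k) (ha k)

theorem IsDecomposition.norm_tsum_sub_le (h : IsDecomposition v ρ) (h1 : ∑' k, ‖v k‖ ^ 2 = 1)
    {E : ℝ} (hE : 0 ≤ E) (henergy : meanPhotonNumber (BKTeleportation.partialTrace ρ) ≤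
      ENNReal.ofReal (E + ∑ j, ‖meanAmplitude (BKTeleportation.partialTrace ρ) j‖ ^ 2))
    (α : Fin m → ℂ) (M : HTensor R (ModeSpace m) →L[ℂ] HTensor R (ModeSpace m))
    (hM : ∀ x, ‖M x‖ ≤ ‖x‖) (s : Finset κ) :
    ∑ k ∈ s, ‖⟪ampDisp R α (v k), M (ampDisp R α (v k))⟫_ℂ - ⟪v k, M (v k)⟫_ℂ‖ ≤
      2 * gain (ampl α) E := by
  have hfin : meanPhotonNumber (BKTeleportation.partialTrace ρ) ≠ ⊤ :=
    ne_top_of_le_ne_top ENNReal.ofReal_ne_top henergy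
  set μ := meanAmplitude (BKTeleportation.partialTrace ρ) with hμ
  have h2 : ∀ k ∈ s, ‖⟪ampDisp R α (v k), M (ampDisp R α (v k))⟫_ℂ - ⟪v k, M (v k)⟫_ℂ‖ ≤
      2 * (‖v k‖ ^ 2 * gain (ampl α) (vecEnergy μ (v k) / ‖v k‖ ^ 2)) := fun k _ => by
    rw [← mul_assoc]
    exact norm_inner_ampDisp_sub_le α μ (h.summable_mode_energy hfin k) M hM
  refine (Finset.sum_le_sum h2).trans ?_
  rw [← Finset.mul_sum]
  refine mul_le_mul_of_nonneg_left ?_ zero_le_two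
  refine (sum_mul_gain_le (ampl_nonneg α) s (fun k => ‖v k‖ ^ 2) (fun k => vecEnergy μ (v k))
    (fun k => sq_nonneg _) (fun k => vecEnergy_nonneg μ _) (fun k hk => ?_) ?_).trans
    (gain_mono (ampl_nonneg α) ?_)
  -- A component of weight zero must also have zero energy, since the quotient `e / a` then takes
  -- the default value `0`.
  · have hk0 : v k = 0 := by simpa using hk
    have hc : ∀ p, coeff (0 : HTensor R (ModeSpace m)) p = 0 := fun p => inner_zero_right _
    simp [hk0, vecEnergy, lowered, hc]
  · rw [← h1]
    exact h.summable.sum_le_tsum s fun k _ => sq_nonneg _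
  · refine (sum_le_hasSum s (fun k _ => vecEnergy_nonneg μ _)
      (h.hasSum_vecEnergy h1 hfin)).trans ?_
    rw [sub_le_iff_le_add]
    exact ENNReal.toReal_le_of_le_ofReal
      (add_nonneg hE (Finset.sum_nonneg fun _ _ => sq_nonneg _)) henergy

end TotalEnergy

/-! ### Trace-norm duality and norm continuity of displaced states -/

section TraceNorm

open Filter Topology

/-! ### A variational bound for the trace norm -/

variable {K : Type*} [NormedAddCommGroup K] [InnerProductSpace ℂ K] [CompleteSpace K]

theorem posTrace_le_of_sum_le {P : K →L[ℂ] K} (hP : P.IsPositive) {B : ℝ}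
    (h : ∀ F : Finset (basisIndex K), ∑ i ∈ F, RCLike.re ⟪stdBasis K i, P (stdBasis K i)⟫_ℂ ≤ B) :
    posTrace P ≤ ENNReal.ofReal B := by
  rw [posTrace, ENNReal.tsum_eq_iSup_sum]
  refine iSup_le fun F => ?_
  rw [← ENNReal.ofReal_sum_of_nonneg fun i _ => hP.re_inner_nonneg_right _]
  exact ENNReal.ofReal_le_ofReal (h F)

/-- `W = X / (|X| + ε)` is a continuous substitute for the sign of `X`; the error `|x| - x²/(|x| +
ε)` is at most `ε`. -/
theorem exists_abs_le {X : K →L[ℂ] K} (hX : IsSelfAdjoint X) {ε : ℝ} (hε : 0 < ε) :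
    ∃ W : K →L[ℂ] K, IsSelfAdjoint W ∧ ‖W‖ ≤ 1 ∧
      ∀ x, RCLike.re ⟪x, CFC.abs X x⟫_ℂ ≤ RCLike.re ⟪W x, X x⟫_ℂ + ε * ‖x‖ ^ 2 := by
  set f : ℝ → ℝ := fun x => x / (|x| + ε) with hf
  have hpos : ∀ x : ℝ, 0 < |x| + ε := fun x => by positivity
  have hc : Continuous f := continuous_id.div (by fun_prop) fun x => (hpos x).ne'
  have hWs : IsSelfAdjoint (cfc f X) := cfc_predicate f X
  refine ⟨cfc f X, hWs, ?_, fun x => ?_⟩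
  · refine norm_cfc_le zero_le_one fun x _ => ?_
    rw [hf, Real.norm_eq_abs, abs_div, abs_of_pos (hpos x), div_le_one (hpos x)]
    linarith
  · have h1 : CFC.abs X ≤ cfc (fun x => f x * x + ε) X := by
      rw [CFC.abs_eq_cfc_norm X hX]
      refine cfc_mono (fun x _ => ?_) (by fun_prop) (by fun_prop)
      rw [hf, Real.norm_eq_abs, div_mul_eq_mul_div, ← abs_mul_abs_self x, ← sub_le_iff_le_add,
        le_div_iff₀ (hpos x)]
      nlinarith [sq_nonneg ε]
    have h2 : cfc (fun x => f x * x + ε) X = cfc f X * X + algebraMap ℝ _ ε := by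
      rw [cfc_add_const ε (fun x => f x * x) X (by fun_prop), cfc_mul f (fun x => x) X
        (by fun_prop) (by fun_prop), cfc_id' ℝ X]
    rw [h2] at h1
    have h3 := (ContinuousLinearMap.le_def _ _).mp h1
    have h4 := h3.re_inner_nonneg_right x
    have h5 : (algebraMap ℝ (K →L[ℂ] K) ε) x = (ε : ℂ) • x := by
      rw [Algebra.algebraMap_eq_smul_one]
      rfl
    have h6 : ⟪x, cfc f X (X x)⟫_ℂ = ⟪cfc f X x, X x⟫_ℂ := by
      rw [← ContinuousLinearMap.adjoint_inner_left, hWs.adjoint_eq]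
    rw [sub_apply, add_apply, mul_apply_eq_comp,
      h5, inner_sub_right, inner_add_right, inner_smul_right, inner_self_eq_norm_sq_to_K, h6] at h4
    have h7 : RCLike.re ((ε : ℂ) * ((‖x‖ : ℂ)) ^ 2) = ε * ‖x‖ ^ 2 := by
      rw [← Complex.ofReal_pow, ← Complex.ofReal_mul]
      exact Complex.ofReal_re _
    simp only [map_sub, map_add] at h4
    have h8 : RCLike.re ((ε : ℂ) * ((RCLike.ofReal ‖x‖ : ℂ)) ^ 2) = ε * ‖x‖ ^ 2 := h7
    rw [h8] at h4
    linarith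

theorem traceNorm_le_of_sum_le {X : K →L[ℂ] K} (hX : IsSelfAdjoint X) {B : ℝ}
    (h : ∀ W : K →L[ℂ] K, IsSelfAdjoint W → ‖W‖ ≤ 1 → ∀ F : Finset (basisIndex K),
      ∑ i ∈ F, RCLike.re ⟪W (stdBasis K i), X (stdBasis K i)⟫_ℂ ≤ B) :
    traceNorm X ≤ ENNReal.ofReal B := by
  refine posTrace_le_of_sum_le
    ((ContinuousLinearMap.nonneg_iff_isPositive _).mp (CFC.abs_nonneg X)) fun F => ?_
  refine le_of_forall_pos_le_add fun δ hδ => ?_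
  -- Each of the `F.card` unit basis vectors costs `ε`, so the total error stays below `δ`; the `+
  -- 1` covers an empty `F`.
  obtain ⟨W, hW, hW1, hW2⟩ := exists_abs_le hX (ε := δ / (F.card + 1)) (by positivity)
  refine (Finset.sum_le_sum fun i _ => hW2 (stdBasis K i)).trans ?_
  rw [Finset.sum_add_distrib]
  refine add_le_add (h W hW hW1 F) ?_
  simp only [(stdBasis K).orthonormal.1, one_pow, mul_one, Finset.sum_const, nsmul_eq_mul]
  rw [mul_div_assoc', div_le_iff₀ (by positivity)]
  nlinarith

/-- The operator `∑_{i ∈ F} |eᵢ⟩⟨W eᵢ|`. -/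
def cutoff (W : K →L[ℂ] K) (F : Finset (basisIndex K)) : K →L[ℂ] K :=
  ∑ i ∈ F, (innerSL ℂ (W (stdBasis K i))).smulRight (stdBasis K i)

theorem cutoff_apply (W : K →L[ℂ] K) (F : Finset (basisIndex K)) (x : K) :
    cutoff W F x = ∑ i ∈ F, ⟪W (stdBasis K i), x⟫_ℂ • stdBasis K i := by
  simp [cutoff]

/-- For self-adjoint `W` the cutoff is `W` followed by the orthogonal projection onto the span of
the `eᵢ`, `i ∈ F`; Bessel's inequality applies. -/
theorem norm_cutoff_le {W : K →L[ℂ] K} (hW : IsSelfAdjoint W) (hW1 : ‖W‖ ≤ 1)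
    (F : Finset (basisIndex K)) (x : K) : ‖cutoff W F x‖ ≤ ‖x‖ := by
  have h1 : ‖cutoff W F x‖ ≤ ‖W x‖ := by
    refine le_of_sq_le_sq ?_ (norm_nonneg _)
    rw [cutoff_apply, norm_sum_sq_of_orthogonal]
    · refine le_trans (Finset.sum_le_sum fun i _ => ?_)
        ((stdBasis K).orthonormal.sum_inner_products_le (s := F) (x := W x))
      rw [norm_smul, (stdBasis K).orthonormal.1, mul_one, ← hW.adjoint_eq,
        ContinuousLinearMap.adjoint_inner_left, hW.adjoint_eq]
    · intro i j hij
      simp only [inner_smul_left, inner_smul_right, (stdBasis K).orthonormal.2 hij,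
        mul_zero]
  refine h1.trans ((W.le_opNorm x).trans ?_)
  exact mul_le_of_le_one_left (norm_nonneg _) hW1

/-- This converts a partial trace of `W T` over basis vectors into expectations of one contraction
in the vectors `vₖ`, to which the speed limit applies. -/
theorem IsDecomposition.hasSum_cutoff {κ : Type*} {v : κ → K} {T : K →L[ℂ] K}
    (h : IsDecomposition v T) (W : K →L[ℂ] K) (F : Finset (basisIndex K)) :
    HasSum (fun k => ⟪v k, cutoff W F (v k)⟫_ℂ)
      (∑ i ∈ F, ⟪W (stdBasis K i), T (stdBasis K i)⟫_ℂ) := by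
  simp only [cutoff_apply, inner_sum, inner_smul_right]
  exact hasSum_sum fun i _ => h.hasSum _ _

end TraceNorm

section ChannelContinuity

open Filter Topology

/-! ### Norm continuity of displaced states -/

variable {m : ℕ} {R : Type*} [NormedAddCommGroup R] [InnerProductSpace ℂ R]
  {κ : Type*} {v : κ → HTensor R (ModeSpace m)}
  {ρ : HTensor R (ModeSpace m) →L[ℂ] HTensor R (ModeSpace m)}

theorem IsDecomposition.ampChannel (h : IsDecomposition v ρ) (α : Fin m → ℂ) :
    IsDecomposition (fun k => ampDisp R α (v k)) (ampChannel α ρ) where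
  summable := by simpa only [ampDisp_norm] using h.summable
  hasSum x y := by
    have h1 := h.hasSum ((ampDisp R α).adjoint x) ((ampDisp R α).adjoint y)
    simp only [ContinuousLinearMap.adjoint_inner_left, ContinuousLinearMap.adjoint_inner_right]
      at h1
    exact h1

/-- Termwise, `|v⟩⟨v| - |w⟩⟨w| = |v - w⟩⟨v| + |w⟩⟨v - w|`. -/
theorem IsDecomposition.norm_sub_le {K : Type*} [NormedAddCommGroup K] [InnerProductSpace ℂ K]
    {v w : κ → K} {S T : K →L[ℂ] K} (hS : IsDecomposition v S)
    (hT : IsDecomposition w T)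
    (hs : Summable fun k => (‖v k‖ + ‖w k‖) * ‖v k - w k‖) :
    ‖S - T‖ ≤ ∑' k, (‖v k‖ + ‖w k‖) * ‖v k - w k‖ := by
  have h0 : 0 ≤ ∑' k, (‖v k‖ + ‖w k‖) * ‖v k - w k‖ := tsum_nonneg fun k => by positivity
  refine ContinuousLinearMap.opNorm_le_bound _ h0 fun y => ?_
  refine norm_le_of_inner_le_of_dense dense_univ (by positivity) fun x _ => ?_
  have h1 := (hS.hasSum x y).sub (hT.hasSum x y)
  rw [← inner_sub_right] at h1
  have h2 : ∀ k, ‖⟪x, v k⟫_ℂ * ⟪v k, y⟫_ℂ - ⟪x, w k⟫_ℂ * ⟪w k, y⟫_ℂ‖ ≤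
      ((‖v k‖ + ‖w k‖) * ‖v k - w k‖) * (‖x‖ * ‖y‖) := by
    intro k
    have h3 : ⟪x, v k⟫_ℂ * ⟪v k, y⟫_ℂ - ⟪x, w k⟫_ℂ * ⟪w k, y⟫_ℂ =
        ⟪x, v k - w k⟫_ℂ * ⟪v k, y⟫_ℂ + ⟪x, w k⟫_ℂ * ⟪v k - w k, y⟫_ℂ := by
      rw [inner_sub_right, inner_sub_left]
      ring
    rw [h3]
    refine (norm_add_le _ _).trans ?_
    rw [norm_mul, norm_mul]
    have e1 := norm_inner_le_norm (𝕜 := ℂ) x (v k - w k)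
    have e2 := norm_inner_le_norm (𝕜 := ℂ) (v k) y
    have e3 := norm_inner_le_norm (𝕜 := ℂ) x (w k)
    have e4 := norm_inner_le_norm (𝕜 := ℂ) (v k - w k) y
    have e5 := mul_le_mul e1 e2 (norm_nonneg _) (by positivity)
    have e6 := mul_le_mul e3 e4 (norm_nonneg _) (by positivity)
    refine (add_le_add e5 e6).trans (le_of_eq (by ring))
  have h4 := (hs.mul_right (‖x‖ * ‖y‖)).hasSum
  rw [tsum_mul_right] at h4
  have h5 : ‖⟪x, S y - T y⟫_ℂ‖ ≤ _ := h1.tsum_eq ▸ tsum_of_norm_bounded h4 h2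
  refine h5.trans (le_of_eq (by ring))

/-- Each term of the series tends to zero by strong continuity of displacements and is dominated by
`4‖vₖ‖²`. Norm continuity is what makes the operator-valued Bochner integrals meaningful. -/
theorem IsDecomposition.continuous_ampChannel [CompleteSpace R] (h : IsDecomposition v ρ) :
    Continuous fun α : Fin m → ℂ => BKTeleportation.ampChannel α ρ := by
  refine continuous_iff_continuousAt.mpr fun β => ?_
  refine (tendsto_iff_norm_sub_tendsto_zero
    (E := HTensor R (ModeSpace m) →L[ℂ] HTensor R (ModeSpace m))).mpr ?_
  set b : (Fin m → ℂ) → κ → ℝ := fun α k =>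
    (‖ampDisp R α (v k)‖ + ‖ampDisp R β (v k)‖) * ‖ampDisp R α (v k) - ampDisp R β (v k)‖ with hb
  have h0 : ∀ α k, 0 ≤ b α k := fun α k => by positivity
  have h1 : ∀ α k, b α k ≤ 4 * ‖v k‖ ^ 2 := by
    intro α k
    have e1 := _root_.norm_sub_le (ampDisp R α (v k)) (ampDisp R β (v k))
    rw [ampDisp_norm, ampDisp_norm] at e1
    rw [hb]
    simp only [ampDisp_norm]
    nlinarith [norm_nonneg (v k)]
  have h2 : Summable fun k => 4 * ‖v k‖ ^ 2 := h.summable.mul_left 4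
  have h3 : Tendsto (fun α => ∑' k, b α k) (𝓝 β) (𝓝 (∑' _ : κ, (0 : ℝ))) := by
    refine tendsto_tsum_of_dominated_convergence h2 (fun k => ?_)
      (Eventually.of_forall fun α k => ?_)
    · have h4 : Continuous fun α : Fin m → ℂ => b α k := by
        have := continuous_ampDisp (v k)
        fun_prop
      have h5 := h4.tendsto β
      simp only [hb, sub_self, norm_zero, mul_zero] at h5
      exact h5
    · rw [Real.norm_of_nonneg (h0 α k)]
      exact h1 α k
  rw [tsum_zero] at h3
  refine squeeze_zero
    (fun α => norm_nonneg (BKTeleportation.ampChannel α ρ - BKTeleportation.ampChannel β ρ))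
    (fun α => ?_) h3
  exact (h.ampChannel α).norm_sub_le (h.ampChannel β)
    (Summable.of_nonneg_of_le (h0 α) (h1 α) h2)

theorem norm_ampChannel_le (α : Fin m → ℂ)
    (T : HTensor R (ModeSpace m) →L[ℂ] HTensor R (ModeSpace m)) :
    ‖BKTeleportation.ampChannel α T‖ ≤ ‖T‖ := by
  refine ContinuousLinearMap.opNorm_le_bound _ (norm_nonneg T) fun x => ?_
  rw [BKTeleportation.ampChannel, adjoint_ampDisp]
  simp only [ContinuousLinearMap.comp_apply, ampDisp_norm]
  refine (T.le_opNorm _).trans (le_of_eq ?_)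
  rw [ampDisp_norm]

theorem isSelfAdjoint_ampChannel (α : Fin m → ℂ)
    {T : HTensor R (ModeSpace m) →L[ℂ] HTensor R (ModeSpace m)} (hT : IsSelfAdjoint T) :
    IsSelfAdjoint (BKTeleportation.ampChannel α T) :=
  hT.conj_adjoint _

end ChannelContinuity

/-! ### Gaussian noise as a random displacement and the radial law of its amplitude -/

section Noise

open Filter Topology

/-! ### The Gaussian noise channel as a mixture of displacements -/

/-- The density of the circular Gaussian distribution with parameter `lam`. -/
def noiseDensity (lam : ℝ) (a : ℂ) : ℝ := (Real.pi * lam)⁻¹ * Real.exp (-‖a‖ ^ 2 / lam)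

theorem noiseDensity_nonneg {lam : ℝ} (hlam : 0 < lam) (a : ℂ) : 0 ≤ noiseDensity lam a := by
  have := Real.pi_pos
  unfold noiseDensity
  positivity

theorem continuous_noiseDensity (lam : ℝ) : Continuous (noiseDensity lam) := by
  unfold noiseDensity
  fun_prop

/-- The circular Gaussian distribution with parameter `lam`. -/
def noiseMeasure (lam : ℝ) : Measure ℂ :=
  volume.withDensity fun a => ENNReal.ofReal (noiseDensity lam a)

theorem integral_noiseMeasure {lam : ℝ} (hlam : 0 < lam) {Z : Type*} [NormedAddCommGroup Z]
    [NormedSpace ℝ Z] (g : ℂ → Z) :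
    ∫ a, g a ∂noiseMeasure lam = ∫ a, noiseDensity lam a • g a := by
  rw [noiseMeasure, integral_withDensity_eq_integral_toReal_smul
    (continuous_noiseDensity lam).measurable.ennreal_ofReal
    (Eventually.of_forall fun _ => ENNReal.ofReal_lt_top)]
  simp only [ENNReal.toReal_ofReal (noiseDensity_nonneg hlam _)]

theorem integral_noiseDensity {lam : ℝ} (hlam : 0 < lam) : ∫ a, noiseDensity lam a = 1 := by
  have h1 := Complex.integral_exp_neg_mul_rpow (p := 2) (b := lam⁻¹) one_le_two (by positivity)
  have h2 : ∀ a : ℂ, noiseDensity lam a =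
      (Real.pi * lam)⁻¹ * Real.exp (-lam⁻¹ * ‖a‖ ^ (2 : ℝ)) := by
    intro a
    rw [noiseDensity, Real.rpow_two]
    congr 2
    field_simp
  simp only [h2]
  rw [integral_const_mul, h1, div_self two_ne_zero, neg_div, div_self two_ne_zero,
    Real.rpow_neg_one, inv_inv, one_add_one_eq_two, Real.Gamma_two, mul_one,
    inv_mul_cancel₀ (mul_pos Real.pi_pos hlam).ne']

theorem isProbabilityMeasure_noiseMeasure {lam : ℝ} (hlam : 0 < lam) :
    IsProbabilityMeasure (noiseMeasure lam) := by
  refine ⟨?_⟩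
  have h1 := integral_noiseDensity hlam
  rw [noiseMeasure, withDensity_apply _ MeasurableSet.univ, Measure.restrict_univ,
    ← ofReal_integral_eq_lintegral_ofReal, h1, ENNReal.ofReal_one]
  -- If the density were not integrable its integral would take the default value `0`, not `1`.
  · by_contra h
    rw [integral_undef h] at h1
    exact zero_ne_one h1
  · exact Eventually.of_forall (noiseDensity_nonneg hlam)

theorem modeNoise_eq {m : ℕ} {lam : ℝ} (hlam : 0 < lam) (j : Fin m)
    (T : ModeSpace m →L[ℂ] ModeSpace m) :
    modeNoise lam j T = ∫ a, displacementChannel (Pi.single j a) T ∂noiseMeasure lam := by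
  rw [integral_noiseMeasure hlam, modeNoise, ← integral_smul]
  simp only [smul_smul, noiseDensity]

/-- Resampling one coordinate of an i.i.d. vector does not change its law; equality of measures is
checked on boxes. -/
theorem measurePreserving_update {ι X : Type*} [Fintype ι] [DecidableEq ι] [MeasurableSpace X]
    (μ : Measure X) [IsProbabilityMeasure μ] (j : ι) :
    MeasurePreserving (fun p : X × (ι → X) => Function.update p.2 j p.1)
      (μ.prod (Measure.pi fun _ => μ)) (Measure.pi fun _ => μ) := by
  have hm : Measurable fun p : X × (ι → X) => Function.update p.2 j p.1 := by
    refine measurable_pi_lambda _ fun i => ?_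
    by_cases hi : i = j
    · subst hi
      simpa only [Function.update_self] using measurable_fst
    · simp only [Function.update_of_ne hi]
      exact (measurable_pi_apply i).comp measurable_snd
  refine ⟨hm, (Measure.pi_eq fun s hs => ?_).symm⟩
  rw [Measure.map_apply hm (MeasurableSet.univ_pi hs)]
  have h1 : (fun p : X × (ι → X) => Function.update p.2 j p.1) ⁻¹' Set.univ.pi s =
      s j ×ˢ Set.univ.pi (Function.update s j Set.univ) := by
    ext ⟨a, x⟩
    simp only [Set.mem_preimage, Set.mem_pi, Set.mem_univ, true_imp_iff, Set.mem_prod]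
    constructor
    · intro h
      refine ⟨by simpa using h j, fun i => ?_⟩
      by_cases hi : i = j
      · subst hi
        simp
      · simpa [hi] using h i
    · rintro ⟨h1, h2⟩ i
      by_cases hi : i = j
      · subst hi
        simpa using h1
      · simpa [hi] using h2 i
  rw [h1, Measure.prod_prod, Measure.pi_pi,
    ← Finset.mul_prod_erase Finset.univ (fun i => μ (Function.update s j Set.univ i))
      (Finset.mem_univ j),
    ← Finset.mul_prod_erase Finset.univ (fun i => μ (s i)) (Finset.mem_univ j),
    Function.update_self, measure_univ, one_mul]
  congr 1
  refine Finset.prod_congr rfl fun i hi => ?_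
  rw [Function.update_of_ne (Finset.ne_of_mem_erase hi)]

variable {m : ℕ} {R : Type*} [NormedAddCommGroup R] [InnerProductSpace ℂ R]

/-- The displacement channel as a continuous linear map. -/
def displacementChannelL (α : Fin m → ℂ) :
    (ModeSpace m →L[ℂ] ModeSpace m) →L[ℂ] (ModeSpace m →L[ℂ] ModeSpace m) :=
  ContinuousLinearMap.mulLeftRight ℂ _ (displacement α) (displacement α).adjoint

theorem displacementChannelL_apply (α : Fin m → ℂ) (T : ModeSpace m →L[ℂ] ModeSpace m) :
    displacementChannelL α T = displacementChannel α T := rfl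

theorem norm_displacementChannel_le (α : Fin m → ℂ) (T : ModeSpace m →L[ℂ] ModeSpace m) :
    ‖displacementChannel α T‖ ≤ ‖T‖ := by
  refine ContinuousLinearMap.opNorm_le_bound _ (norm_nonneg T) fun x => ?_
  rw [displacementChannel_apply, displacement_norm, ← displacement_norm (-α) x]
  exact T.le_opNorm _

/-- The slice as a continuous linear map. -/
def sliceL (e f : R) : (HTensor R (ModeSpace m) →L[ℂ] HTensor R (ModeSpace m)) →L[ℂ]
    (ModeSpace m →L[ℂ] ModeSpace m) :=
  (ContinuousLinearMap.compL ℂ (ModeSpace m) (HTensor R (ModeSpace m)) (ModeSpace m)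
    (ketTensor e).adjoint) ∘L
  (ContinuousLinearMap.compL ℂ (ModeSpace m) (HTensor R (ModeSpace m))
    (HTensor R (ModeSpace m))).flip (ketTensor f)

theorem sliceL_apply (e f : R) (T : HTensor R (ModeSpace m) →L[ℂ] HTensor R (ModeSpace m)) :
    sliceL e f T = slice T e f := rfl

/-- The distribution of the random displacement of `m` modes. -/
def modesMeasure (m : ℕ) (lam : ℝ) : Measure (Fin m → ℂ) := Measure.pi fun _ => noiseMeasure lam

theorem isProbabilityMeasure_modesMeasure (m : ℕ) {lam : ℝ} (hlam : 0 < lam) :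
    IsProbabilityMeasure (modesMeasure m lam) := by
  have := isProbabilityMeasure_noiseMeasure hlam
  unfold modesMeasure
  infer_instance

/-- The part of a displacement which acts on the modes in a list. -/
def restrictModes (l : List (Fin m)) (α : Fin m → ℂ) : Fin m → ℂ :=
  fun i => if i ∈ l then α i else 0

theorem continuous_restrictModes (l : List (Fin m)) : Continuous (restrictModes l) := by
  refine continuous_pi fun i => ?_
  unfold restrictModes
  by_cases h : i ∈ l
  · simpa only [h, if_true] using continuous_apply i
  · simpa only [h, if_false] using continuous_const

/-- Induction over the modes. The outer integral supplies a fresh coordinate `j`, on which the inner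
integrand does not depend since `j ∉ l`; Fubini and the resampling invariance merge the two
integrals into one. -/
theorem foldr_modeNoise {lam : ℝ} (hlam : 0 < lam) {T : ModeSpace m →L[ℂ] ModeSpace m}
    (hT : Continuous fun α => displacementChannel α T) (l : List (Fin m)) (hl : l.Nodup) :
    l.foldr (fun j S => modeNoise lam j S) T =
      ∫ α, displacementChannel (restrictModes l α) T ∂modesMeasure m lam := by
  have hp1 := isProbabilityMeasure_noiseMeasure hlam
  have hp2 := isProbabilityMeasure_modesMeasure m hlam
  induction l with
  | nil =>
    have h1 : ∀ α : Fin m → ℂ, displacementChannel (restrictModes [] α) T = T := by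
      intro α
      have h2 : restrictModes [] α = (0 : Fin m → ℂ) := by
        funext i
        simp [restrictModes]
      ext1 ψ
      rw [h2, displacementChannel_apply, neg_zero, displacement_zero, displacement_zero]
    simp [h1]
  | cons j l ih =>
    rw [List.nodup_cons] at hl
    have hint : ∀ {X : Type} [TopologicalSpace X] [SecondCountableTopology X] [MeasurableSpace X]
        [BorelSpace X] (μ : Measure X) [IsProbabilityMeasure μ] (β : X → Fin m → ℂ),
        Continuous β → Integrable (fun x => displacementChannel (β x) T) μ := by
      intro X _ _ _ _ μ _ β hβ
      refine Integrable.mono' (integrable_const ‖T‖) (hT.comp hβ).aestronglyMeasurable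
        (Eventually.of_forall fun x => norm_displacementChannel_le _ _)
    have hup : ∀ p : ℂ × (Fin m → ℂ), Pi.single j p.1 + restrictModes l p.2 =
        restrictModes (j :: l) (Function.update p.2 j p.1) := by
      intro p
      funext i
      by_cases hi : i = j
      · subst hi
        simp [restrictModes, hl.1]
      · simp [restrictModes, hi]
    rw [List.foldr_cons, ih hl.2, modeNoise_eq hlam]
    have h1 : ∀ a : ℂ, displacementChannel (Pi.single j a)
        (∫ α, displacementChannel (restrictModes l α) T ∂modesMeasure m lam) =
        ∫ α, displacementChannel (restrictModes (j :: l) (Function.update α j a)) T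
          ∂modesMeasure m lam := by
      intro a
      rw [← displacementChannelL_apply, ← ContinuousLinearMap.integral_comp_comm _
        (hint _ _ (continuous_restrictModes l))]
      refine integral_congr_ae (Eventually.of_forall fun α => ?_)
      simp only [displacementChannelL_apply, displacementChannel_displacementChannel]
      rw [hup (a, α)]
    simp only [h1]
    have hmp := measurePreserving_update (noiseMeasure lam) j
    have hc : Continuous fun p : ℂ × (Fin m → ℂ) =>
        restrictModes (j :: l) (Function.update p.2 j p.1) :=
      (continuous_restrictModes _).comp (continuous_snd.update j continuous_fst)
    rw [← integral_prod (μ := noiseMeasure lam) (ν := modesMeasure m lam)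
      (fun p => displacementChannel (restrictModes (j :: l) (Function.update p.2 j p.1)) T)
      (hint _ _ hc)]
    rw [modesMeasure, ← hmp.map_eq, integral_map hmp.measurable.aemeasurable, hmp.map_eq]
    exact (hT.comp (continuous_restrictModes _)).aestronglyMeasurable

theorem noiseChannel_eq_integral {lam : ℝ} (hlam : 0 < lam) {T : ModeSpace m →L[ℂ] ModeSpace m}
    (hT : Continuous fun α => displacementChannel α T) :
    noiseChannel lam T = ∫ α, displacementChannel α T ∂modesMeasure m lam := by
  have h : ∀ α : Fin m → ℂ, restrictModes (List.finRange m) α = α := fun α => by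
    funext i
    simp [restrictModes]
  rw [noiseChannel, foldr_modeNoise hlam hT _ (List.nodup_finRange m)]
  simp only [h]

end Noise

section ChiSquare

open Filter Topology

/-! ### The chi-square distribution of the amplitude -/

theorem modesMeasure_eq_withDensity (m : ℕ) {lam : ℝ} (hlam : 0 < lam) :
    modesMeasure m lam = volume.withDensity fun α : Fin m → ℂ =>
      ENNReal.ofReal (∏ j, noiseDensity lam (α j)) := by
  have hp := isProbabilityMeasure_noiseMeasure hlam
  have hi : Integrable (noiseDensity lam) := by
    refine Integrable.of_integral_ne_zero ?_
    rw [integral_noiseDensity hlam]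
    exact one_ne_zero
  refine Measure.pi_eq fun s hs => ?_
  have h1 : ∀ j, noiseMeasure lam (s j) = ENNReal.ofReal (∫ a in s j, noiseDensity lam a) := by
    intro j
    rw [noiseMeasure, withDensity_apply _ (hs j), ofReal_integral_eq_lintegral_ofReal
      hi.integrableOn
      (Eventually.of_forall (noiseDensity_nonneg hlam))]
  have h2 : Measure.pi (fun j => (volume : Measure ℂ).restrict (s j)) =
      (volume : Measure (Fin m → ℂ)).restrict (Set.univ.pi s) := (Measure.restrict_pi_pi _ s).symm
  rw [withDensity_apply _ (MeasurableSet.univ_pi hs), ← h2, ← ofReal_integral_eq_lintegral_ofReal,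
    integral_fintype_prod_eq_prod, ENNReal.ofReal_prod_of_nonneg]
  · exact Finset.prod_congr rfl fun j _ => (h1 j).symm
  · exact fun j _ => integral_nonneg (noiseDensity_nonneg hlam)
  · exact Integrable.fintype_prod fun j => hi.integrableOn
  · exact Eventually.of_forall fun α => Finset.prod_nonneg fun j _ => noiseDensity_nonneg hlam _

theorem prod_noiseDensity {m : ℕ} (lam : ℝ) (α : Fin m → ℂ) :
    ∏ j, noiseDensity lam (α j) = (Real.pi * lam)⁻¹ ^ m * Real.exp (-ampl α ^ 2 / lam) := by
  simp only [noiseDensity]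
  rw [Finset.prod_mul_distrib, Finset.prod_const, Finset.card_univ, Fintype.card_fin,
    ← Real.exp_sum, ampl_sq, ← Finset.sum_div, Finset.sum_neg_distrib]

theorem integral_modesMeasure {m : ℕ} {lam : ℝ} (hlam : 0 < lam) (g : ℝ → ℝ) :
    ∫ α, g (ampl α) ∂modesMeasure m lam =
      ∫ α : Fin m → ℂ, (Real.pi * lam)⁻¹ ^ m * Real.exp (-ampl α ^ 2 / lam) * g (ampl α) := by
  have hc : Measurable fun α : Fin m → ℂ => ∏ j, noiseDensity lam (α j) :=
    (continuous_finsetProd _ fun j _ =>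
      (continuous_noiseDensity lam).comp (continuous_apply j)).measurable
  rw [modesMeasure_eq_withDensity m hlam, integral_withDensity_eq_integral_toReal_smul
    hc.ennreal_ofReal (Eventually.of_forall fun _ => ENNReal.ofReal_lt_top)]
  refine integral_congr_ae (Eventually.of_forall fun α => ?_)
  simp only
  rw [ENNReal.toReal_ofReal (Finset.prod_nonneg fun j _ => noiseDensity_nonneg hlam _),
    prod_noiseDensity, smul_eq_mul]

/-- Polar coordinates in real dimension `2m`, after replacing the supremum norm of the function
space by the Euclidean one. The sphere constant need not be evaluated: it is fixed later by
normalisation. -/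
theorem exists_integral_ampl (m : ℕ) (hm : 1 ≤ m) :
    ∃ C : ℝ, ∀ g : ℝ → ℝ, ∫ α : Fin m → ℂ, g (ampl α) =
      C * ∫ y in Set.Ioi (0 : ℝ), y ^ (2 * m - 1) * g y := by
  set e : (Fin m → ℂ) ≃L[ℝ] EuclideanSpace ℂ (Fin m) :=
    (PiLp.continuousLinearEquiv 2 ℝ (fun _ : Fin m => ℂ)).symm with he
  have hfin : Module.finrank ℝ (EuclideanSpace ℂ (Fin m)) = 2 * m := by
    rw [← e.toLinearEquiv.finrank_eq, Module.finrank_pi_fintype]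
    simp [mul_comm]
  have hnt : Nontrivial (EuclideanSpace ℂ (Fin m)) :=
    Module.nontrivial_of_finrank_pos (R := ℝ) (by omega)
  have hnorm : ∀ α : Fin m → ℂ, ‖e α‖ = ampl α := fun α => EuclideanSpace.norm_eq _
  refine ⟨(2 * m : ℕ) * ((volume : Measure (Fin m → ℂ)).map e).real (Metric.ball 0 1),
    fun g => ?_⟩
  have h1 := integral_fun_norm_addHaar ((volume : Measure (Fin m → ℂ)).map e) g
  have h2 : ∫ x, g ‖x‖ ∂((volume : Measure (Fin m → ℂ)).map e) =
      ∫ α : Fin m → ℂ, g (ampl α) := by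
    refine (e.toHomeomorph.measurableEmbedding.integral_map fun x => g ‖x‖).trans ?_
    exact integral_congr_ae (Eventually.of_forall fun α => congrArg g (hnorm α))
  rw [h2, hfin] at h1
  rw [h1, smul_eq_mul, nsmul_eq_mul, ← mul_assoc]
  rfl

theorem integral_pow_mul_eq (m : ℕ) (hm : 1 ≤ m) {b : ℝ} (hb : 0 < b) (g : ℝ → ℝ) :
    ∫ y in Set.Ioi (0 : ℝ), y ^ (2 * m - 1) * g y =
      b ^ m / 2 * ∫ x in Set.Ioi (0 : ℝ), x ^ (m - 1) * g (Real.sqrt (b * x)) := by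
  have h1 := integral_comp_rpow_Ioi_of_pos (g := fun y => y ^ (2 * m - 1) * g y)
    (p := 1 / 2) (by norm_num)
  have h2 := integral_comp_mul_left_Ioi (fun x => x ^ (m - 1) * g (Real.sqrt x)) 0 hb
  rw [← h1]
  have h3 : ∫ x in Set.Ioi (0 : ℝ), (1 / 2 * x ^ (1 / 2 - 1 : ℝ)) •
      ((x ^ (1 / 2 : ℝ)) ^ (2 * m - 1) * g (x ^ (1 / 2 : ℝ))) =
      ∫ x in Set.Ioi (0 : ℝ), 1 / 2 * (x ^ (m - 1) * g (Real.sqrt x)) := by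
    refine setIntegral_congr_fun measurableSet_Ioi fun x hx => ?_
    have hx0 : 0 < x := hx
    -- The Jacobian of `y = √x` accounts for the exponents: `-1/2 + (2m - 1)/2 = m - 1`.
    have h4 : x ^ (1 / 2 - 1 : ℝ) * (x ^ (1 / 2 : ℝ)) ^ (2 * m - 1) = x ^ (m - 1) := by
      rw [← Real.rpow_natCast, ← Real.rpow_mul hx0.le, ← Real.rpow_add hx0, ← Real.rpow_natCast]
      congr 1
      rw [Nat.cast_sub (by omega), Nat.cast_sub hm]
      push_cast
      ring
    simp only [smul_eq_mul]
    rw [← h4, Real.sqrt_eq_rpow]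
    ring
  rw [h3, integral_const_mul]
  have h5 : ∫ x in Set.Ioi (0 : ℝ), (b * x) ^ (m - 1) * g (Real.sqrt (b * x)) =
      b ^ (m - 1) * ∫ x in Set.Ioi (0 : ℝ), x ^ (m - 1) * g (Real.sqrt (b * x)) := by
    rw [← integral_const_mul]
    refine integral_congr_ae (Eventually.of_forall fun x => ?_)
    simp only
    rw [mul_pow, mul_assoc]
  rw [mul_zero, h5, smul_eq_mul] at h2
  have h6 : b ^ m = b ^ (m - 1) * b := by rw [← pow_succ, Nat.sub_add_cancel hm]
  rw [h6]
  have h7 : ∫ x in Set.Ioi (0 : ℝ), x ^ (m - 1) * g (Real.sqrt x) =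
      b * (b ^ (m - 1) * ∫ x in Set.Ioi (0 : ℝ), x ^ (m - 1) * g (Real.sqrt (b * x))) := by
    rw [h2, ← mul_assoc, mul_inv_cancel₀ hb.ne', one_mul]
  rw [h7]
  ring

theorem integral_rpow_mul_exp_half {a : ℝ} (ha : 0 < a) :
    ∫ x in Set.Ioi (0 : ℝ), x ^ (a - 1) * Real.exp (-x / 2) = 2 ^ a * Real.Gamma a := by
  have h1 := Real.integral_rpow_mul_exp_neg_mul_Ioi ha (r := 1 / 2) (by norm_num)
  rw [one_div_one_div] at h1
  rw [← h1]
  refine integral_congr_ae (Eventually.of_forall fun x => ?_)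
  simp only
  congr 2
  ring

theorem integrableOn_rpow_mul_exp_half {a : ℝ} (ha : 0 < a) :
    IntegrableOn (fun x : ℝ => x ^ (a - 1) * Real.exp (-x / 2)) (Set.Ioi 0) := by
  refine Integrable.of_integral_ne_zero ?_
  rw [integral_rpow_mul_exp_half ha]
  have := Real.Gamma_pos_of_pos ha
  positivity

theorem chiSqDensity_eq {m : ℕ} (hm : 1 ≤ m) (x : ℝ) :
    chiSqDensity m x =
      (2 ^ m * Real.Gamma m)⁻¹ * (x ^ ((m : ℝ) - 1) * Real.exp (-x / 2)) := by
  rw [chiSqDensity, div_eq_inv_mul, ← Real.rpow_natCast x, Nat.cast_sub hm, Nat.cast_one]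

theorem Gamma_natCast_pos {m : ℕ} (hm : 1 ≤ m) : 0 < Real.Gamma m :=
  Real.Gamma_pos_of_pos (by exact_mod_cast hm)

theorem integrableOn_chiSqDensity {m : ℕ} (hm : 1 ≤ m) :
    IntegrableOn (chiSqDensity m) (Set.Ioi 0) := by
  have h1 := (integrableOn_rpow_mul_exp_half (a := m) (by exact_mod_cast hm)).const_mul
    (2 ^ m * Real.Gamma m)⁻¹
  exact h1.congr (Eventually.of_forall fun x => (chiSqDensity_eq hm x).symm)

theorem integral_chiSqDensity {m : ℕ} (hm : 1 ≤ m) :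
    ∫ x in Set.Ioi (0 : ℝ), chiSqDensity m x = 1 := by
  simp only [chiSqDensity_eq hm]
  rw [integral_const_mul, integral_rpow_mul_exp_half (by exact_mod_cast hm), Real.rpow_natCast]
  have := Gamma_natCast_pos hm
  exact inv_mul_cancel₀ (by positivity)

theorem chiSqDensity_nonneg {m : ℕ} (hm : 1 ≤ m) {x : ℝ} (hx : 0 ≤ x) : 0 ≤ chiSqDensity m x := by
  have := Gamma_natCast_pos hm
  unfold chiSqDensity
  positivity

/-- The substitution `y = √(λx/2)` turns the radial Gaussian weight into a multiple of the
chi-square density. Testing with `g = 1` shows that the multiple is one, both sides being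
probability laws. -/
theorem integral_ampl_modesMeasure {m : ℕ} (hm : 1 ≤ m) {lam : ℝ} (hlam : 0 < lam) (g : ℝ → ℝ) :
    ∫ α, g (ampl α) ∂modesMeasure m lam =
      ∫ x in Set.Ioi (0 : ℝ), chiSqDensity m x * g (Real.sqrt (lam * x / 2)) := by
  obtain ⟨C, hC⟩ := exists_integral_ampl m hm
  have key : ∃ C' : ℝ, ∀ g : ℝ → ℝ, ∫ α, g (ampl α) ∂modesMeasure m lam =
      C' * ∫ x in Set.Ioi (0 : ℝ), chiSqDensity m x * g (Real.sqrt (lam * x / 2)) := by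
    have hG := Gamma_natCast_pos hm
    refine ⟨C * ((lam / 2) ^ m / 2) * ((Real.pi * lam)⁻¹ ^ m * (2 ^ m * Real.Gamma m)),
      fun g => ?_⟩
    rw [integral_modesMeasure hlam, hC fun y =>
      (Real.pi * lam)⁻¹ ^ m * Real.exp (-y ^ 2 / lam) * g y,
      integral_pow_mul_eq m hm (b := lam / 2) (by positivity), ← mul_assoc,
      mul_assoc (C * ((lam / 2) ^ m / 2)) _ (∫ _, _ ∂_)]
    congr 1
    rw [← integral_const_mul]
    refine setIntegral_congr_fun measurableSet_Ioi fun x hx => ?_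
    have hx0 : 0 < x := hx
    rw [Real.sq_sqrt (by positivity), chiSqDensity, show -(lam / 2 * x) / lam = -x / 2 by
      field_simp, show lam / 2 * x = lam * x / 2 by ring]
    field_simp
  obtain ⟨C', hC'⟩ := key
  have hp := isProbabilityMeasure_modesMeasure m hlam
  have h1 := hC' fun _ => 1
  simp only [mul_one, integral_chiSqDensity hm, integral_const, probReal_univ, smul_eq_mul] at h1
  rw [hC', ← h1, one_mul]

theorem gain_le_one (r E : ℝ) : gain r E ≤ 1 := Real.sin_le_one _

theorem continuous_gain (E : ℝ) : Continuous fun r => gain r E := by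
  unfold gain
  fun_prop

theorem integrableOn_chiSqDensity_mul_gain {m : ℕ} (hm : 1 ≤ m) (lam E : ℝ) :
    IntegrableOn (fun x => chiSqDensity m x * gain (Real.sqrt (lam * x / 2)) E) (Set.Ioi 0) := by
  refine (integrableOn_chiSqDensity hm).mul_bdd (c := 1) ?_ (Eventually.of_forall fun x => ?_)
  · exact ((continuous_gain E).comp (by fun_prop)).aestronglyMeasurable
  · rw [Real.norm_of_nonneg (gain_nonneg (Real.sqrt_nonneg _) E)]
    exact gain_le_one _ _

/-- After `sin t ≤ t` there remains the chi-square mean of `√x`, which is `√2 Γ(m + 1/2)/Γ(m)`; its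
`√2` cancels that of `√(λ/2)`. -/
theorem integral_chiSqDensity_mul_gain_le {m : ℕ} (hm : 1 ≤ m) {lam : ℝ} (hlam : 0 < lam) (E : ℝ) :
    ∫ x in Set.Ioi (0 : ℝ), chiSqDensity m x * gain (Real.sqrt (lam * x / 2)) E ≤
      Real.Gamma (m + 1 / 2) / (m - 1).factorial * gammaE E * Real.sqrt lam := by
  have hG := Gamma_natCast_pos hm
  set c : ℝ := (2 ^ m * Real.Gamma m)⁻¹ * gammaE E * Real.sqrt (lam / 2) with hc
  have ha : (0 : ℝ) < m + 1 / 2 := by positivity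
  have h1 := (integrableOn_rpow_mul_exp_half ha).const_mul c
  have h2 : ∀ x ∈ Set.Ioi (0 : ℝ), chiSqDensity m x * gain (Real.sqrt (lam * x / 2)) E ≤
      c * (x ^ ((m : ℝ) + 1 / 2 - 1) * Real.exp (-x / 2)) := by
    intro x hx
    have hx0 : 0 < x := hx
    have h3 : gain (Real.sqrt (lam * x / 2)) E ≤ gammaE E * Real.sqrt (lam * x / 2) :=
      (Real.sin_le (gain_arg_mem (Real.sqrt_nonneg _) E).1).trans (min_le_left _ _)
    refine (mul_le_mul_of_nonneg_left h3 (chiSqDensity_nonneg hm hx0.le)).trans (le_of_eq ?_)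
    rw [chiSqDensity_eq hm, show lam * x / 2 = lam / 2 * x by ring,
      Real.sqrt_mul (by positivity), show (m + 1 / 2 - 1 : ℝ) = (m - 1) + 1 / 2 by ring,
      Real.rpow_add hx0, ← Real.sqrt_eq_rpow, hc]
    ring
  refine (setIntegral_mono_on (integrableOn_chiSqDensity_mul_gain hm lam E) h1
    measurableSet_Ioi h2).trans (le_of_eq ?_)
  rw [integral_const_mul, integral_rpow_mul_exp_half ha, hc, Real.rpow_add two_pos,
    Real.rpow_natCast, ← Real.sqrt_eq_rpow, Real.sqrt_div' _ zero_le_two]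
  have h4 : Real.Gamma m = (m - 1).factorial := by
    have := Real.Gamma_nat_eq_factorial (m - 1)
    rwa [Nat.cast_sub hm, Nat.cast_one, sub_add_cancel] at this
  rw [← h4]
  field_simp

end ChiSquare

/-! ### Averaging over displacements and assembling the bounds -/

section OperatorIntegral

open Filter Topology

/-! ### Integrals of operator valued functions -/

theorem isSelfAdjoint_integral {X A : Type*} [MeasurableSpace X] {μ : Measure X}
    [NonUnitalCStarAlgebra A] {f : X → A} (hf : ∀ x, IsSelfAdjoint (f x)) :
    IsSelfAdjoint (∫ x, f x ∂μ) := by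
  have h := (starL' ℝ : A ≃L[ℝ] A).integral_comp_comm (μ := μ) f
  simp only [starL'_apply] at h
  rw [isSelfAdjoint_iff, ← h]
  exact integral_congr_ae (Eventually.of_forall fun x => hf x)

variable {K : Type*} [NormedAddCommGroup K] [InnerProductSpace ℂ K] [CompleteSpace K]
  {X : Type*} [TopologicalSpace X] [SecondCountableTopology X] [MeasurableSpace X]
  [OpensMeasurableSpace X] {μ : Measure X} [IsProbabilityMeasure μ]

theorem integrable_of_continuous_of_norm_le {Z : Type*} [NormedAddCommGroup Z] {f : X → Z}
    (hc : Continuous f) {C : ℝ} (hb : ∀ x, ‖f x‖ ≤ C) : Integrable f μ :=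
  Integrable.mono' (integrable_const C) hc.aestronglyMeasurable (Eventually.of_forall hb)

theorem comp_integral_comp {H : Type*} [NormedAddCommGroup H] [InnerProductSpace ℂ H]
    [CompleteSpace H] {f : X → K →L[ℂ] K} (hc : Continuous f) {C : ℝ} (hb : ∀ x, ‖f x‖ ≤ C)
    (A : K →L[ℂ] H) (B : H →L[ℂ] K) :
    A ∘L (∫ x, f x ∂μ) ∘L B = ∫ x, A ∘L f x ∘L B ∂μ :=
  ((ContinuousLinearMap.compL ℂ H K H A ∘L
    (ContinuousLinearMap.compL ℂ H K K).flip B).integral_comp_comm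
    (integrable_of_continuous_of_norm_le hc hb)).symm

/-- The functional `T ↦ ∑_{i ∈ F} ⟨W eᵢ, T eᵢ⟩`. -/
def pairing (W : K →L[ℂ] K) (F : Finset (basisIndex K)) : (K →L[ℂ] K) →L[ℂ] ℂ :=
  ∑ i ∈ F, innerSL ℂ (W (stdBasis K i)) ∘L ContinuousLinearMap.apply ℂ K (stdBasis K i)

theorem pairing_apply (W : K →L[ℂ] K) (F : Finset (basisIndex K)) (T : K →L[ℂ] K) :
    pairing W F T = ∑ i ∈ F, ⟪W (stdBasis K i), T (stdBasis K i)⟫_ℂ := by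
  simp [pairing]

/-- Convexity of the trace norm for an integral that converges only in operator norm: each finite
pairing is a continuous functional, so it passes inside the integral before the supremum over
pairings is taken. -/
theorem traceNorm_integral_sub_le {f : X → K →L[ℂ] K} (hc : Continuous f) {C : ℝ}
    (hb : ∀ x, ‖f x‖ ≤ C) {T : K →L[ℂ] K} (hT : IsSelfAdjoint T) (hf : ∀ x, IsSelfAdjoint (f x))
    {g : X → ℝ} (hg : Integrable g μ)
    (h : ∀ x, ∀ W : K →L[ℂ] K, IsSelfAdjoint W → ‖W‖ ≤ 1 → ∀ F : Finset (basisIndex K),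
      ‖pairing W F (f x - T)‖ ≤ g x) :
    traceNorm (∫ x, f x ∂μ - T) ≤ ENNReal.ofReal (∫ x, g x ∂μ) := by
  have hi : Integrable f μ := integrable_of_continuous_of_norm_le hc hb
  have hX : ∫ x, f x ∂μ - T = ∫ x, (f x - T) ∂μ := by
    rw [integral_sub hi (integrable_const T), integral_const, probReal_univ, one_smul]
  rw [hX]
  refine traceNorm_le_of_sum_le (isSelfAdjoint_integral fun x => (hf x).sub hT)
    fun W hW hW1 F => ?_
  rw [← map_sum, ← pairing_apply]
  refine (RCLike.re_le_norm _).trans ?_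
  have hi' : Integrable (fun x => f x - T) μ := hi.sub (integrable_const T)
  rw [← ContinuousLinearMap.integral_comp_comm _ hi']
  exact norm_integral_le_of_norm_le hg (Eventually.of_forall fun x => h x W hW hW1 F)

end OperatorIntegral

section Main

open Filter Topology

/-! ### Continuity bounds for the Gaussian noise channel -/

variable {m : ℕ} {R : Type*} [NormedAddCommGroup R] [InnerProductSpace ℂ R]

/-- The state `(I ⊗ 𝒩_λ^{⊗m})(ρ)`. -/
def noisyState (lam : ℝ) (ρ : HTensor R (ModeSpace m) →L[ℂ] HTensor R (ModeSpace m)) :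
    HTensor R (ModeSpace m) →L[ℂ] HTensor R (ModeSpace m) :=
  ∫ α, ampChannel α ρ ∂modesMeasure m lam

/-- Slicing is continuous and linear, so it commutes with the integral, and it intertwines `1 ⊗
D(α)` with `D(α)`. Continuity of the sliced integrand is what permits rewriting the noise channel as
one integral. -/
theorem isAmpliation_noisyState {lam : ℝ} (hlam : 0 < lam)
    {ρ : HTensor R (ModeSpace m) →L[ℂ] HTensor R (ModeSpace m)}
    (hc : Continuous fun α : Fin m → ℂ => ampChannel α ρ) :
    IsAmpliation (noiseChannel lam) ρ (noisyState lam ρ) := by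
  intro e f
  have hc' : Continuous fun α : Fin m → ℂ => displacementChannel α (slice ρ e f) := by
    simp only [← slice_ampChannel]
    exact (sliceL (m := m) e f).continuous.comp hc
  have hp := isProbabilityMeasure_modesMeasure m hlam
  rw [noiseChannel_eq_integral hlam hc']
  simp only [← slice_ampChannel]
  exact comp_integral_comp (K := HTensor R (ModeSpace m)) hc (fun α => norm_ampChannel_le α ρ) _ _

theorem IsAmpliation.sub_self
    {L : (ModeSpace m →L[ℂ] ModeSpace m) → (ModeSpace m →L[ℂ] ModeSpace m)}
    {T X : HTensor R (ModeSpace m) →L[ℂ] HTensor R (ModeSpace m)} (h : IsAmpliation L T X) :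
    IsAmpliation (fun S => L S - S) T (X - T) := by
  intro e f
  rw [← sliceL_apply, map_sub, sliceL_apply, sliceL_apply, h]

variable [CompleteSpace R]

/-- The same decomposition, displaced vector by vector, represents both states, so the pairing
becomes a series of the differences controlled by the speed limit and Jensen's inequality. -/
theorem norm_pairing_ampChannel_sub_le {ρ : HTensor R (ModeSpace m) →L[ℂ] HTensor R (ModeSpace m)}
    (hρ : IsState ρ) {E : ℝ} (hE : 0 ≤ E) (henergy : meanPhotonNumber (partialTrace ρ) ≤
      ENNReal.ofReal (E + ∑ j, ‖meanAmplitude (partialTrace ρ) j‖ ^ 2)) (α : Fin m → ℂ)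
    {W : HTensor R (ModeSpace m) →L[ℂ] HTensor R (ModeSpace m)} (hW : IsSelfAdjoint W)
    (hW1 : ‖W‖ ≤ 1) (F : Finset (basisIndex (HTensor R (ModeSpace m)))) :
    ‖pairing W F (ampChannel α ρ - ρ)‖ ≤ 2 * gain (ampl α) E := by
  obtain ⟨v, hv, hv1⟩ := hρ.exists_decomposition
  have h1 := ((hv.ampChannel α).hasSum_cutoff W F).sub (hv.hasSum_cutoff W F)
  have h2 := hv.norm_tsum_sub_le hv1 hE henergy α (cutoff W F) (norm_cutoff_le hW hW1 F)
  have h3 := summable_of_sum_le (fun _ => norm_nonneg _) h2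
  rw [map_sub, pairing_apply, pairing_apply, ← h1.tsum_eq]
  exact (norm_tsum_le_tsum_norm h3).trans (Summable.tsum_le_of_sum_le h3 h2)

theorem continuous_ampl : Continuous (ampl : (Fin m → ℂ) → ℝ) := by
  unfold ampl
  fun_prop

theorem integrable_gain_ampl {lam : ℝ} (hlam : 0 < lam) (E : ℝ) :
    Integrable (fun α => gain (ampl α) E) (modesMeasure m lam) := by
  have hp := isProbabilityMeasure_modesMeasure m hlam
  refine Integrable.mono' (integrable_const 1)
    ((continuous_gain E).comp continuous_ampl).aestronglyMeasurable
    (Eventually.of_forall fun α => ?_)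
  rw [Real.norm_of_nonneg (gain_nonneg (ampl_nonneg α) E)]
  exact gain_le_one _ _

theorem traceNorm_noisyState_sub_le (hm : 1 ≤ m)
    {ρ : HTensor R (ModeSpace m) →L[ℂ] HTensor R (ModeSpace m)}
    (hρ : IsState ρ) {E : ℝ} (hE : 0 ≤ E) (henergy : meanPhotonNumber (partialTrace ρ) ≤
      ENNReal.ofReal (E + ∑ j, ‖meanAmplitude (partialTrace ρ) j‖ ^ 2)) {lam : ℝ} (hlam : 0 < lam) :
    traceNorm (noisyState lam ρ - ρ) ≤ ENNReal.ofReal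
      (2 * ∫ x in Set.Ioi (0 : ℝ), chiSqDensity m x * gain (Real.sqrt (lam * x / 2)) E) := by
  have hp := isProbabilityMeasure_modesMeasure m hlam
  obtain ⟨v, hv, -⟩ := hρ.exists_decomposition
  have hsa : IsSelfAdjoint ρ := hρ.1.isSelfAdjoint
  rw [← integral_ampl_modesMeasure hm hlam fun r => gain r E, ← integral_const_mul]
  exact traceNorm_integral_sub_le (K := HTensor R (ModeSpace m)) hv.continuous_ampChannel
    (fun α => norm_ampChannel_le α ρ) hsa (fun α => isSelfAdjoint_ampChannel α hsa)
    ((integrable_gain_ampl hlam E).const_mul 2)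
    fun α W hW hW1 F => norm_pairing_ampChannel_sub_le hρ hE henergy α hW hW1 F

theorem exists_isAmpliation_noiseChannel (hm : 1 ≤ m)
    {ρ : HTensor R (ModeSpace m) →L[ℂ] HTensor R (ModeSpace m)}
    (hρ : IsState ρ) {E : ℝ} (hE : 0 ≤ E) (henergy : meanPhotonNumber (partialTrace ρ) ≤
      ENNReal.ofReal (E + ∑ j, ‖meanAmplitude (partialTrace ρ) j‖ ^ 2)) {lam : ℝ} (hlam : 0 < lam) :
    ∃ ρ', IsAmpliation (noiseChannel lam) ρ ρ' ∧ traceNorm (ρ' - ρ) ≤ ENNReal.ofReal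
      (2 * ∫ x in Set.Ioi (0 : ℝ), chiSqDensity m x * gain (Real.sqrt (lam * x / 2)) E) := by
  obtain ⟨v, hv, -⟩ := hρ.exists_decomposition
  exact ⟨noisyState lam ρ, isAmpliation_noisyState hlam hv.continuous_ampChannel,
    traceNorm_noisyState_sub_le hm hρ hE henergy hlam⟩

theorem noiseParameter_pos {η : ℝ} (r : ℝ) (h0 : 0 < η) (h1 : η ≤ 1) : 0 < noiseParameter r η := by
  have h2 : 0 ≤ (1 - η ^ 2) / η ^ 2 := div_nonneg (by nlinarith) (sq_nonneg η)
  have h3 := Real.exp_pos (-2 * r)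
  unfold noiseParameter
  linarith

/-- A bound on the mean photon number implies the same bound on the centred energy, so the estimate
for individual states applies to each competitor in the supremum. -/
theorem ecDiamondNorm_noiseChannel_sub_le (hm : 1 ≤ m) {E : ℝ} (hE : 0 ≤ E) {lam : ℝ}
    (hlam : 0 < lam) :
    ecDiamondNorm.{u} (fun T => noiseChannel (m := m) lam T - T) E ≤ ENNReal.ofReal
      (2 * ∫ x in Set.Ioi (0 : ℝ), chiSqDensity m x * gain (Real.sqrt (lam * x / 2)) E) := by
  refine iSup_le fun R => iSup_le fun _ => iSup_le fun _ => iSup_le fun _ => iSup_le fun ρ =>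
    iSup_le fun hρ => iSup_le fun henergy => ?_
  have h1 : E ≤ E + ∑ j, ‖meanAmplitude (partialTrace ρ) j‖ ^ 2 :=
    le_add_of_nonneg_right (Finset.sum_nonneg fun _ _ => sq_nonneg _)
  obtain ⟨ρ', h2, h3⟩ := exists_isAmpliation_noiseChannel hm hρ hE
    (henergy.trans (ENNReal.ofReal_le_ofReal h1)) hlam
  exact (iInf₂_le (ρ' - ρ) h2.sub_self).trans h3

end Main

end BKTeleportation

end

open BKTeleportation in
theorem mainTheorem1 (m : ℕ) (hm : 1 ≤ m) (E : ℝ) (hE : 0 ≤ E) :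
    (∀ (R : Type u) [NormedAddCommGroup R] [InnerProductSpace ℂ R] [CompleteSpace R]
        (ρ : HTensor R (ModeSpace m) →L[ℂ] HTensor R (ModeSpace m)), IsState ρ →
        meanPhotonNumber (partialTrace ρ) ≤
          ENNReal.ofReal (E + ∑ j : Fin m, ‖meanAmplitude (partialTrace ρ) j‖ ^ 2) →
        ∀ r η : ℝ, 0 ≤ r → 0 < η → η ≤ 1 →
          ∃ ρ' : HTensor R (ModeSpace m) →L[ℂ] HTensor R (ModeSpace m),
            IsAmpliation (noiseChannel (noiseParameter r η)) ρ ρ' ∧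
            traceNorm (ρ' - ρ) ≤ ENNReal.ofReal
              (2 * ∫ x in Set.Ioi (0 : ℝ), chiSqDensity m x *
                Real.sin (min (gammaE E * Real.sqrt (noiseParameter r η * x / 2)) (Real.pi / 2))))
      ∧ (∀ lam : ℝ, 0 < lam →
          ecDiamondNorm.{u} (fun T => noiseChannel (m := m) lam T - T) E ≤ ENNReal.ofReal
            (2 * ∫ x in Set.Ioi (0 : ℝ), chiSqDensity m x *
              Real.sin (min (gammaE E * Real.sqrt (lam * x / 2)) (Real.pi / 2))))
      ∧ (∀ lam : ℝ, 0 < lam →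
          IntegrableOn (fun x => chiSqDensity m x *
            Real.sin (min (gammaE E * Real.sqrt (lam * x / 2)) (Real.pi / 2))) (Set.Ioi 0) ∧
          2 * (∫ x in Set.Ioi (0 : ℝ), chiSqDensity m x *
              Real.sin (min (gammaE E * Real.sqrt (lam * x / 2)) (Real.pi / 2))) ≤
            2 * Real.Gamma (m + 1 / 2) / (m - 1).factorial * gammaE E * Real.sqrt lam) := by
  refine ⟨fun R _ _ _ ρ hρ henergy r η _ h0 h1 => ?_, fun lam hlam => ?_, fun lam hlam => ⟨?_, ?_⟩⟩
  · exact exists_isAmpliation_noiseChannel hm hρ hE henergy (noiseParameter_pos r h0 h1)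
  · exact ecDiamondNorm_noiseChannel_sub_le hm hE hlam
  · exact integrableOn_chiSqDensity_mul_gain hm lam E
  · refine (mul_le_mul_of_nonneg_left (integral_chiSqDensity_mul_gain_le hm hlam E)
      zero_le_two).trans (le_of_eq ?_)
    ring
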